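/- **Setting.** Let $(\partial\colon E\to G,\triangleright)$ be a pre-crossed module of (finite-dimensional) Lie groups: $\partial$ is a smooth homomorphism, $\triangleright$ is a smooth left action of $G$ on $E$ by automorphisms, and $\partial(g\triangleright e)=g\,\partial(e)\,g^{-1}$. Let $\mathfrak g,\mathfrak e$ be the Lie algebras. Let $M$ be a smooth manifold, $\omega$ a smooth $\mathfrak g$-valued 1-form and $m$ a smooth $\mathfrak e$-valued 2-form on $M$ with $\partial(m)=\Omega$, where $\Omega=d\omega+[\omega,\omega]$ and $[\omega,\omega](X,Y)=[\omega(X),\omega(Y)]$. **Tracks.** For $n=1,2,3$ an *$n$-path* is a smooth map $\alpha\colon[0,1]^n\to M$ which, for some $\epsilon>0$, does not depend on the $i$-th coordinate $x_i$ for $x_i\le\epsilon$, nor for $x_i\ge 1-\epsilon$ ($i=1,\dots,n$), and which is constant on $\{x_1=0\}$ and on $\{x_1=1\}$. Write $\partial_i^-\alpha,\partial_i^+\alpha$ for the restrictions to $x_i=0$ and $x_i=1$, and $\natural_i$ for concatenation in the $i$-th coordinate. A *rank-1 homotopy* from $\gamma$ to $\phi$ is a 2-path $H$ with $\partial_2^-H=\gamma$,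 $\partial_2^+H=\phi$ and $\mathrm{Rank}\,\mathcal DH\le1$ everywhere. 2-paths $\Gamma,\Gamma'$ are *laminated rank-2 homotopic* if there is a 3-path $J(t,s,x)$ with $\partial_3^-J=\Gamma$, $\partial_3^+J=\Gamma'$, with $J(t,0,x)$ and $J(t,1,x)$ rank-1 homotopies, with $\mathrm{Rank}\,\mathcal DJ\le2$ everywhere, and such that for almost every $(s,x)\in(0,1)^2$ one of the following holds: (a) for $\zeta=s$ or for $\zeta=x$, $\mathrm{Rank}\,\mathcal D_{(t,\zeta)}J(t,s,x)\le1$ for all $t\in[0,1]$; (b) there are non-zero constants $a,b$ with $a\,\partial_sJ(t,s,x)+b\,\partial_xJ(t,s,x)=0$ for all $t\in[0,1]$. Let $\mathcal S_1(M)$ (1-tracks) be the set of 1-paths up to rank-1 homotopy and $\mathcal S_2^l(M)$ (laminated 2-tracks) the set of 2-paths up to laminated rank-2 homotopy. Points of $M$, 1-tracks and laminated 2-tracks have boundaries $\partial_1^\pm\colon\mathcal S_1(M)\to M$ and $\partial_2^\pm\colon\mathcal S_2^l(M)\to\mathcal S_1(M)$, identities (constant 1-paths, and $\mathrm{id}(\gamma)(t,s)=\gamma(t)$),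 composition $[\gamma]\natural_1[\phi]=[\gamma\natural_1\phi]$, vertical composition $[\Gamma]\natural_2[\Gamma']=[\Gamma\natural_2H\natural_2\Gamma']$ with $H$ any rank-1 homotopy from $\partial_2^+\Gamma$ to $\partial_2^-\Gamma'$, and whiskerings $[\gamma]\natural_1[\Gamma]=[\mathrm{id}(\gamma)\natural_1\Gamma]$ and $[\Gamma]\natural_1[\gamma]=[\Gamma\natural_1\mathrm{id}(\gamma)]$. In terms of these, there are two horizontal compositions of 2-morphisms, $(a\natural_1\partial_2^-b)\natural_2(\partial_2^+a\natural_1b)$ and $(\partial_2^-a\natural_1b)\natural_2(a\natural_1\partial_2^+b)$. **Target.** The pre-crossed module gives a structure of the same kind with a single object, morphisms $X\in G$ composed by multiplication, and 2-morphisms $(X,e)\in G\times E$ with $\partial_2^-(X,e)=X$, $\partial_2^+(X,e)=\partial(e)^{-1}X$, identities $(X,1)$, $(X,e)\natural_2(\partial(e)^{-1}X,f)=(X,ef)$, $X\natural_1(Y,e)=(XY,X\triangleright e)$ and $(Y,e)\natural_1X=(YX,e)$. **Holonomy.** For a 1-path $\gamma$ let $t\mapsto g^\omega_\gamma(0,t)\in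 G$ be the solution of $\frac{d}{dt}g=g\,\omega(\dot\gamma(t))$, $g(0)=1$, and $g^\omega_\gamma=g^\omega_\gamma(0,1)$. For a 2-path $\Gamma(t,s)=\gamma_s(t)$ let $s\mapsto e_\Gamma^{(\omega,m)}(0,s)\in E$ be the solution of $\frac{d}{ds}e=e\int_0^1g^\omega_{\gamma_s}(0,t)\triangleright m\left(\frac{\partial}{\partial t}\gamma_s(t),\frac{\partial}{\partial s}\gamma_s(t)\right)dt$, $e(0)=1$, and $e_\Gamma^{(\omega,m)}=e_\Gamma^{(\omega,m)}(0,1)$. **Theorem.** These differential equations have unique solutions, and the assignments $$\gamma\in\mathcal S_1(M)\mapsto g^\omega_\gamma\in G,\qquad \Gamma\in\mathcal S_2^l(M)\mapsto\left(g^\omega_{\partial_2^-(\Gamma)},\,e_\Gamma^{(\omega,m)}\right)\in G\times E$$ are well defined on tracks and strictly preserve all boundaries, identities, compositions of 1-morphisms, vertical compositions, whiskerings and both horizontal compositions of 2-morphisms; that is, they satisfy all the axioms of a morphism of Gray 3-groupoids which do not involve 3-morphisms (a morphism of sesquigroupoids). -/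

import Mathlib

open Set MeasureTheory
open scoped Manifold ContDiff

noncomputable section

namespace Holonomy

/-! ### 1-, 2- and 3-paths

A smooth map out of a cube with a product structure close to the boundary extends uniquely to a
smooth map on all of Euclidean space which only depends on the point of the cube obtained by
clamping every coordinate to `[0, 1]`. Paths are recorded through this extension, so that two
paths are equal exactly when they agree on the cube, and derivatives at boundary points of the
cube are the usual ones. -/

section Paths

variable (V : Type*) [NormedAddCommGroup V] [NormedSpace ℝ V]
variable (M : Type*) [TopologicalSpace M] [ChartedSpace V M]

/-- A 1-path: a smooth path with sitting instants. -/
@[ext]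
structure Path1 where
  toFun : ℝ → M
  smooth : ContMDiff 𝓘(ℝ, ℝ) 𝓘(ℝ, V) ∞ toFun
  collar : ∃ ε : ℝ, 0 < ε ∧
    (∀ t, t ≤ ε → toFun t = toFun 0) ∧ (∀ t, 1 - ε ≤ t → toFun t = toFun 1)

/-- A 2-path `(t, s) ↦ Γ (t, s)`. -/
@[ext]
structure Path2 where
  toFun : ℝ × ℝ → M
  smooth : ContMDiff 𝓘(ℝ, ℝ × ℝ) 𝓘(ℝ, V) ∞ toFun
  collar : ∃ ε : ℝ, 0 < ε ∧
    (∀ t s, t ≤ ε → toFun (t, s) = toFun (0, 0)) ∧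
    (∀ t s, 1 - ε ≤ t → toFun (t, s) = toFun (1, 0)) ∧
    (∀ t s, s ≤ ε → toFun (t, s) = toFun (t, 0)) ∧
    (∀ t s, 1 - ε ≤ s → toFun (t, s) = toFun (t, 1))

/-- A 3-path `(t, s, x) ↦ J (t, s, x)`. -/
@[ext]
structure Path3 where
  toFun : ℝ × ℝ × ℝ → M
  smooth : ContMDiff 𝓘(ℝ, ℝ × ℝ × ℝ) 𝓘(ℝ, V) ∞ toFun
  collar : ∃ ε : ℝ, 0 < ε ∧
    (∀ t s x, t ≤ ε → toFun (t, s, x) = toFun (0, 0, 0)) ∧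
    (∀ t s x, 1 - ε ≤ t → toFun (t, s, x) = toFun (1, 0, 0)) ∧
    (∀ t s x, s ≤ ε → toFun (t, s, x) = toFun (t, 0, x)) ∧
    (∀ t s x, 1 - ε ≤ s → toFun (t, s, x) = toFun (t, 1, x)) ∧
    (∀ t s x, x ≤ ε → toFun (t, s, x) = toFun (t, s, 0)) ∧
    (∀ t s x, 1 - ε ≤ x → toFun (t, s, x) = toFun (t, s, 1))

end Paths

section PathOperations

variable {V : Type*} [NormedAddCommGroup V] [NormedSpace ℝ V]
variable {M : Type*} [TopologicalSpace M] [ChartedSpace V M]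

instance : CoeFun (Path1 V M) (fun _ => ℝ → M) := ⟨Path1.toFun⟩
instance : CoeFun (Path2 V M) (fun _ => ℝ × ℝ → M) := ⟨Path2.toFun⟩
instance : CoeFun (Path3 V M) (fun _ => ℝ × ℝ × ℝ → M) := ⟨Path3.toFun⟩

/-- A map is smooth if it is locally equal to smooth maps. -/
theorem contMDiff_of_glue {W : Type*} [NormedAddCommGroup W] [NormedSpace ℝ W]
    {f f₁ f₂ : W → M} (h₁ : ContMDiff 𝓘(ℝ, W) 𝓘(ℝ, V) ∞ f₁)
    (h₂ : ContMDiff 𝓘(ℝ, W) 𝓘(ℝ, V) ∞ f₂)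
    {U₁ U₂ : Set W} (hU₁ : IsOpen U₁) (hU₂ : IsOpen U₂) (hU : ∀ x, x ∈ U₁ ∨ x ∈ U₂)
    (e₁ : ∀ x ∈ U₁, f x = f₁ x) (e₂ : ∀ x ∈ U₂, f x = f₂ x) :
    ContMDiff 𝓘(ℝ, W) 𝓘(ℝ, V) ∞ f := by
  intro x
  rcases hU x with hx | hx
  · exact (h₁ x).congr_of_eventuallyEq (Filter.eventuallyEq_of_mem (hU₁.mem_nhds hx) e₁)
  · exact (h₂ x).congr_of_eventuallyEq (Filter.eventuallyEq_of_mem (hU₂.mem_nhds hx) e₂)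

/-- The constant 1-path. -/
def Path1.const (p : M) : Path1 V M where
  toFun _ := p
  smooth := contMDiff_const
  collar := ⟨1, one_pos, fun _ _ => rfl, fun _ _ => rfl⟩

/-- The concatenation of 1-paths. -/
def Path1.comp (γ φ : Path1 V M) (h : γ 1 = φ 0) : Path1 V M where
  toFun t := if t ≤ 1 / 2 then γ (2 * t) else φ (2 * t - 1)
  smooth := by
    obtain ⟨a, ha, -, ha'⟩ := γ.collar
    obtain ⟨b, hb, hb', -⟩ := φ.collar
    have l₁ : ContMDiff 𝓘(ℝ, ℝ) 𝓘(ℝ, ℝ) ∞ (fun t : ℝ => 2 * t) :=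
      ContDiff.contMDiff (by fun_prop)
    have l₂ : ContMDiff 𝓘(ℝ, ℝ) 𝓘(ℝ, ℝ) ∞ (fun t : ℝ => 2 * t - 1) :=
      ContDiff.contMDiff (by fun_prop)
    refine contMDiff_of_glue (γ.smooth.comp l₁) (φ.smooth.comp l₂)
      (U₁ := {t | t < 1 / 2 + b / 2}) (U₂ := {t | 1 / 2 - a / 2 < t})
      (isOpen_lt (by fun_prop) (by fun_prop)) (isOpen_lt (by fun_prop) (by fun_prop)) ?_ ?_ ?_
    · intro t
      rcases lt_or_ge t (1 / 2 + b / 2) with hc | hc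
      · exact Or.inl hc
      · exact Or.inr (show 1 / 2 - a / 2 < t by linarith)
    · intro t (ht : t < 1 / 2 + b / 2)
      by_cases hs : t ≤ 1 / 2
      · exact if_pos hs
      · simp only [hs, if_false, Function.comp]
        rw [hb' (2 * t - 1) (by linarith), ← h]
        exact (ha' _ (by linarith)).symm
    · intro t (ht : 1 / 2 - a / 2 < t)
      by_cases hs : t ≤ 1 / 2
      · simp only [hs, if_true, Function.comp]
        rw [ha' (2 * t) (by linarith), h]
        exact (hb' _ (by linarith)).symm
      · exact if_neg hs
  collar := by
    obtain ⟨a, ha, ha₀, ha₁⟩ := γ.collar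
    obtain ⟨b, hb, hb₀, hb₁⟩ := φ.collar
    refine ⟨min (1 / 4) (min (a / 2) (b / 2)), by positivity, ?_, ?_⟩
    · intro t ht
      simp only [le_min_iff] at ht
      rw [if_pos (by linarith), if_pos (by norm_num), ha₀ _ (by linarith)]
      simp
    · intro t ht
      have h1 := min_le_left (1 / 4 : ℝ) (min (a / 2) (b / 2))
      have h2 := (min_le_right (1 / 4 : ℝ) (min (a / 2) (b / 2))).trans (min_le_right _ _)
      rw [if_neg (by linarith), if_neg (by norm_num), hb₁ _ (by linarith)]
      norm_num

/-- The 1-path `γ_s = Γ (·, s)`. -/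
def Path2.slice (Γ : Path2 V M) (s : ℝ) : Path1 V M where
  toFun t := Γ (t, s)
  smooth := Γ.smooth.comp (ContDiff.contMDiff (by fun_prop))
  collar := by
    obtain ⟨a, ha, h₀, h₁, -, -⟩ := Γ.collar
    refine ⟨a, ha, fun t ht => ?_, fun t ht => ?_⟩
    · rw [h₀ t s ht, h₀ 0 s ha.le]
    · rw [h₁ t s ht, h₁ 1 s (by linarith)]

/-- `∂₂⁻`. -/
def Path2.bot (Γ : Path2 V M) : Path1 V M := Γ.slice 0

/-- `∂₂⁺`. -/
def Path2.top (Γ : Path2 V M) : Path1 V M := Γ.slice 1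

/-- The identity 2-path of a 1-path. -/
def Path1.id2 (γ : Path1 V M) : Path2 V M where
  toFun p := γ p.1
  smooth := γ.smooth.comp (ContDiff.contMDiff (by fun_prop))
  collar := by
    obtain ⟨a, ha, h₀, h₁⟩ := γ.collar
    exact ⟨a, ha, fun t _ ht => h₀ t ht, fun t _ ht => h₁ t ht, fun _ _ _ => rfl,
      fun _ _ _ => rfl⟩

/-- The vertical concatenation `Γ ♮₂ Γ'` of 2-paths. -/
def Path2.vcomp (Γ Γ' : Path2 V M) (h : Γ.top = Γ'.bot) : Path2 V M where
  toFun p := if p.2 ≤ 1 / 2 then Γ (p.1, 2 * p.2) else Γ' (p.1, 2 * p.2 - 1)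
  smooth := by
    have h' : ∀ t, Γ (t, 1) = Γ' (t, 0) := fun t => congrFun (congrArg Path1.toFun h) t
    obtain ⟨a, ha, -, -, -, ha'⟩ := Γ.collar
    obtain ⟨b, hb, -, -, hb', -⟩ := Γ'.collar
    have l₁ : ContMDiff 𝓘(ℝ, ℝ × ℝ) 𝓘(ℝ, ℝ × ℝ) ∞ (fun p : ℝ × ℝ => (p.1, 2 * p.2)) :=
      ContDiff.contMDiff (by fun_prop)
    have l₂ : ContMDiff 𝓘(ℝ, ℝ × ℝ) 𝓘(ℝ, ℝ × ℝ) ∞ (fun p : ℝ × ℝ => (p.1, 2 * p.2 - 1)) :=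
      ContDiff.contMDiff (by fun_prop)
    refine contMDiff_of_glue (Γ.smooth.comp l₁) (Γ'.smooth.comp l₂)
      (U₁ := {p | p.2 < 1 / 2 + b / 2}) (U₂ := {p | 1 / 2 - a / 2 < p.2})
      (isOpen_lt (by fun_prop) (by fun_prop)) (isOpen_lt (by fun_prop) (by fun_prop)) ?_ ?_ ?_
    · intro p
      rcases lt_or_ge p.2 (1 / 2 + b / 2) with hc | hc
      · exact Or.inl hc
      · exact Or.inr (show 1 / 2 - a / 2 < p.2 by linarith)
    · rintro ⟨t, s⟩ (hp : s < 1 / 2 + b / 2)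
      by_cases hs : s ≤ 1 / 2
      · exact if_pos hs
      · simp only [hs, if_false, Function.comp]
        rw [hb' t (2 * s - 1) (by linarith), ← h']
        exact (ha' _ _ (by linarith)).symm
    · rintro ⟨t, s⟩ (hp : 1 / 2 - a / 2 < s)
      by_cases hs : s ≤ 1 / 2
      · simp only [hs, if_true, Function.comp]
        rw [ha' t (2 * s) (by linarith), h']
        exact (hb' _ _ (by linarith)).symm
      · exact if_neg hs
  collar := by
    have h' : ∀ t, Γ (t, 1) = Γ' (t, 0) := fun t => congrFun (congrArg Path1.toFun h) t
    obtain ⟨a, ha, ha₀, ha₁, ha₂, ha₃⟩ := Γ.collar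
    obtain ⟨b, hb, hb₀, hb₁, hb₂, hb₃⟩ := Γ'.collar
    have m0 : 0 < min (1 / 4 : ℝ) (min (a / 2) (b / 2)) := by positivity
    have m1 := min_le_left (1 / 4 : ℝ) (min (a / 2) (b / 2))
    have m2 := (min_le_right (1 / 4 : ℝ) (min (a / 2) (b / 2))).trans (min_le_left _ _)
    have m3 := (min_le_right (1 / 4 : ℝ) (min (a / 2) (b / 2))).trans (min_le_right _ _)
    refine ⟨min (1 / 4) (min (a / 2) (b / 2)), m0, ?_, ?_, ?_, ?_⟩
    · intro t s ht
      simp only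
      split_ifs
      · rw [ha₀ t _ (by linarith)]; simp
      · linarith
      · rw [hb₀ t _ (by linarith), ← h', ha₀ 0 1 ha.le]; simp
      · linarith
    · intro t s ht
      simp only
      split_ifs
      · rw [ha₁ t _ (by linarith)]; simp
      · linarith
      · rw [hb₁ t _ (by linarith), ← h', ha₁ 1 1 (by linarith)]; simp
      · linarith
    · intro t s hs
      simp only
      rw [if_pos (by linarith), if_pos (by norm_num), ha₂ _ _ (by linarith)]
      simp
    · intro t s hs
      simp only
      rw [if_neg (by linarith), if_neg (by norm_num), hb₃ _ _ (by linarith)]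
      norm_num

/-- The horizontal concatenation `Γ ♮₁ Γ'` of 2-paths. -/
def Path2.hcomp (Γ Γ' : Path2 V M) (h : Γ (1, 0) = Γ' (0, 0)) : Path2 V M where
  toFun p := if p.1 ≤ 1 / 2 then Γ (2 * p.1, p.2) else Γ' (2 * p.1 - 1, p.2)
  smooth := by
    obtain ⟨a, ha, -, ha', -, -⟩ := Γ.collar
    obtain ⟨b, hb, hb', -, -, -⟩ := Γ'.collar
    have l₁ : ContMDiff 𝓘(ℝ, ℝ × ℝ) 𝓘(ℝ, ℝ × ℝ) ∞ (fun p : ℝ × ℝ => (2 * p.1, p.2)) :=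
      ContDiff.contMDiff (by fun_prop)
    have l₂ : ContMDiff 𝓘(ℝ, ℝ × ℝ) 𝓘(ℝ, ℝ × ℝ) ∞ (fun p : ℝ × ℝ => (2 * p.1 - 1, p.2)) :=
      ContDiff.contMDiff (by fun_prop)
    refine contMDiff_of_glue (Γ.smooth.comp l₁) (Γ'.smooth.comp l₂)
      (U₁ := {p | p.1 < 1 / 2 + b / 2}) (U₂ := {p | 1 / 2 - a / 2 < p.1})
      (isOpen_lt (by fun_prop) (by fun_prop)) (isOpen_lt (by fun_prop) (by fun_prop)) ?_ ?_ ?_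
    · intro p
      rcases lt_or_ge p.1 (1 / 2 + b / 2) with hc | hc
      · exact Or.inl hc
      · exact Or.inr (show 1 / 2 - a / 2 < p.1 by linarith)
    · rintro ⟨t, s⟩ (hp : t < 1 / 2 + b / 2)
      by_cases hs : t ≤ 1 / 2
      · exact if_pos hs
      · simp only [hs, if_false, Function.comp]
        rw [hb' (2 * t - 1) s (by linarith), ← h]
        exact (ha' _ _ (by linarith)).symm
    · rintro ⟨t, s⟩ (hp : 1 / 2 - a / 2 < t)
      by_cases hs : t ≤ 1 / 2
      · simp only [hs, if_true, Function.comp]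
        rw [ha' (2 * t) s (by linarith), h]
        exact (hb' _ _ (by linarith)).symm
      · exact if_neg hs
  collar := by
    obtain ⟨a, ha, ha₀, ha₁, ha₂, ha₃⟩ := Γ.collar
    obtain ⟨b, hb, hb₀, hb₁, hb₂, hb₃⟩ := Γ'.collar
    have m0 : 0 < min (1 / 4 : ℝ) (min (a / 2) (b / 2)) := by positivity
    have m1 := min_le_left (1 / 4 : ℝ) (min (a / 2) (b / 2))
    have m2 := (min_le_right (1 / 4 : ℝ) (min (a / 2) (b / 2))).trans (min_le_left _ _)
    have m3 := (min_le_right (1 / 4 : ℝ) (min (a / 2) (b / 2))).trans (min_le_right _ _)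
    refine ⟨min (1 / 4) (min (a / 2) (b / 2)), m0, ?_, ?_, ?_, ?_⟩
    · intro t s ht
      simp only
      rw [if_pos (by linarith), if_pos (by norm_num), ha₀ _ _ (by linarith)]
      simp
    · intro t s ht
      simp only
      rw [if_neg (by linarith), if_neg (by norm_num), hb₁ _ _ (by linarith)]
      norm_num
    · intro t s hs
      simp only
      split_ifs
      · exact ha₂ _ _ (by linarith)
      · exact hb₂ _ _ (by linarith)
    · intro t s hs
      simp only
      split_ifs
      · exact ha₃ _ _ (by linarith)
      · exact hb₃ _ _ (by linarith)

/-- `∂₃⁻` is the case `x = 0`, `∂₃⁺` the case `x = 1`. -/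
def Path3.face3 (J : Path3 V M) (x : ℝ) : Path2 V M where
  toFun p := J (p.1, p.2, x)
  smooth := J.smooth.comp (ContDiff.contMDiff (by fun_prop))
  collar := by
    obtain ⟨a, ha, h₀, h₁, h₂, h₃, -, -⟩ := J.collar
    refine ⟨a, ha, fun t s ht => ?_, fun t s ht => ?_, fun t s hs => h₂ t s x hs,
      fun t s hs => h₃ t s x hs⟩
    · simp only; rw [h₀ t s x ht, h₀ 0 0 x ha.le]
    · simp only; rw [h₁ t s x ht, h₁ 1 0 x (by linarith)]

/-- `∂₂⁻` is the case `s = 0`, `∂₂⁺` the case `s = 1`. -/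
def Path3.face2 (J : Path3 V M) (s : ℝ) : Path2 V M where
  toFun p := J (p.1, s, p.2)
  smooth := J.smooth.comp (ContDiff.contMDiff (by fun_prop))
  collar := by
    obtain ⟨a, ha, h₀, h₁, -, -, h₂, h₃⟩ := J.collar
    refine ⟨a, ha, fun t x ht => ?_, fun t x ht => ?_, fun t x hx => h₂ t s x hx,
      fun t x hx => h₃ t s x hx⟩
    · simp only; rw [h₀ t s x ht, h₀ 0 s 0 ha.le]
    · simp only; rw [h₁ t s x ht, h₁ 1 s 0 (by linarith)]

/-! ### Homotopies and tracks -/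

/-- The rank of the derivative of a map from a vector space to a manifold at a point. -/
def rankAt {W : Type*} [NormedAddCommGroup W] [NormedSpace ℝ W] (f : W → M) (w : W) : ℕ :=
  Module.finrank ℝ (LinearMap.range (mfderiv 𝓘(ℝ, W) 𝓘(ℝ, V) f w).toLinearMap)

/-- The 2-path has derivative of rank at most one everywhere: it is a rank-1 homotopy from
`∂₂⁻` to `∂₂⁺`. -/
def Path2.IsThin (Γ : Path2 V M) : Prop :=
  ∀ v ∈ Icc (0 : ℝ × ℝ) 1, rankAt (V := V) Γ.toFun v ≤ 1

/-- Rank-1 homotopy of 1-paths. -/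
def Rank1Homotopic (φ γ : Path1 V M) : Prop :=
  ∃ Γ : Path2 V M, Γ.bot = γ ∧ Γ.top = φ ∧ Γ.IsThin

/-- The laminatedness condition at `(s, x)`: for `ζ = s` or for `ζ = x`, the derivative of `J` in
the variables `(t, ζ)` has rank at most one for all `t`. -/
def Path3.LaminatedAt (J : Path3 V M) (s x : ℝ) : Prop :=
  (∀ t ∈ Icc (0 : ℝ) 1, rankAt (V := V) (fun p : ℝ × ℝ => J (p.1, p.2, x)) (t, s) ≤ 1) ∨
  (∀ t ∈ Icc (0 : ℝ) 1, rankAt (V := V) (fun p : ℝ × ℝ => J (p.1, s, p.2)) (t, x) ≤ 1)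

/-- The path space thinness condition at `(s, x)`. -/
def Path3.PathSpaceThinAt (J : Path3 V M) (s x : ℝ) : Prop :=
  ∃ a b : ℝ, a ≠ 0 ∧ b ≠ 0 ∧ ∀ t ∈ Icc (0 : ℝ) 1,
    a • mfderiv 𝓘(ℝ, ℝ × ℝ × ℝ) 𝓘(ℝ, V) J.toFun (t, s, x) ((0, 1, 0) : ℝ × ℝ × ℝ) +
      b • mfderiv 𝓘(ℝ, ℝ × ℝ × ℝ) 𝓘(ℝ, V) J.toFun (t, s, x) ((0, 0, 1) : ℝ × ℝ × ℝ) = 0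

/-- Laminated rank-2 homotopy of 2-paths. The last condition holds for almost every `(s, x)`. -/
def LaminatedHomotopic (Γ Γ' : Path2 V M) : Prop :=
  ∃ J : Path3 V M, J.face3 0 = Γ ∧ J.face3 1 = Γ' ∧
    (J.face2 0).IsThin ∧ (J.face2 1).IsThin ∧
    (∀ v ∈ Icc (0 : ℝ × ℝ × ℝ) 1, rankAt (V := V) J.toFun v ≤ 2) ∧
    ∀ᵐ p : ℝ × ℝ ∂(volume.restrict (Ioo (0 : ℝ) 1 ×ˢ Ioo (0 : ℝ) 1)),
      J.LaminatedAt p.1 p.2 ∨ J.PathSpaceThinAt p.1 p.2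

variable (V M) in
/-- 1-tracks: 1-paths up to rank-1 homotopy. (`Quot` is the quotient by the equivalence relation
generated by its argument, which already is an equivalence relation.) -/
def Track1 : Type _ := Quot (Rank1Homotopic (V := V) (M := M))

variable (V M) in
/-- Laminated 2-tracks: 2-paths up to laminated rank-2 homotopy. -/
def Track2 : Type _ := Quot (LaminatedHomotopic (V := V) (M := M))

/-- The class of a 1-path. -/
def Path1.track (γ : Path1 V M) : Track1 V M := Quot.mk _ γ

/-- The class of a 2-path. -/
def Path2.track (Γ : Path2 V M) : Track2 V M := Quot.mk _ Γ

theorem Rank1Homotopic.start_eq {φ γ : Path1 V M} (h : Rank1Homotopic φ γ) : φ 0 = γ 0 := by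
  obtain ⟨Γ, rfl, rfl, -⟩ := h
  obtain ⟨a, ha, h₀, -⟩ := Γ.collar
  exact h₀ 0 1 ha.le

theorem Rank1Homotopic.end_eq {φ γ : Path1 V M} (h : Rank1Homotopic φ γ) : φ 1 = γ 1 := by
  obtain ⟨Γ, rfl, rfl, -⟩ := h
  obtain ⟨a, ha, -, h₁, -⟩ := Γ.collar
  exact h₁ 1 1 (by linarith)

theorem LaminatedHomotopic.bot_track {Γ Γ' : Path2 V M} (h : LaminatedHomotopic Γ Γ') :
    Γ.bot.track = Γ'.bot.track := by
  obtain ⟨J, rfl, rfl, h₀, -⟩ := h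
  exact (Quot.sound ⟨J.face2 0, rfl, rfl, h₀⟩ : Path1.track _ = Path1.track _).symm

theorem LaminatedHomotopic.top_track {Γ Γ' : Path2 V M} (h : LaminatedHomotopic Γ Γ') :
    Γ.top.track = Γ'.top.track := by
  obtain ⟨J, rfl, rfl, -, h₁, -⟩ := h
  exact (Quot.sound ⟨J.face2 1, rfl, rfl, h₁⟩ : Path1.track _ = Path1.track _).symm

theorem rankAt_comp_le {W W' : Type*} [NormedAddCommGroup W] [NormedSpace ℝ W]
    [NormedAddCommGroup W'] [NormedSpace ℝ W'] [FiniteDimensional ℝ W'] {f : W' → M}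
    (hf : ContMDiff 𝓘(ℝ, W') 𝓘(ℝ, V) ∞ f) (L : W →L[ℝ] W') (v : W) :
    rankAt (V := V) (fun v => f (L v)) v ≤ Module.finrank ℝ W' := by
  have h : mfderiv 𝓘(ℝ, W) 𝓘(ℝ, V) (fun v => f (L v)) v =
      (mfderiv 𝓘(ℝ, W') 𝓘(ℝ, V) f (L v)).comp (mfderiv 𝓘(ℝ, W) 𝓘(ℝ, W') L v) :=
    mfderiv_comp v ((hf (L v)).mdifferentiableAt (by simp))
      L.differentiableAt.mdifferentiableAt
  let A : W →ₗ[ℝ] W' := (mfderiv 𝓘(ℝ, W) 𝓘(ℝ, W') L v).toLinearMap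
  let B : W' →ₗ[ℝ] V := (mfderiv 𝓘(ℝ, W') 𝓘(ℝ, V) f (L v)).toLinearMap
  have h' : rankAt (V := V) (fun v => f (L v)) v =
      Module.finrank ℝ (LinearMap.range (B.comp A)) := by
    unfold rankAt
    rw [h]
    rfl
  rw [h']
  exact (Submodule.finrank_mono (LinearMap.range_comp_le_range A B)).trans
    (LinearMap.finrank_range_le B)

/-- Identity 2-paths of rank-1 homotopic 1-paths are laminated rank-2 homotopic. -/
theorem Rank1Homotopic.id2_track {φ γ : Path1 V M} (h : Rank1Homotopic φ γ) :
    φ.id2.track = γ.id2.track := by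
  obtain ⟨H, rfl, rfl, hH⟩ := h
  let L : ℝ × ℝ × ℝ →L[ℝ] ℝ × ℝ :=
    (ContinuousLinearMap.fst ℝ ℝ (ℝ × ℝ)).prod
      ((ContinuousLinearMap.snd ℝ ℝ ℝ).comp (ContinuousLinearMap.snd ℝ ℝ (ℝ × ℝ)))
  let J : Path3 V M :=
    { toFun := fun p => H (L p)
      smooth := H.smooth.comp L.contDiff.contMDiff
      collar := by
        obtain ⟨a, ha, h₀, h₁, h₂, h₃⟩ := H.collar
        exact ⟨a, ha, fun t _ x ht => h₀ t x ht, fun t _ x ht => h₁ t x ht,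
          fun _ _ _ _ => rfl, fun _ _ _ _ => rfl, fun t _ x hx => h₂ t x hx,
          fun t _ x hx => h₃ t x hx⟩ }
  refine (Quot.sound ⟨J, rfl, rfl, hH, hH, fun v _ => ?_, .of_forall fun p => .inl (.inl ?_)⟩ :
    Path2.track _ = Path2.track _).symm
  · exact (rankAt_comp_le H.smooth L v).trans (by simp)
  · intro t _
    exact (rankAt_comp_le (H.slice p.2).smooth (ContinuousLinearMap.fst ℝ ℝ ℝ) (t, p.1)).trans
      (by simp)

end PathOperations

/-! ### Differential forms on a manifold -/

section Forms

variable (V : Type*) [NormedAddCommGroup V] [NormedSpace ℝ V]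
variable (M : Type*) [TopologicalSpace M] [ChartedSpace V M]
variable (F : Type*) [NormedAddCommGroup F] [NormedSpace ℝ F]

/-- The expression of a field of alternating forms in the preferred chart around `c`, that is, its
pullback under the inverse of the chart. -/
def localRep {V : Type*} [NormedAddCommGroup V] [NormedSpace ℝ V]
    {M : Type*} [TopologicalSpace M] [ChartedSpace V M]
    {F : Type*} [NormedAddCommGroup F] [NormedSpace ℝ F] {k : ℕ}
    (α : ∀ x : M, TangentSpace 𝓘(ℝ, V) x [⋀^Fin k]→L[ℝ] F) (c : M) (y : V) :
    V [⋀^Fin k]→L[ℝ] F :=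
  (α ((extChartAt 𝓘(ℝ, V) c).symm y)).compContinuousLinearMap
    (mfderiv 𝓘(ℝ, V) 𝓘(ℝ, V) (extChartAt 𝓘(ℝ, V) c).symm y)

/-- Smooth differential `k`-forms on `M` with values in `F`. -/
structure Form (k : ℕ) where
  toFun : ∀ x : M, TangentSpace 𝓘(ℝ, V) x [⋀^Fin k]→L[ℝ] F
  smooth : ∀ c : M, ContDiffOn ℝ ∞ (localRep toFun c) (extChartAt 𝓘(ℝ, V) c).target

variable {V M F}

/-- The exterior derivative, at `x`, computed in the preferred chart around `x`. For a 1-form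
`w`, this is `dw (X, Y) = X w(Y) - Y w(X) - w([X, Y])`. -/
def Form.d {k : ℕ} (α : Form V M F k) (x : M) :
    TangentSpace 𝓘(ℝ, V) x [⋀^Fin (k + 1)]→L[ℝ] F :=
  (extDeriv (localRep α.toFun x) (extChartAt 𝓘(ℝ, V) x x)).compContinuousLinearMap
    (mfderiv 𝓘(ℝ, V) 𝓘(ℝ, V) (extChartAt 𝓘(ℝ, V) x) x)

/-- The function `t ↦ w (γ' t)`. -/
def Form.along (w : Form V M F 1) (γ : Path1 V M) (t : ℝ) : F :=
  w.toFun (γ t) ![mfderiv 𝓘(ℝ, ℝ) 𝓘(ℝ, V) γ.toFun t (1 : ℝ)]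

end Forms

/-! ### Lie pre-crossed modules

The Lie algebra of a Lie group is its tangent space at the identity, with the bracket of
left-invariant vector fields. As a vector space, this is by definition the model space. -/

section PreCrossedModule

variable (VG : Type*) [NormedAddCommGroup VG] [NormedSpace ℝ VG]
variable (G : Type*) [TopologicalSpace G] [ChartedSpace VG G] [Group G]
variable (VE : Type*) [NormedAddCommGroup VE] [NormedSpace ℝ VE]
variable (E : Type*) [TopologicalSpace E] [ChartedSpace VE E] [Group E]

/-- A pre-crossed module of Lie groups. -/
structure LiePreCrossedModule where
  /-- The boundary map `∂`. -/
  bd : E →* G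
  contMDiff_bd : ContMDiff 𝓘(ℝ, VE) 𝓘(ℝ, VG) ∞ bd
  /-- The left action of `G` on `E` by automorphisms. -/
  act : G →* MulAut E
  contMDiff_act : ContMDiff (𝓘(ℝ, VG).prod 𝓘(ℝ, VE)) 𝓘(ℝ, VE) ∞ (fun p : G × E => act p.1 p.2)
  bd_act : ∀ (g : G) (e : E), bd (act g e) = g * bd e * g⁻¹

variable {VG G VE E}

/-- The differential `𝔢 → 𝔤` of the boundary map. -/
def LiePreCrossedModule.dbd (P : LiePreCrossedModule VG G VE E) : VE →L[ℝ] VG :=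
  mfderiv 𝓘(ℝ, VE) 𝓘(ℝ, VG) P.bd (1 : E)

/-- The action of an element of `G` on the Lie algebra `𝔢`. -/
def LiePreCrossedModule.dact (P : LiePreCrossedModule VG G VE E) (g : G) : VE →L[ℝ] VE :=
  mfderiv 𝓘(ℝ, VE) 𝓘(ℝ, VE) (fun e : E => P.act g e) (1 : E)

variable (VG G) in
/-- The Lie bracket of the Lie algebra of `G`. -/
def lieAlgBracket (u v : VG) : VG :=
  (⁅(show GroupLieAlgebra 𝓘(ℝ, VG) G from u), (show GroupLieAlgebra 𝓘(ℝ, VG) G from v)⁆ :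
    GroupLieAlgebra 𝓘(ℝ, VG) G)

/-- `f` solves `f' = f A` with `f 0 = 1`, where `f A` is the left translate of `A`. -/
def IsTransport (A : ℝ → VG) (f : ℝ → G) : Prop :=
  f 0 = 1 ∧ ∀ t : ℝ, HasMFDerivAt 𝓘(ℝ, ℝ) 𝓘(ℝ, VG) f t
    ((1 : ℝ →L[ℝ] ℝ).smulRight
      (mulInvariantVectorField (show GroupLieAlgebra 𝓘(ℝ, VG) G from A t) (f t)))

/-- The solution of `f' = f A`, `f 0 = 1`. -/
def transport (A : ℝ → VG) : ℝ → G :=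
  Classical.epsilon (IsTransport (G := G) A)

variable {V : Type*} [NormedAddCommGroup V] [NormedSpace ℝ V]
variable {M : Type*} [TopologicalSpace M] [ChartedSpace V M]

/-- The curvature equation `∂(m) = Ω`, where `Ω = dw + [w, w]` is the curvature
of `w` and `[w, w] (X, Y) = [w(X), w(Y)]`. -/
def LiePreCrossedModule.CurvatureEq (P : LiePreCrossedModule VG G VE E)
    (w : Form V M VG 1) (m : Form V M VE 2) : Prop :=
  ∀ (x : M) (X Y : TangentSpace 𝓘(ℝ, V) x),
    P.dbd (m.toFun x ![X, Y]) =
      w.d x ![X, Y] + lieAlgBracket VG G (w.toFun x ![X]) (w.toFun x ![Y])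

variable (G) in
/-- One-dimensional holonomy `t ↦ g_γ (0, t)`. -/
def holonomyCurve (w : Form V M VG 1) (γ : Path1 V M) : ℝ → G :=
  transport (w.along γ)

variable (G) in
/-- One-dimensional holonomy `g_γ = g_γ (0, 1)`. -/
def holonomy₁ (w : Form V M VG 1) (γ : Path1 V M) : G :=
  holonomyCurve G w γ 1

/-- The function `s ↦ ∫₀¹ g_{γ_s} (0, t) ▷ m (∂_t γ_s (t), ∂_s γ_s (t)) dt`. -/
def LiePreCrossedModule.along (P : LiePreCrossedModule VG G VE E)
    (w : Form V M VG 1) (m : Form V M VE 2) (Γ : Path2 V M) (s : ℝ) : VE :=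
  ∫ t in (0 : ℝ)..1, P.dact (holonomyCurve G w (Γ.slice s) t)
    (m.toFun (Γ (t, s))
      ![mfderiv 𝓘(ℝ, ℝ × ℝ) 𝓘(ℝ, V) Γ.toFun (t, s) ((1, 0) : ℝ × ℝ),
        mfderiv 𝓘(ℝ, ℝ × ℝ) 𝓘(ℝ, V) Γ.toFun (t, s) ((0, 1) : ℝ × ℝ)])

/-- Two-dimensional holonomy `e_Γ = e_Γ (0, 1)`. -/
def LiePreCrossedModule.holonomy₂ (P : LiePreCrossedModule VG G VE E)
    (w : Form V M VG 1) (m : Form V M VE 2) (Γ : Path2 V M) : E :=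
  transport (P.along w m Γ) 1

end PreCrossedModule

/-! ### The part of a Gray 3-groupoid that does not involve 3-morphisms -/

/-- Objects, morphisms and 2-morphisms with their boundaries, identities, compositions and
whiskerings. Compositions are recorded by their graphs: `comp₁ a b c` means that `c` is the
composite of `a` and `b`. The boundaries of a 2-morphism among the objects are those of its source,
equivalently of its target. -/
structure SesquiData where
  C₀ : Type*
  C₁ : Type*
  C₂ : Type*
  src₁ : C₁ → C₀
  tgt₁ : C₁ → C₀
  src₂ : C₂ → C₁
  tgt₂ : C₂ → C₁
  id₁ : C₀ → C₁
  id₂ : C₁ → C₂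
  /-- Composition of morphisms. -/
  comp₁ : C₁ → C₁ → C₁ → Prop
  /-- Vertical composition of 2-morphisms. -/
  comp₂ : C₂ → C₂ → C₂ → Prop
  /-- Left whiskering by a morphism. -/
  whiskerLeft : C₁ → C₂ → C₂ → Prop
  /-- Right whiskering by a morphism. -/
  whiskerRight : C₂ → C₁ → C₂ → Prop

/-- The horizontal composition `(a ♮₁ ∂₂⁻ b) ♮₂ (∂₂⁺ a ♮₁ b)`. -/
def SesquiData.hcompMinus (C : SesquiData) (a b c : C.C₂) : Prop :=
  ∃ p q, C.whiskerRight a (C.src₂ b) p ∧ C.whiskerLeft (C.tgt₂ a) b q ∧ C.comp₂ p q c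

/-- The horizontal composition `(∂₂⁻ a ♮₁ b) ♮₂ (a ♮₁ ∂₂⁺ b)`. -/
def SesquiData.hcompPlus (C : SesquiData) (a b c : C.C₂) : Prop :=
  ∃ p q, C.whiskerLeft (C.src₂ a) b p ∧ C.whiskerRight a (C.tgt₂ b) q ∧ C.comp₂ p q c

/-- Morphisms: maps strictly preserving all boundaries, identities and compositions. -/
structure SesquiHom (C D : SesquiData) where
  map₀ : C.C₀ → D.C₀
  map₁ : C.C₁ → D.C₁
  map₂ : C.C₂ → D.C₂
  map_src₁ : ∀ a, D.src₁ (map₁ a) = map₀ (C.src₁ a)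
  map_tgt₁ : ∀ a, D.tgt₁ (map₁ a) = map₀ (C.tgt₁ a)
  map_src₂ : ∀ a, D.src₂ (map₂ a) = map₁ (C.src₂ a)
  map_tgt₂ : ∀ a, D.tgt₂ (map₂ a) = map₁ (C.tgt₂ a)
  map_id₁ : ∀ x, map₁ (C.id₁ x) = D.id₁ (map₀ x)
  map_id₂ : ∀ a, map₂ (C.id₂ a) = D.id₂ (map₁ a)
  map_comp₁ : ∀ a b c, C.comp₁ a b c → D.comp₁ (map₁ a) (map₁ b) (map₁ c)
  map_comp₂ : ∀ a b c, C.comp₂ a b c → D.comp₂ (map₂ a) (map₂ b) (map₂ c)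
  map_whiskerLeft : ∀ a b c, C.whiskerLeft a b c → D.whiskerLeft (map₁ a) (map₂ b) (map₂ c)
  map_whiskerRight : ∀ a b c, C.whiskerRight a b c → D.whiskerRight (map₂ a) (map₁ b) (map₂ c)
  map_hcompMinus : ∀ a b c, C.hcompMinus a b c → D.hcompMinus (map₂ a) (map₂ b) (map₂ c)
  map_hcompPlus : ∀ a b c, C.hcompPlus a b c → D.hcompPlus (map₂ a) (map₂ b) (map₂ c)

section TrackData

variable (V : Type*) [NormedAddCommGroup V] [NormedSpace ℝ V]
variable (M : Type*) [TopologicalSpace M] [ChartedSpace V M]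

/-- Points, 1-tracks and laminated 2-tracks of `M`. The graphs of the compositions contain the
composites formed from all representatives; for the vertical composition, the representatives
are joined by an arbitrary rank-1 homotopy `H`. -/
def tracks : SesquiData where
  C₀ := M
  C₁ := Track1 V M
  C₂ := Track2 V M
  src₁ := Quot.lift (fun γ : Path1 V M => γ 0) (fun _ _ h => h.start_eq)
  tgt₁ := Quot.lift (fun γ : Path1 V M => γ 1) (fun _ _ h => h.end_eq)
  src₂ := Quot.lift (fun Γ : Path2 V M => Γ.bot.track) (fun _ _ h => h.bot_track)
  tgt₂ := Quot.lift (fun Γ : Path2 V M => Γ.top.track) (fun _ _ h => h.top_track)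
  id₁ p := (Path1.const p).track
  id₂ := Quot.lift (fun γ : Path1 V M => γ.id2.track) (fun _ _ h => h.id2_track)
  comp₁ a b c := ∃ (γ φ : Path1 V M) (h : γ 1 = φ 0),
    a = γ.track ∧ b = φ.track ∧ c = (γ.comp φ h).track
  comp₂ a b c := ∃ (Γ H Γ' : Path2 V M) (h : Γ.top = H.bot) (h' : (Γ.vcomp H h).top = Γ'.bot),
    H.IsThin ∧ a = Γ.track ∧ b = Γ'.track ∧ c = ((Γ.vcomp H h).vcomp Γ' h').track
  whiskerLeft a b c := ∃ (γ : Path1 V M) (Γ : Path2 V M) (h : γ 1 = Γ (0, 0)),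
    a = γ.track ∧ b = Γ.track ∧ c = (γ.id2.hcomp Γ h).track
  whiskerRight a b c := ∃ (Γ : Path2 V M) (γ : Path1 V M) (h : Γ (1, 0) = γ 0),
    a = Γ.track ∧ b = γ.track ∧ c = (Γ.hcomp γ.id2 h).track

end TrackData

/-- The morphisms and 2-morphisms, with a single object, of the Gray 3-groupoid of a 2-crossed
module; they only depend on the underlying pre-crossed module. -/
def LiePreCrossedModule.sesqui
    {VG : Type*} [NormedAddCommGroup VG] [NormedSpace ℝ VG]
    {G : Type*} [TopologicalSpace G] [ChartedSpace VG G] [Group G]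
    {VE : Type*} [NormedAddCommGroup VE] [NormedSpace ℝ VE]
    {E : Type*} [TopologicalSpace E] [ChartedSpace VE E] [Group E]
    (P : LiePreCrossedModule VG G VE E) : SesquiData where
  C₀ := Unit
  C₁ := G
  C₂ := G × E
  src₁ _ := ()
  tgt₁ _ := ()
  src₂ a := a.1
  tgt₂ a := (P.bd a.2)⁻¹ * a.1
  id₁ _ := 1
  id₂ X := (X, 1)
  comp₁ X Y Z := Z = X * Y
  comp₂ a b c := b.1 = (P.bd a.2)⁻¹ * a.1 ∧ c = (a.1, a.2 * b.2)
  whiskerLeft X a c := c = (X * a.1, P.act X a.2)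
  whiskerRight a X c := c = (a.1 * X, a.2)

end Holonomy

end

open Holonomy

open Filter Topology

noncomputable section

set_option linter.unusedSectionVars false

/-! Both holonomies solve an equation `f' = f A` in a Lie group, and everything is proved by
comparing logarithmic derivatives `f⁻¹ f'` (`HasLogDeriv`). Picard–Lindelöf in a chart at the
identity, continued by left translations, gives existence (`exists_isTransport`). Two solutions `f`,
`h` differ by a left translation because `f h⁻¹` has zero logarithmic derivative. The chart
estimate, applied to the quotient of neighbouring solutions, also yields `g⁻¹ ∂_s g = Ad(g⁻¹) ∫
Ad(g) ∂_s A` for a family of equations (`hasLogDeriv_transport_param`).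

For a family of paths, let `A` and `C` be the components of ω along and across the paths. The
curvature equation reads `∂m = ∂_t C - ∂_s A + [A, C]`, and integration by parts turns the formula
above into `g⁻¹ ∂_s g = C - Ad(g⁻¹) ∂F`, with `F` the integral of `g ▷ m`
(`LiePreCrossedModule.flux`). At fixed endpoints `C = 0`; since `e' = e F`, the product `∂(e) g` is
then constant in `s`. This nonabelian Stokes theorem (`FlatPair.stokes`) is the target condition for
2-morphisms. On a rank-1 homotopy `m` pulls back to zero, so `e = 1` and `g` does not change:
holonomy descends to 1-tracks.

For a laminated homotopy `J(t, s, x)`, the fluxes `F_s`, `F_x` of `m` through the `(t, s)` and `(t,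
x)` directions are the components of an 𝔢-valued connection on the `(s, x)` square, and the
2-holonomies of the faces `x = 0, 1` are its transports along two opposite sides. The component
`F_x` vanishes on the sides `s = 0, 1`, where `J` is thin, so it suffices that the connection is
flat (`transport_eq_of_ae`). In `∂_s F_x - ∂_x F_s` a total `t`-derivative integrates to zero, the
terms from `dm` and from the action of ω on `m` vanish because `J` has rank at most 2, and quadratic
terms `∂F_x ▷ (g ▷ m_s) - ∂F_s ▷ (g ▷ m_x)` remain. The Peiffer identity, which would cancel them
against `[F_s, F_x]`, is not available. Instead laminatedness makes `m_s` and `m_x` proportional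
with a factor independent of `t`, so the quadratic terms and the bracket vanish separately
(`integral_deriv_flux_eq`).

Compositions reduce to transport over concatenated intervals. An identity 2-path is thin, so under
whiskering it contributes nothing to the flux; on the left its 1-holonomy acts on the remaining
flux, hence on its transport. -/

namespace Holonomy

/-! ### Derivatives between manifolds, read in the model spaces. -/

section Diff

variable {W₁ : Type*} [NormedAddCommGroup W₁] [NormedSpace ℝ W₁]
variable {W₂ : Type*} [NormedAddCommGroup W₂] [NormedSpace ℝ W₂]
variable {W₃ : Type*} [NormedAddCommGroup W₃] [NormedSpace ℝ W₃]
variable {W₄ : Type*} [NormedAddCommGroup W₄] [NormedSpace ℝ W₄]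
variable {X₁ : Type*} [TopologicalSpace X₁] [ChartedSpace W₁ X₁]
variable {X₂ : Type*} [TopologicalSpace X₂] [ChartedSpace W₂ X₂]
variable {X₃ : Type*} [TopologicalSpace X₃] [ChartedSpace W₃ X₃]
variable {X₄ : Type*} [TopologicalSpace X₄] [ChartedSpace W₄ X₄]

/-- `HasMFDerivAt`, with the derivative considered as a map between the model spaces. -/
def HasDiff (f : X₁ → X₂) (x : X₁) (L : W₁ →L[ℝ] W₂) : Prop :=
  HasMFDerivAt 𝓘(ℝ, W₁) 𝓘(ℝ, W₂) f x L

variable (W₁ W₂) in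
/-- `mfderiv`, considered as a map between the model spaces. -/
def diff (f : X₁ → X₂) (x : X₁) : W₁ →L[ℝ] W₂ := mfderiv 𝓘(ℝ, W₁) 𝓘(ℝ, W₂) f x

theorem HasDiff.diff_eq {f : X₁ → X₂} {x : X₁} {L : W₁ →L[ℝ] W₂} (h : HasDiff f x L) :
    diff W₁ W₂ f x = L := HasMFDerivAt.mfderiv h

theorem HasDiff.unique {f : X₁ → X₂} {x : X₁} {L L' : W₁ →L[ℝ] W₂} (h : HasDiff f x L)
    (h' : HasDiff f x L') : L = L' := hasMFDerivAt_unique h h'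

theorem HasDiff.continuousAt {f : X₁ → X₂} {x : X₁} {L : W₁ →L[ℝ] W₂} (h : HasDiff f x L) :
    ContinuousAt f x := HasMFDerivAt.continuousAt h

theorem HasDiff.mdifferentiableAt {f : X₁ → X₂} {x : X₁} {L : W₁ →L[ℝ] W₂} (h : HasDiff f x L) :
    MDifferentiableAt 𝓘(ℝ, W₁) 𝓘(ℝ, W₂) f x := HasMFDerivAt.mdifferentiableAt h

theorem _root_.MDifferentiableAt.hasDiff {f : X₁ → X₂} {x : X₁}
    (h : MDifferentiableAt 𝓘(ℝ, W₁) 𝓘(ℝ, W₂) f x) : HasDiff f x (diff W₁ W₂ f x) :=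
  h.hasMFDerivAt

theorem _root_.ContMDiff.hasDiff {f : X₁ → X₂} (h : ContMDiff 𝓘(ℝ, W₁) 𝓘(ℝ, W₂) ∞ f) (x : X₁) :
    HasDiff f x (diff W₁ W₂ f x) := (h.mdifferentiableAt (by simp)).hasDiff

theorem _root_.ContMDiffAt.hasDiff {f : X₁ → X₂} {x : X₁}
    (h : ContMDiffAt 𝓘(ℝ, W₁) 𝓘(ℝ, W₂) ∞ f x) :
    HasDiff f x (diff W₁ W₂ f x) := (h.mdifferentiableAt (by simp)).hasDiff

theorem HasDiff.comp {g : X₂ → X₃} {f : X₁ → X₂} {x : X₁} {L' : W₂ →L[ℝ] W₃} {L : W₁ →L[ℝ] W₂}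
    (hg : HasDiff g (f x) L') (hf : HasDiff f x L) :
    HasDiff (fun y => g (f y)) x (L'.comp L) := HasMFDerivAt.comp x hg hf

theorem HasDiff.comp_of_eq {g : X₂ → X₃} {f : X₁ → X₂} {x : X₁} {y : X₂} {L' : W₂ →L[ℝ] W₃}
    {L : W₁ →L[ℝ] W₂} (hg : HasDiff g y L') (hf : HasDiff f x L) (hy : f x = y) :
    HasDiff (fun z => g (f z)) x (L'.comp L) := by
  subst hy
  exact hg.comp hf

theorem HasDiff.congr {f f' : X₁ → X₂} {x : X₁} {L : W₁ →L[ℝ] W₂} (h : HasDiff f x L)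
    (e : f' =ᶠ[𝓝 x] f) : HasDiff f' x L := HasMFDerivAt.congr_of_eventuallyEq h e

theorem hasDiff_id (x : X₁) : HasDiff (fun y : X₁ => y) x (ContinuousLinearMap.id ℝ W₁) :=
  hasMFDerivAt_id x

theorem hasDiff_const (c : X₂) (x : X₁) : HasDiff (fun _ : X₁ => c) x (0 : W₁ →L[ℝ] W₂) :=
  hasMFDerivAt_const c x

theorem hasDiff_iff_hasFDerivAt {f : W₁ → W₂} {x : W₁} {L : W₁ →L[ℝ] W₂} :
    HasDiff f x L ↔ HasFDerivAt f L x := hasMFDerivAt_iff_hasFDerivAt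

theorem HasDiff.comp₂ {F : X₂ × X₃ → X₄}
    (hF : ContMDiff (𝓘(ℝ, W₂).prod 𝓘(ℝ, W₃)) 𝓘(ℝ, W₄) ∞ F)
    {f : X₁ → X₂} {g : X₁ → X₃} {x : X₁} {L : W₁ →L[ℝ] W₂} {L' : W₁ →L[ℝ] W₃}
    (hf : HasDiff f x L) (hg : HasDiff g x L') :
    HasDiff (fun y => F (f y, g y)) x
      ((diff W₂ W₄ (fun z => F (z, g x)) (f x)).comp L +
        (diff W₃ W₄ (fun z => F (f x, z)) (g x)).comp L') := by
  have h := hF.mdifferentiableAt (x := (f x, g x)) (by simp)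
  have h1 := HasMFDerivAt.comp x h.hasMFDerivAt (HasMFDerivAt.prodMk hf hg)
  refine HasMFDerivAt.congr_mfderiv h1 ?_
  refine ContinuousLinearMap.ext fun v => ?_
  exact mfderiv_prod_eq_add_apply h (v := (L v, L' v))

end Diff

/-! ### Logarithmic derivatives of curves in a Lie group. -/

section LieCalculus

variable {VG : Type*} [NormedAddCommGroup VG] [NormedSpace ℝ VG]
variable {G : Type*} [TopologicalSpace G] [ChartedSpace VG G] [Group G]
variable {VH : Type*} [NormedAddCommGroup VH] [NormedSpace ℝ VH]
variable {H : Type*} [TopologicalSpace H] [ChartedSpace VH H] [Group H]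

variable (VG) in
/-- The differential at the identity of the left translation by `g`. -/
def leftDiff (g : G) : VG →L[ℝ] VG := diff VG VG (fun x : G => g * x) (1 : G)

/-- The curve `f` has left logarithmic derivative `a` at `t`, that is, `f' = f a` at `t`. -/
def HasLogDeriv (f : ℝ → G) (a : VG) (t : ℝ) : Prop :=
  HasDiff f t ((1 : ℝ →L[ℝ] ℝ).smulRight (leftDiff VG (f t) a))

theorem HasLogDeriv.continuousAt {f : ℝ → G} {a : VG} {t : ℝ} (h : HasLogDeriv f a t) :
    ContinuousAt f t := HasDiff.continuousAt h

theorem HasLogDeriv.congr {f f' : ℝ → G} {a : VG} {t : ℝ} (h : HasLogDeriv f a t)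
    (e : f' =ᶠ[𝓝 t] f) : HasLogDeriv f' a t := by
  unfold HasLogDeriv
  rw [e.eq_of_nhds]
  exact HasDiff.congr h e

theorem leftDiff_one : leftDiff VG (1 : G) = ContinuousLinearMap.id ℝ VG := by
  simp only [leftDiff, one_mul]
  exact (hasDiff_id _).diff_eq

theorem hasLogDeriv_const (g : G) (t : ℝ) : HasLogDeriv (fun _ : ℝ => g) (0 : VG) t := by
  have : (1 : ℝ →L[ℝ] ℝ).smulRight (0 : VG) = 0 := by ext; simp
  simp only [HasLogDeriv, map_zero, this]
  exact hasDiff_const g t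

theorem HasLogDeriv.comp {f : ℝ → G} {a : VG} {u : ℝ → ℝ} {u' t : ℝ}
    (hf : HasLogDeriv f a (u t)) (hu : HasDerivAt u u' t) :
    HasLogDeriv (fun τ => f (u τ)) (u' • a) t := by
  have h := HasDiff.comp hf (hasDiff_iff_hasFDerivAt.2 hu.hasFDerivAt)
  unfold HasLogDeriv
  convert h using 1
  ext
  simp

/-- Postcomposition of curves with differentiable maps. -/
theorem HasLogDeriv.hasDiff_comp {W : Type*} [NormedAddCommGroup W] [NormedSpace ℝ W]
    {X : Type*} [TopologicalSpace X] [ChartedSpace W X] {f : ℝ → G} {a : VG} {t : ℝ}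
    (h : HasLogDeriv f a t) {F : G → X} {L : VG →L[ℝ] W} (hF : HasDiff F (f t) L) :
    HasDiff (fun τ => F (f τ)) t ((1 : ℝ →L[ℝ] ℝ).smulRight (L (leftDiff VG (f t) a))) := by
  convert HasDiff.comp hF h using 1
  ext
  simp

theorem HasLogDeriv.hasDerivAt_comp {W : Type*} [NormedAddCommGroup W] [NormedSpace ℝ W]
    {f : ℝ → G} {a : VG} {t : ℝ}
    (h : HasLogDeriv f a t) {F : G → W} {L : VG →L[ℝ] W} (hF : HasDiff F (f t) L) :
    HasDerivAt (fun τ => F (f τ)) (L (leftDiff VG (f t) a)) t := by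
  simpa using (hasDiff_iff_hasFDerivAt.1 (h.hasDiff_comp hF)).hasDerivAt

variable [LieGroup 𝓘(ℝ, VG) ∞ G] [LieGroup 𝓘(ℝ, VH) ∞ H]

theorem hasDiff_mul_left (g x : G) :
    HasDiff (fun x : G => g * x) x (diff VG VG (fun x : G => g * x) x) :=
  (contMDiff_mul_left (I := 𝓘(ℝ, VG)) (n := ∞) (a := g)).hasDiff x

theorem leftDiff_hasDiff (g : G) : HasDiff (fun x : G => g * x) 1 (leftDiff VG g) :=
  hasDiff_mul_left g 1

theorem leftDiff_mul (g h : G) :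
    leftDiff VG (g * h) = (diff VG VG (fun x : G => g * x) h).comp (leftDiff VG h) := by
  have h2 := ((hasDiff_mul_left (VG := VG) g h).comp_of_eq (leftDiff_hasDiff h) (mul_one h)).diff_eq
  simp only [← mul_assoc] at h2
  exact h2

theorem diff_mul_left_leftDiff (g h : G) (a : VG) :
    diff VG VG (fun x : G => g * x) h (leftDiff VG h a) = leftDiff VG (g * h) a := by
  rw [leftDiff_mul]; rfl

theorem leftDiff_injective (g : G) : Function.Injective (leftDiff VG g) := by
  refine Function.LeftInverse.injective (g := diff VG VG (fun x : G => g⁻¹ * x) g) fun a => ?_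
  rw [diff_mul_left_leftDiff, inv_mul_cancel, leftDiff_one]
  rfl

/-- Together with injectivity this makes every velocity at `g` a unique left translate, so
differentiable curves have well-defined logarithmic derivatives. -/
theorem leftDiff_surjective (g : G) : Function.Surjective (leftDiff VG g) := by
  refine Function.RightInverse.surjective (g := diff VG VG (fun x : G => g⁻¹ * x) g) fun a => ?_
  have h2 := (leftDiff_hasDiff (VG := VG) g).comp_of_eq (hasDiff_mul_left g⁻¹ g) (inv_mul_cancel g)
  simp only [mul_inv_cancel_left] at h2
  exact congrArg (fun L : VG →L[ℝ] VG => L a) (h2.unique (hasDiff_id g))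

theorem HasLogDeriv.const_mul {f : ℝ → G} {a : VG} {t : ℝ} (h : HasLogDeriv f a t) (g : G) :
    HasLogDeriv (fun τ => g * f τ) a t := by
  have h1 := h.hasDiff_comp (hasDiff_mul_left g _)
  rwa [diff_mul_left_leftDiff] at h1

theorem HasLogDeriv.of_const_mul {f : ℝ → G} {a : VG} {t : ℝ} (g : G)
    (h : HasLogDeriv (fun τ => g * f τ) a t) : HasLogDeriv f a t := by
  simpa using h.const_mul g⁻¹

/-- Differentiate at the identity the relation between `h` and left translations, `h (g x) = h g * h
x`. -/
theorem diff_hom_leftDiff {h : G →* H} (hh : ContMDiff 𝓘(ℝ, VG) 𝓘(ℝ, VH) ∞ h) (g : G) (a : VG) :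
    diff VG VH h g (leftDiff VG g a) = leftDiff VH (h g) (diff VG VH h 1 a) := by
  have h3 := (hh.hasDiff g).comp_of_eq (leftDiff_hasDiff g) (mul_one g)
  have h4 := (leftDiff_hasDiff (VG := VH) (h g)).comp_of_eq (hh.hasDiff 1) (map_one h)
  simp only [map_mul] at h3
  exact congrArg (fun L : VG →L[ℝ] VH => L a) (h3.unique h4)

theorem HasLogDeriv.map {f : ℝ → G} {a : VG} {t : ℝ} (hf : HasLogDeriv f a t) {h : G →* H}
    (hh : ContMDiff 𝓘(ℝ, VG) 𝓘(ℝ, VH) ∞ h) :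
    HasLogDeriv (fun τ => h (f τ)) (diff VG VH h 1 a) t := by
  have h1 := hf.hasDiff_comp (hh.hasDiff (f t))
  rwa [diff_hom_leftDiff hh] at h1

theorem HasLogDeriv.unique {f : ℝ → G} {a b : VG} {t : ℝ} (ha : HasLogDeriv f a t)
    (hb : HasLogDeriv f b t) : a = b := by
  have h' := congrArg (fun L : ℝ →L[ℝ] VG => L 1) (HasDiff.unique ha hb)
  exact leftDiff_injective _ (by simpa using h')

theorem exists_hasLogDeriv {f : ℝ → G} {t : ℝ} (h : MDifferentiableAt 𝓘(ℝ, ℝ) 𝓘(ℝ, VG) f t) :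
    ∃ a : VG, HasLogDeriv f a t := by
  have hL := h.hasDiff
  obtain ⟨a, ha⟩ := leftDiff_surjective (f t) (diff ℝ VG f t 1)
  refine ⟨a, ?_⟩
  unfold HasLogDeriv
  rw [ha]
  convert hL using 1
  ext
  simp

theorem HasLogDeriv.mul_of_eq_one {f k : ℝ → G} {a b : VG} {t : ℝ} (hf : HasLogDeriv f a t)
    (hk : HasLogDeriv k b t) (hf1 : f t = 1) (hk1 : k t = 1) :
    HasLogDeriv (fun τ => f τ * k τ) (a + b) t := by
  have h := HasDiff.comp₂ (contMDiff_mul 𝓘(ℝ, VG) ∞) hf hk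
  simp only [hf1, hk1, mul_one, one_mul, leftDiff_one, (hasDiff_id _).diff_eq] at h
  simp only [HasLogDeriv, hf1, hk1, mul_one, leftDiff_one]
  convert h using 1
  ext
  simp

variable (VG) in
/-- The action of a Lie group on itself by conjugation, as a crossed module. -/
def conjModule : LiePreCrossedModule VG G VG G where
  bd := MonoidHom.id G
  contMDiff_bd := contMDiff_id
  act := MulAut.conj
  contMDiff_act := by
    have h1 : ContMDiff (𝓘(ℝ, VG).prod 𝓘(ℝ, VG)) 𝓘(ℝ, VG) ∞ (fun p : G × G => p.1) :=
      contMDiff_fst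
    have h2 : ContMDiff (𝓘(ℝ, VG).prod 𝓘(ℝ, VG)) 𝓘(ℝ, VG) ∞ (fun p : G × G => p.2) :=
      contMDiff_snd
    exact (h1.mul h2).mul h1.inv
  bd_act _ _ := rfl

variable (VG) in
/-- The adjoint action. -/
def Ad (g : G) : VG →L[ℝ] VG := (conjModule VG (G := G)).dact g

theorem HasLogDeriv.conj {f : ℝ → G} {a : VG} {t : ℝ} (hf : HasLogDeriv f a t) (g : G) :
    HasLogDeriv (fun τ => g * f τ * g⁻¹) (Ad VG g a) t :=
  hf.map (h := (MulAut.conj g).toMonoidHom)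
    ((contMDiff_mul_left (I := 𝓘(ℝ, VG)) (n := ∞) (a := g)).mul contMDiff_const)

/-- Left translation moves the product to the identity, where it becomes `(k₀⁻¹ (f₀⁻¹ f) k₀) (k₀⁻¹
k)` with `f₀ = f t`, `k₀ = k t`. There multiplication has addition as its differential. -/
theorem HasLogDeriv.mul {f k : ℝ → G} {a b : VG} {t : ℝ} (hf : HasLogDeriv f a t)
    (hk : HasLogDeriv k b t) :
    HasLogDeriv (fun τ => f τ * k τ) (Ad VG (k t)⁻¹ a + b) t := by
  apply HasLogDeriv.of_const_mul (f t * k t)⁻¹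
  have h1 := ((hf.const_mul (f t)⁻¹).conj (k t)⁻¹).mul_of_eq_one (hk.const_mul (k t)⁻¹)
    (by simp) (by simp)
  convert h1 using 2
  group

/-- Smoothness of inversion provides some logarithmic derivative; the product rule for `f f⁻¹ = 1`
then determines it. -/
theorem HasLogDeriv.inv {f : ℝ → G} {a : VG} {t : ℝ} (hf : HasLogDeriv f a t) :
    HasLogDeriv (fun τ => (f τ)⁻¹) (-Ad VG (f t) a) t := by
  have h0 : MDifferentiableAt 𝓘(ℝ, ℝ) 𝓘(ℝ, VG) (fun τ => (f τ)⁻¹) t :=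
    HasDiff.mdifferentiableAt
      (((contMDiff_inv 𝓘(ℝ, VG) ∞ (G := G)).hasDiff (f t)).comp hf)
  obtain ⟨c, hc⟩ := exists_hasLogDeriv h0
  have h1 := hf.mul hc
  simp only [mul_inv_cancel, inv_inv] at h1
  have h2 := h1.unique (hasLogDeriv_const 1 t)
  rw [← eq_neg_of_add_eq_zero_right h2]
  exact hc

/-- A curve in a Lie group with vanishing derivative is constant. -/
theorem eq_of_hasLogDeriv_zero {f : ℝ → G} {a b : ℝ} (hab : a ≤ b)
    (hc : ContinuousOn f (Icc a b)) (hd : ∀ t ∈ Ioo a b, HasLogDeriv f (0 : VG) t) :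
    f a = f b := by
  have : T1Space G := ChartedSpace.t1Space VG G
  rcases hab.eq_or_lt with rfl | hab
  · rfl
  -- Local constancy: in the chart at `f c` the curve has zero derivative, and the chart is
  -- injective.
  have key : ∀ c ∈ Ioo a b, ∀ᶠ t in 𝓝 c, f t = f c := by
    intro c hcm
    set ψ := extChartAt 𝓘(ℝ, VG) (f c) with hψ
    have hev : ∀ᶠ t in 𝓝 c, t ∈ Ioo a b ∧ f t ∈ ψ.source :=
      Filter.Eventually.and (Ioo_mem_nhds hcm.1 hcm.2)
        ((hd c hcm).continuousAt.preimage_mem_nhds (extChartAt_source_mem_nhds (f c)))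
    obtain ⟨r, hr, hball⟩ := Metric.eventually_nhds_iff_ball.1 hev
    have hD : ∀ t ∈ Metric.ball c r, HasDerivAt (fun τ => ψ (f τ)) 0 t := by
      intro t ht
      have h1 := (hd t (hball t ht).1).hasDerivAt_comp (F := ψ)
        (mdifferentiableAt_extChartAt (I := 𝓘(ℝ, VG)) (by
          simpa [hψ] using (hball t ht).2)).hasDiff
      rwa [map_zero, map_zero] at h1
    have hconst : ∀ t ∈ Metric.ball c r, ψ (f t) = ψ (f c) := fun t ht =>
      Metric.isOpen_ball.is_const_of_deriv_eq_zero (convex_ball c r).isPreconnected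
        (fun x hx => (hD x hx).differentiableAt.differentiableWithinAt)
        (fun x hx => (hD x hx).deriv) ht (Metric.mem_ball_self hr)
    filter_upwards [Metric.ball_mem_nhds c hr] with t ht
    exact ψ.injOn (hball t ht).2 (hball c (Metric.mem_ball_self hr)).2 (hconst t ht)
  have hconst : ∀ c ∈ Ioo a b, ∀ d ∈ Ioo a b, f c = f d := by
    have hlc : IsLocallyConstant (fun t : Ioo a b => f t) := by
      rw [IsLocallyConstant.iff_eventually_eq]
      intro c
      exact (continuous_subtype_val.tendsto c).eventually (key c c.2)
    intro c hc d hd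
    have : PreconnectedSpace (Ioo a b) := Subtype.preconnectedSpace isPreconnected_Ioo
    exact hlc.apply_eq_of_preconnectedSpace ⟨c, hc⟩ ⟨d, hd⟩
  set m := (a + b) / 2 with hm
  have hmm : m ∈ Ioo a b := ⟨by simp only [hm]; linarith, by simp only [hm]; linarith⟩
  -- The endpoints are reached by continuity, since the point `f m` is closed.
  have hcl : ∀ t ∈ Icc a b, f t = f m := by
    intro t ht
    have h1 : MapsTo f (Ioo a b) {f m} := fun s hs => hconst s hs m hmm
    have h2 := h1.closure_of_continuousOn (by rw [closure_Ioo hab.ne]; exact hc)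
    rw [closure_Ioo hab.ne, closure_singleton] at h2
    exact h2 ht
  rw [hcl a ⟨le_rfl, hab.le⟩, hcl b ⟨hab.le, le_rfl⟩]

end LieCalculus

/-! ### Group multiplication in the chart at the identity. -/

section Chart

variable {VG : Type*} [NormedAddCommGroup VG] [NormedSpace ℝ VG]
variable {G : Type*} [TopologicalSpace G] [ChartedSpace VG G]

theorem hasDiff_extChartAt [IsManifold 𝓘(ℝ, VG) ∞ G] {c g : G}
    (hg : g ∈ (extChartAt 𝓘(ℝ, VG) c).source) :
    HasDiff (extChartAt 𝓘(ℝ, VG) c) g (diff VG VG (extChartAt 𝓘(ℝ, VG) c) g) := by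
  have : IsManifold 𝓘(ℝ, VG) 1 G := IsManifold.of_le (n := ∞) (by simp)
  exact (mdifferentiableAt_extChartAt (I := 𝓘(ℝ, VG)) (by simpa using hg)).hasDiff

theorem contMDiffAt_extChartAt_symm [IsManifold 𝓘(ℝ, VG) ∞ G] {c : G} {y : VG}
    (hy : y ∈ (extChartAt 𝓘(ℝ, VG) c).target) :
    ContMDiffAt 𝓘(ℝ, VG) 𝓘(ℝ, VG) ∞ (extChartAt 𝓘(ℝ, VG) c).symm y :=
  (contMDiffOn_extChartAt_symm c).contMDiffAt (extChartAt_target_mem_nhds' hy)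

theorem diff_extChartAt_comp_diff_symm [IsManifold 𝓘(ℝ, VG) ∞ G] {c : G} {y : VG}
    (hy : y ∈ (extChartAt 𝓘(ℝ, VG) c).target) :
    (diff VG VG (extChartAt 𝓘(ℝ, VG) c) ((extChartAt 𝓘(ℝ, VG) c).symm y)).comp
      (diff VG VG (extChartAt 𝓘(ℝ, VG) c).symm y) = ContinuousLinearMap.id ℝ VG := by
  have h1 := (hasDiff_extChartAt ((extChartAt 𝓘(ℝ, VG) c).map_target hy)).comp
    (contMDiffAt_extChartAt_symm hy).hasDiff
  refine h1.unique ((hasDiff_id y).congr ?_)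
  filter_upwards [extChartAt_target_mem_nhds' hy] with z hz
  exact (extChartAt 𝓘(ℝ, VG) c).right_inv hz

theorem diff_symm_comp_diff_extChartAt [IsManifold 𝓘(ℝ, VG) ∞ G] {c : G} {y : VG}
    (hy : y ∈ (extChartAt 𝓘(ℝ, VG) c).target) :
    (diff VG VG (extChartAt 𝓘(ℝ, VG) c).symm y).comp
      (diff VG VG (extChartAt 𝓘(ℝ, VG) c) ((extChartAt 𝓘(ℝ, VG) c).symm y)) =
      ContinuousLinearMap.id ℝ VG := by
  have h1 := (contMDiffAt_extChartAt_symm hy).hasDiff.comp_of_eq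
    (hasDiff_extChartAt ((extChartAt 𝓘(ℝ, VG) c).map_target hy))
    ((extChartAt 𝓘(ℝ, VG) c).right_inv hy)
  refine h1.unique ((hasDiff_id _).congr ?_)
  filter_upwards [extChartAt_source_mem_nhds' ((extChartAt 𝓘(ℝ, VG) c).map_target hy)] with z hz
  exact (extChartAt 𝓘(ℝ, VG) c).left_inv hz

theorem diff_extChartAt_self [IsManifold 𝓘(ℝ, VG) ∞ G] (c : G) :
    diff VG VG (extChartAt 𝓘(ℝ, VG) c) c = ContinuousLinearMap.id ℝ VG := by
  have : IsManifold 𝓘(ℝ, VG) 1 G := IsManifold.of_le (n := ∞) (by simp)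
  exact mfderiv_extChartAt_self

theorem diff_extChartAt_symm_self [IsManifold 𝓘(ℝ, VG) ∞ G] (c : G) :
    diff VG VG (extChartAt 𝓘(ℝ, VG) c).symm (extChartAt 𝓘(ℝ, VG) c c) =
      ContinuousLinearMap.id ℝ VG := by
  have h := diff_symm_comp_diff_extChartAt (mem_extChartAt_target (I := 𝓘(ℝ, VG)) c)
  rwa [extChartAt_to_inv, diff_extChartAt_self, ContinuousLinearMap.comp_id] at h

variable [Group G]

variable (VG G) in
/-- The multiplication in the preferred chart at the identity. -/
def chartMul (p : VG × VG) : VG :=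
  extChartAt 𝓘(ℝ, VG) (1 : G)
    ((extChartAt 𝓘(ℝ, VG) (1 : G)).symm p.1 * (extChartAt 𝓘(ℝ, VG) (1 : G)).symm p.2)

variable (VG G) in
/-- The differential at the identity of left translations, in the preferred chart. -/
def chartLeft (y : VG) : VG →L[ℝ] VG :=
  (fderiv ℝ (chartMul VG G) (y, extChartAt 𝓘(ℝ, VG) (1 : G) 1)).comp
    (ContinuousLinearMap.inr ℝ VG VG)

variable [LieGroup 𝓘(ℝ, VG) ∞ G]

theorem contDiffAt_chartMul {y z : VG} (hy : y ∈ (extChartAt 𝓘(ℝ, VG) (1 : G)).target)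
    (hz : z ∈ (extChartAt 𝓘(ℝ, VG) (1 : G)).target)
    (h : (extChartAt 𝓘(ℝ, VG) (1 : G)).symm y * (extChartAt 𝓘(ℝ, VG) (1 : G)).symm z ∈
      (extChartAt 𝓘(ℝ, VG) (1 : G)).source) :
    ContDiffAt ℝ ∞ (chartMul VG G) (y, z) := by
  rw [← contMDiffAt_iff_contDiffAt]
  have h1 : ContMDiffAt 𝓘(ℝ, VG × VG) 𝓘(ℝ, VG) ∞
      (fun p : VG × VG => (extChartAt 𝓘(ℝ, VG) (1 : G)).symm p.1) (y, z) :=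
    ContMDiffAt.comp (y, z) (contMDiffAt_extChartAt_symm hy) contDiffAt_fst.contMDiffAt
  have h2 : ContMDiffAt 𝓘(ℝ, VG × VG) 𝓘(ℝ, VG) ∞
      (fun p : VG × VG => (extChartAt 𝓘(ℝ, VG) (1 : G)).symm p.2) (y, z) :=
    ContMDiffAt.comp (y, z) (contMDiffAt_extChartAt_symm hz) contDiffAt_snd.contMDiffAt
  have h3 : ContMDiffAt 𝓘(ℝ, VG) 𝓘(ℝ, VG) ∞ (extChartAt 𝓘(ℝ, VG) (1 : G))
      ((extChartAt 𝓘(ℝ, VG) (1 : G)).symm y * (extChartAt 𝓘(ℝ, VG) (1 : G)).symm z) :=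
    contMDiffAt_extChartAt' (by simpa using h)
  exact ContMDiffAt.comp (y, z) h3 (h1.mul h2)

theorem contDiffAt_chartMul_right {y : VG} (hy : y ∈ (extChartAt 𝓘(ℝ, VG) (1 : G)).target) :
    ContDiffAt ℝ ∞ (chartMul VG G) (y, extChartAt 𝓘(ℝ, VG) (1 : G) 1) :=
  contDiffAt_chartMul hy (mem_extChartAt_target _)
    (by simpa using (extChartAt 𝓘(ℝ, VG) (1 : G)).map_target hy)

theorem contDiffAt_chartMul_left {y : VG} (hy : y ∈ (extChartAt 𝓘(ℝ, VG) (1 : G)).target) :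
    ContDiffAt ℝ ∞ (chartMul VG G) (extChartAt 𝓘(ℝ, VG) (1 : G) 1, y) :=
  contDiffAt_chartMul (mem_extChartAt_target _) hy
    (by simpa using (extChartAt 𝓘(ℝ, VG) (1 : G)).map_target hy)

theorem contDiffAt_chartLeft {y : VG} (hy : y ∈ (extChartAt 𝓘(ℝ, VG) (1 : G)).target) :
    ContDiffAt ℝ ∞ (chartLeft VG G) y := by
  have h1 : ContDiffAt ℝ ∞ (fderiv ℝ (chartMul VG G)) (y, extChartAt 𝓘(ℝ, VG) (1 : G) 1) :=
    (contDiffAt_chartMul_right hy).fderiv_right (by simp)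
  have h2 : ContDiffAt ℝ ∞ (fun z : VG => (z, extChartAt 𝓘(ℝ, VG) (1 : G) 1)) y := by fun_prop
  exact (h1.comp y h2).clm_comp contDiffAt_const

/-- The partial derivative of the multiplication in its second variable is a left translation; the
inverse chart contributes nothing because its differential at the image of `1` is the identity. -/
theorem chartLeft_eq {y : VG} (hy : y ∈ (extChartAt 𝓘(ℝ, VG) (1 : G)).target) :
    chartLeft VG G y = (diff VG VG (extChartAt 𝓘(ℝ, VG) (1 : G))
      ((extChartAt 𝓘(ℝ, VG) (1 : G)).symm y)).comp
        (leftDiff VG ((extChartAt 𝓘(ℝ, VG) (1 : G)).symm y)) := by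
  set φ := extChartAt 𝓘(ℝ, VG) (1 : G) with hφ
  have h1 : HasFDerivAt (fun z => chartMul VG G (y, z)) (chartLeft VG G y) (φ 1) :=
    ((contDiffAt_chartMul_right hy).differentiableAt (by simp)).hasFDerivAt.comp (φ 1)
      (hasFDerivAt_prodMk_right y (φ 1))
  have h2 : HasDiff φ.symm (φ 1) (diff VG VG φ.symm (φ 1)) :=
    (contMDiffAt_extChartAt_symm (mem_extChartAt_target _)).hasDiff
  rw [hφ, diff_extChartAt_symm_self, ← hφ] at h2
  have h3 := (leftDiff_hasDiff (VG := VG) (φ.symm y)).comp_of_eq h2 (by simp [hφ])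
  have h4 := (hasDiff_extChartAt (φ.map_target hy)).comp_of_eq h3 (by simp [hφ])
  exact (hasDiff_iff_hasFDerivAt.2 h1).unique h4

theorem chartLeft_one : chartLeft VG G (extChartAt 𝓘(ℝ, VG) (1 : G) 1) =
    ContinuousLinearMap.id ℝ VG := by
  rw [chartLeft_eq (mem_extChartAt_target _), extChartAt_to_inv, diff_extChartAt_self,
    leftDiff_one, ContinuousLinearMap.id_comp]

/-- Solutions of the transport equation in the preferred chart at the identity. -/
theorem hasLogDeriv_of_chart {y : ℝ → VG} {a : VG} {t : ℝ}
    (ht : y t ∈ (extChartAt 𝓘(ℝ, VG) (1 : G)).target)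
    (h : HasDerivAt y (chartLeft VG G (y t) a) t) :
    HasLogDeriv (fun τ => (extChartAt 𝓘(ℝ, VG) (1 : G)).symm (y τ)) a t := by
  have h1 := (contMDiffAt_extChartAt_symm ht).hasDiff.comp
    (hasDiff_iff_hasFDerivAt.2 h.hasFDerivAt)
  unfold HasLogDeriv
  convert h1 using 1
  ext
  have h2 := congrArg (fun L : VG →L[ℝ] VG => L (leftDiff VG
      ((extChartAt 𝓘(ℝ, VG) (1 : G)).symm (y t)) a)) (diff_symm_comp_diff_extChartAt ht)
  simpa [chartLeft_eq ht] using h2.symm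

/-- A curve through the identity has a logarithmic derivative there if its expression in the
preferred chart has a derivative. -/
theorem hasLogDeriv_of_eq_one {f : ℝ → G} {a : VG} {t : ℝ} (ht : f t = 1)
    (hs : ∀ᶠ τ in 𝓝 t, f τ ∈ (extChartAt 𝓘(ℝ, VG) (1 : G)).source)
    (h : HasDerivAt (fun τ => extChartAt 𝓘(ℝ, VG) (1 : G) (f τ)) a t) : HasLogDeriv f a t := by
  have h1 : HasLogDeriv (fun τ => (extChartAt 𝓘(ℝ, VG) (1 : G)).symm
      (extChartAt 𝓘(ℝ, VG) (1 : G) (f τ))) a t := by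
    apply hasLogDeriv_of_chart
    · rw [ht]; exact mem_extChartAt_target _
    · rw [ht, chartLeft_one]; exact h
  refine h1.congr ?_
  filter_upwards [hs] with τ hτ
  exact ((extChartAt 𝓘(ℝ, VG) (1 : G)).left_inv hτ).symm

end Chart

/-! ### The induced representations on Lie algebras, and the bracket as the differential of `Ad`. -/

section Representation

variable {VG : Type*} [NormedAddCommGroup VG] [NormedSpace ℝ VG]
variable {G : Type*} [TopologicalSpace G] [ChartedSpace VG G] [Group G]
variable {VE : Type*} [NormedAddCommGroup VE] [NormedSpace ℝ VE]
variable {E : Type*} [TopologicalSpace E] [ChartedSpace VE E] [Group E]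
variable [LieGroup 𝓘(ℝ, VG) ∞ G] [LieGroup 𝓘(ℝ, VE) ∞ E]
variable (P : LiePreCrossedModule VG G VE E)

namespace LiePreCrossedModule

theorem dact_eq (g : G) : P.dact g = diff VE VE (fun e : E => P.act g e) 1 := rfl

theorem contMDiff_act_apply (g : G) :
    ContMDiff 𝓘(ℝ, VE) 𝓘(ℝ, VE) ∞ (fun e : E => P.act g e) :=
  P.contMDiff_act.comp (contMDiff_const.prodMk contMDiff_id)

theorem hasDiff_act (g : G) : HasDiff (fun e : E => P.act g e) 1 (P.dact g) :=
  (P.contMDiff_act_apply g).hasDiff 1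

theorem dact_one : P.dact 1 = ContinuousLinearMap.id ℝ VE := by
  simp only [dact_eq, map_one, MulAut.one_apply]
  exact (hasDiff_id _).diff_eq

theorem dact_mul (g h : G) : P.dact (g * h) = (P.dact g).comp (P.dact h) := by
  have h1 := (P.hasDiff_act g).comp_of_eq (P.hasDiff_act h) (map_one _)
  rw [dact_eq, ← h1.diff_eq]
  simp only [map_mul, MulAut.mul_apply]

theorem dact_inv_dact (g : G) (v : VE) : P.dact g⁻¹ (P.dact g v) = v := by
  have := P.dact_mul g⁻¹ g
  rw [inv_mul_cancel, dact_one] at this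
  exact congrArg (fun L : VE →L[ℝ] VE => L v) this.symm

theorem dact_dact_inv (g : G) (v : VE) : P.dact g (P.dact g⁻¹ v) = v := by
  simpa using P.dact_inv_dact g⁻¹ v

theorem contMDiff_dact : ContMDiff 𝓘(ℝ, VG) 𝓘(ℝ, VE →L[ℝ] VE) ∞ P.dact := by
  have : IsManifold 𝓘(ℝ, VE) 1 E := IsManifold.of_le (n := ∞) (by simp)
  intro g
  have h1 : ContMDiffAt (𝓘(ℝ, VG).prod 𝓘(ℝ, VE)) 𝓘(ℝ, VE) ∞
      (Function.uncurry fun (g : G) (e : E) => P.act g e) (g, 1) := P.contMDiff_act _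
  have h2 := ContMDiffAt.mfderiv (x₀ := g) (m := ∞) (fun (g : G) (e : E) => P.act g e)
    (fun _ => (1 : E)) h1 contMDiffAt_const (by simp)
  refine ContMDiffAt.congr_of_eventuallyEq h2 (Filter.Eventually.of_forall fun x => ?_)
  rw [inTangentCoordinates_eq_mfderiv_comp (by simp) (by simp)]
  refine ContinuousLinearMap.ext fun v => ?_
  have h3 := diff_extChartAt_self (VG := VE) (1 : E)
  have h4 := diff_extChartAt_symm_self (VG := VE) (1 : E)
  have e1 : mfderivWithin 𝓘(ℝ, VE) 𝓘(ℝ, VE) (extChartAt 𝓘(ℝ, VE) (1 : E)).symm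
      (range 𝓘(ℝ, VE)) (extChartAt 𝓘(ℝ, VE) (1 : E) 1) v = v := by
    rw [ModelWithCorners.Boundaryless.range_eq_univ, mfderivWithin_univ]
    exact congrArg (fun L : VE →L[ℝ] VE => L v) h4
  -- Automorphisms fix `1`, so both coordinate changes in `inTangentCoordinates` are based at `1`,
  -- where the chart has identity differential.
  have e2 : ∀ (a b : E) (v : VE), a = 1 → b = 1 →
      (diff VE VE (extChartAt 𝓘(ℝ, VE) a) b : VE →L[ℝ] VE) v = v := by
    rintro a b v rfl rfl
    rw [h3]; rfl
  refine Eq.symm ?_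
  refine (e2 (P.act g 1) (P.act x 1) _ (map_one _) (map_one _)).trans ?_
  exact congrArg (P.dact x) e1

/-- The differential of the representation of `G` on the Lie algebra of `E`. -/
def drep : VG →L[ℝ] VE →L[ℝ] VE := diff VG (VE →L[ℝ] VE) P.dact 1

theorem hasDiff_dact (g : G) : HasDiff P.dact g (diff VG (VE →L[ℝ] VE) P.dact g) :=
  P.contMDiff_dact.hasDiff g

/-- Differentiating `dact (g x) = dact g ∘ dact x` at `x = 1` reduces the derivative everywhere to
`drep`. -/
theorem diff_dact_leftDiff (g : G) (a : VG) :
    diff VG (VE →L[ℝ] VE) P.dact g (leftDiff VG g a) = (P.dact g).comp (P.drep a) := by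
  have h1 := (P.hasDiff_dact g).comp_of_eq (leftDiff_hasDiff g) (mul_one g)
  have h2 : HasDiff (fun x : G => (P.dact g).comp (P.dact x)) 1
      ((ContinuousLinearMap.compL ℝ VE VE VE (P.dact g)).comp P.drep) :=
    (hasDiff_iff_hasFDerivAt.2
      (ContinuousLinearMap.compL ℝ VE VE VE (P.dact g)).hasFDerivAt).comp (P.hasDiff_dact 1)
  simp only [← P.dact_mul] at h2
  exact congrArg (fun L : VG →L[ℝ] (VE →L[ℝ] VE) => L a) (h1.unique h2)

theorem hasDerivAt_dact {f : ℝ → G} {a : VG} {t : ℝ} (h : HasLogDeriv f a t) :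
    HasDerivAt (fun τ => P.dact (f τ)) ((P.dact (f t)).comp (P.drep a)) t := by
  rw [← diff_dact_leftDiff]
  exact h.hasDerivAt_comp (P.hasDiff_dact (f t))

theorem dbd_dact (g : G) (v : VE) : P.dbd (P.dact g v) = Ad VG g (P.dbd v) := by
  have h1 : HasDiff P.bd 1 P.dbd := P.contMDiff_bd.hasDiff 1
  have h2 := h1.comp_of_eq (P.hasDiff_act g) (map_one _)
  have h3 := ((conjModule VG (G := G)).hasDiff_act g).comp_of_eq h1 (map_one _)
  simp only [P.bd_act] at h2
  exact congrArg (fun L : VE →L[ℝ] VG => L v) (h2.unique h3)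

/-- Infinitesimal form of `dact (g x g⁻¹) = dact g ∘ dact x ∘ (dact g)⁻¹`, differentiated in `x` at
`1`. -/
theorem drep_Ad (g : G) (a : VG) (v : VE) :
    P.drep (Ad VG g a) (P.dact g v) = P.dact g (P.drep a v) := by
  have h1 := (P.hasDiff_dact 1).comp_of_eq ((conjModule VG (G := G)).hasDiff_act g) (map_one _)
  have h2 := (hasDiff_iff_hasFDerivAt.2
      (((ContinuousLinearMap.compL ℝ VE VE VE (P.dact g)).comp
        ((ContinuousLinearMap.compL ℝ VE VE VE).flip (P.dact g⁻¹))).hasFDerivAt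
          (x := P.dact 1))).comp (P.hasDiff_dact 1)
  have e : (fun x : G => P.dact ((conjModule VG (G := G)).act g x)) =
      fun x : G => ((ContinuousLinearMap.compL ℝ VE VE VE (P.dact g)).comp
        ((ContinuousLinearMap.compL ℝ VE VE VE).flip (P.dact g⁻¹))) (P.dact x) := by
    funext x
    change P.dact (g * x * g⁻¹) = _
    rw [P.dact_mul, P.dact_mul]
    rfl
  rw [e] at h1
  have h3 := congrArg (fun L : VG →L[ℝ] (VE →L[ℝ] VE) => L a (P.dact g v)) (h1.unique h2)
  refine h3.trans ?_
  change P.dact g (P.drep a (P.dact g⁻¹ (P.dact g v))) = _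
  rw [dact_inv_dact]

end LiePreCrossedModule

theorem Ad_one : Ad VG (1 : G) = ContinuousLinearMap.id ℝ VG := (conjModule VG).dact_one

theorem Ad_inv_Ad (g : G) (v : VG) : Ad VG g⁻¹ (Ad VG g v) = v := (conjModule VG).dact_inv_dact g v

theorem Ad_Ad_inv (g : G) (v : VG) : Ad VG g (Ad VG g⁻¹ v) = v := (conjModule VG).dact_dact_inv g v

theorem contMDiff_Ad : ContMDiff 𝓘(ℝ, VG) 𝓘(ℝ, VG →L[ℝ] VG) ∞ (Ad VG (G := G)) :=
  (conjModule VG).contMDiff_dact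

variable (VG G) in
/-- The adjoint representation of the Lie algebra. -/
def ad : VG →L[ℝ] VG →L[ℝ] VG := (conjModule VG (G := G)).drep

theorem hasDerivAt_Ad {f : ℝ → G} {a : VG} {t : ℝ} (h : HasLogDeriv f a t) :
    HasDerivAt (fun τ => Ad VG (f τ)) ((Ad VG (f t)).comp (ad VG G a)) t :=
  (conjModule VG).hasDerivAt_dact h

/-- Differentiate `g x = (g x g⁻¹) g` at `x = 1`. -/
theorem leftDiff_eq_rightDiff (g : G) (v : VG) :
    leftDiff VG g v = diff VG VG (fun x : G => x * g) 1 (Ad VG g v) := by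
  have h1 := ((contMDiff_mul_right (I := 𝓘(ℝ, VG)) (n := ∞) (a := g)).hasDiff 1).comp_of_eq
    ((conjModule VG (G := G)).hasDiff_act g) (map_one _)
  have h2 := (leftDiff_hasDiff (VG := VG) g)
  have e : (fun x : G => (conjModule VG (G := G)).act g x * g) = fun x => g * x := by
    funext x
    change g * x * g⁻¹ * g = _
    simp
  rw [e] at h1
  exact congrArg (fun L : VG →L[ℝ] VG => L v) (h2.unique h1)

/-- Left and right translations in the preferred chart at the identity. -/
theorem chartLeft_eq_right {y : VG} (hy : y ∈ (extChartAt 𝓘(ℝ, VG) (1 : G)).target) (v : VG) :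
    chartLeft VG G y v = fderiv ℝ (chartMul VG G) (extChartAt 𝓘(ℝ, VG) (1 : G) 1, y)
      (Ad VG ((extChartAt 𝓘(ℝ, VG) (1 : G)).symm y) v, 0) := by
  rw [chartLeft_eq hy]
  set φ := extChartAt 𝓘(ℝ, VG) (1 : G) with hφ
  have h1 : HasFDerivAt (fun z => chartMul VG G (z, y))
      ((fderiv ℝ (chartMul VG G) (φ 1, y)).comp (ContinuousLinearMap.inl ℝ VG VG)) (φ 1) :=
    HasFDerivAt.comp (f := fun z => (z, y)) (φ 1)
      ((contDiffAt_chartMul_left hy).differentiableAt (by simp)).hasFDerivAt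
      (hasFDerivAt_prodMk_left (φ 1) y)
  have h2 : HasDiff φ.symm (φ 1) (diff VG VG φ.symm (φ 1)) :=
    (contMDiffAt_extChartAt_symm (mem_extChartAt_target _)).hasDiff
  rw [hφ, diff_extChartAt_symm_self, ← hφ] at h2
  have h3 := ((contMDiff_mul_right (I := 𝓘(ℝ, VG)) (n := ∞) (a := φ.symm y)).hasDiff 1).comp_of_eq
    h2 (by simp [hφ])
  have h4 := (hasDiff_extChartAt (φ.map_target hy)).comp_of_eq h3 (by simp [hφ])
  have h5 := congrArg (fun L : VG →L[ℝ] VG => L (Ad VG (φ.symm y) v))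
    ((hasDiff_iff_hasFDerivAt.2 h1).unique h4)
  rw [ContinuousLinearMap.comp_apply, leftDiff_eq_rightDiff]
  exact h5.symm

theorem fderiv_chartLeft_apply (u v : VG) :
    fderiv ℝ (fun y => chartLeft VG G y v) (extChartAt 𝓘(ℝ, VG) (1 : G) 1) u =
      fderiv ℝ (fderiv ℝ (chartMul VG G))
        (extChartAt 𝓘(ℝ, VG) (1 : G) 1, extChartAt 𝓘(ℝ, VG) (1 : G) 1) (u, 0) (0, v) := by
  set e := extChartAt 𝓘(ℝ, VG) (1 : G) 1
  have h1 : ContDiffAt ℝ ∞ (fderiv ℝ (chartMul VG G)) (e, e) :=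
    (contDiffAt_chartMul_right (mem_extChartAt_target _)).fderiv_right (by simp)
  have h2 := HasFDerivAt.comp (f := fun y => (y, e)) e
    (h1.differentiableAt (by simp)).hasFDerivAt (hasFDerivAt_prodMk_left e e)
  have h3 := h2.clm_apply (hasFDerivAt_const ((0, v) : VG × VG) e)
  have h4 : HasFDerivAt (fun y => chartLeft VG G y v) _ e := h3
  rw [h4.fderiv]
  simp

/-- A left translate of `v` is a right translate of `Ad v`. Differentiating this equality in the
chart at `1` along `u` gives `ad u v` plus a mixed second derivative of the multiplication; by
symmetry of second derivatives the latter is the other term of the commutator. -/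
theorem ad_eq (u v : VG) :
    ad VG G u v = fderiv ℝ (fun y => chartLeft VG G y v) (extChartAt 𝓘(ℝ, VG) (1 : G) 1) u -
      fderiv ℝ (fun y => chartLeft VG G y u) (extChartAt 𝓘(ℝ, VG) (1 : G) 1) v := by
  set φ := extChartAt 𝓘(ℝ, VG) (1 : G) with hφ
  have h0 : ContDiffAt ℝ ∞ (chartMul VG G) (φ 1, φ 1) :=
    contDiffAt_chartMul_right (mem_extChartAt_target _)
  have h1 : ContDiffAt ℝ ∞ (fderiv ℝ (chartMul VG G)) (φ 1, φ 1) := h0.fderiv_right (by simp)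
  have h2 := HasFDerivAt.comp (f := fun y => (φ 1, y)) (φ 1)
    (h1.differentiableAt (by simp)).hasFDerivAt (hasFDerivAt_prodMk_right (φ 1) (φ 1))
  have hsymm : HasDiff φ.symm (φ 1) (ContinuousLinearMap.id ℝ VG) := by
    have := (contMDiffAt_extChartAt_symm (mem_extChartAt_target (I := 𝓘(ℝ, VG)) (1 : G))).hasDiff
    rwa [diff_extChartAt_symm_self] at this
  have h3 : HasFDerivAt (fun y => Ad VG (φ.symm y)) (ad VG G) (φ 1) := by
    have := ((conjModule VG (G := G)).hasDiff_dact 1).comp_of_eq hsymm (by simp [hφ])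
    exact hasDiff_iff_hasFDerivAt.1 this
  have h4 := HasFDerivAt.clm_apply h3 (hasFDerivAt_const v (φ 1))
  have h5 := HasFDerivAt.clm_apply h2 (h4.prodMk (hasFDerivAt_const (0 : VG) (φ 1)))
  have h6 : (fun y => chartLeft VG G y v) =ᶠ[𝓝 (φ 1)]
      fun y => fderiv ℝ (chartMul VG G) (φ 1, y) (Ad VG (φ.symm y) v, 0) := by
    filter_upwards [extChartAt_target_mem_nhds (I := 𝓘(ℝ, VG)) (1 : G)] with y hy
    exact chartLeft_eq_right hy v
  have h7 := (HasFDerivAt.congr_of_eventuallyEq h5 h6).fderiv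
  have h8 := congrArg (fun L : VG →L[ℝ] VG => L u) h7
  have h9 : ∀ w : VG, fderiv ℝ (chartMul VG G) (φ 1, φ 1) (w, 0) = w := by
    intro w
    have := chartLeft_eq_right (mem_extChartAt_target (I := 𝓘(ℝ, VG)) (1 : G)) w
    rw [chartLeft_one, extChartAt_to_inv, Ad_one] at this
    exact this.symm
  have h2' : minSmoothness ℝ 2 ≤ (∞ : WithTop ℕ∞) := by
    simp only [minSmoothness_of_isRCLikeNormedField]
    exact WithTop.coe_le_coe.2 (le_top : (2 : ℕ∞) ≤ ⊤)
  have hs' := (h0.isSymmSndFDerivAt h2') (v, 0) (0, u)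
  have h10 : φ.symm (φ 1) = 1 := by simp [hφ]
  rw [fderiv_chartLeft_apply v u, hs', h8]
  simp [h9, h10, Ad_one]

/-- The differential of the adjoint action is the Lie bracket. -/
theorem lieAlgBracket_eq_ad (u v : VG) : lieAlgBracket VG G u v = ad VG G u v := by
  -- In the chart, the left-invariant field of `w` is `y ↦ chartLeft y w`, so the manifold bracket
  -- becomes the commutator computed in `ad_eq`.
  have hX : ∀ w : VG, (fun y => chartLeft VG G y w) =ᶠ[𝓝 (extChartAt 𝓘(ℝ, VG) (1 : G) 1)]
      (VectorField.mpullbackWithin 𝓘(ℝ, VG) 𝓘(ℝ, VG) (extChartAt 𝓘(ℝ, VG) (1 : G)).symm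
        (mulInvariantVectorField (show GroupLieAlgebra 𝓘(ℝ, VG) G from w))
        (range 𝓘(ℝ, VG)) : VG → VG) := by
    intro w
    filter_upwards [extChartAt_target_mem_nhds (I := 𝓘(ℝ, VG)) (1 : G)] with y hy
    rw [chartLeft_eq hy]
    have h1 : ContinuousLinearMap.inverse (diff VG VG (extChartAt 𝓘(ℝ, VG) (1 : G)).symm y) =
        diff VG VG (extChartAt 𝓘(ℝ, VG) (1 : G)) ((extChartAt 𝓘(ℝ, VG) (1 : G)).symm y) :=
      ContinuousLinearMap.inverse_eq (diff_symm_comp_diff_extChartAt hy)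
        (diff_extChartAt_comp_diff_symm hy)
    rw [← h1]
    unfold VectorField.mpullbackWithin
    rw [ModelWithCorners.Boundaryless.range_eq_univ, mfderivWithin_univ]
    rfl
  have h0 : lieAlgBracket VG G u v = VectorField.lieBracket ℝ
      (VectorField.mpullbackWithin 𝓘(ℝ, VG) 𝓘(ℝ, VG) (extChartAt 𝓘(ℝ, VG) (1 : G)).symm
        (mulInvariantVectorField (show GroupLieAlgebra 𝓘(ℝ, VG) G from u))
        (range 𝓘(ℝ, VG)) : VG → VG)
      (VectorField.mpullbackWithin 𝓘(ℝ, VG) 𝓘(ℝ, VG) (extChartAt 𝓘(ℝ, VG) (1 : G)).symm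
        (mulInvariantVectorField (show GroupLieAlgebra 𝓘(ℝ, VG) G from v))
        (range 𝓘(ℝ, VG)) : VG → VG) (extChartAt 𝓘(ℝ, VG) (1 : G) 1) := by
    unfold lieAlgBracket
    rw [GroupLieAlgebra.bracket_def, ← VectorField.mlieBracketWithin_univ,
      VectorField.mlieBracketWithin_apply]
    have h1 : (mfderiv 𝓘(ℝ, VG) 𝓘(ℝ, VG) (extChartAt 𝓘(ℝ, VG) (1 : G)) 1) =
      ContinuousLinearMap.id ℝ VG := diff_extChartAt_self (1 : G)
    have h2 : ∀ w : VG, ContinuousLinearMap.inverse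
      (mfderiv 𝓘(ℝ, VG) 𝓘(ℝ, VG) (extChartAt 𝓘(ℝ, VG) (1 : G)) 1) w = w := by
      intro w
      have : ContinuousLinearMap.inverse (ContinuousLinearMap.id ℝ VG) w = w := by simp
      rw [← h1] at this
      exact this
    refine (h2 _).trans ?_
    have hr : range 𝓘(ℝ, VG) = univ := ModelWithCorners.Boundaryless.range_eq_univ
    have : ((extChartAt 𝓘(ℝ, VG) (1 : G)).symm ⁻¹' univ ∩ range 𝓘(ℝ, VG)) = univ := by
      rw [hr]; simp
    rw [this]
    exact congrFun (VectorField.lieBracketWithin_univ (𝕜 := ℝ) (E := VG)) _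
  rw [h0, ← (hX u).lieBracket_vectorField_eq (hX v), VectorField.lieBracket_eq]
  simp only [chartLeft_one]
  exact (ad_eq u v).symm

theorem ad_self (u : VG) : ad VG G u u = 0 := by rw [ad_eq, sub_self]

end Representation

/-- The Picard-Lindelöf theorem, with the information that the solution stays in the ball. -/
theorem exists_solution_mem_closedBall {W : Type*} [NormedAddCommGroup W] [NormedSpace ℝ W]
    [CompleteSpace W] {f : ℝ → W → W} {tmin tmax : ℝ} {t₀ : Icc tmin tmax} {x₀ : W}
    {a L K : NNReal} (hf : IsPicardLindelof f t₀ x₀ a 0 L K) :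
    ∃ α : ℝ → W, Continuous α ∧ α t₀ = x₀ ∧ (∀ t, α t ∈ Metric.closedBall x₀ a) ∧
      ∀ t ∈ Icc tmin tmax, HasDerivWithinAt α (f t (α t)) (Icc tmin tmax) t := by
  obtain ⟨α, hα⟩ := ODE.FunSpace.exists_isFixedPt_next hf (Metric.mem_closedBall_self le_rfl)
  refine ⟨α.compProj, α.continuous_compProj,
    by rw [ODE.FunSpace.compProj_val, ← hα, ODE.FunSpace.next_apply₀],
    fun t => α.compProj_mem_closedBall hf.mul_max_le, fun t ht => ?_⟩
  apply ODE.hasDerivWithinAt_picard_Icc t₀.2 hf.continuousOn_uncurry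
    α.continuous_compProj.continuousOn (fun _ ht' => α.compProj_mem_closedBall hf.mul_max_le)
    x₀ ht |>.congr_of_mem _ ht
  intro t' ht'
  nth_rw 1 [← hα]
  rw [ODE.FunSpace.compProj_of_mem ht', ODE.FunSpace.next_apply]

/-! ### Existence, uniqueness and functoriality of transports. -/

section Transport

variable {VG : Type*} [NormedAddCommGroup VG] [NormedSpace ℝ VG] [FiniteDimensional ℝ VG]
variable {G : Type*} [TopologicalSpace G] [ChartedSpace VG G] [Group G]
variable [LieGroup 𝓘(ℝ, VG) ∞ G]
variable {VH : Type*} [NormedAddCommGroup VH] [NormedSpace ℝ VH] [FiniteDimensional ℝ VH]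
variable {H : Type*} [TopologicalSpace H] [ChartedSpace VH H] [Group H]
variable [LieGroup 𝓘(ℝ, VH) ∞ H]

/-- Two curves with the same logarithmic derivative differ by a left translation. -/
theorem mul_inv_eq_of_hasLogDeriv {f h : ℝ → G} {A : ℝ → VG} {a b : ℝ} (hab : a ≤ b)
    (hf : ContinuousOn f (Icc a b)) (hh : ContinuousOn h (Icc a b))
    (hf' : ∀ t ∈ Ioo a b, HasLogDeriv f (A t) t) (hh' : ∀ t ∈ Ioo a b, HasLogDeriv h (A t) t) :
    f a * (h a)⁻¹ = f b * (h b)⁻¹ := by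
  have : IsTopologicalGroup G := topologicalGroup_of_lieGroup 𝓘(ℝ, VG) ∞
  refine eq_of_hasLogDeriv_zero (VG := VG) (f := fun t => f t * (h t)⁻¹) hab (hf.mul hh.inv)
    fun t ht => ?_
  have h1 := (hf' t ht).mul (hh' t ht).inv
  rwa [inv_inv, add_neg_cancel] at h1

theorem eq_of_hasLogDeriv {f h : ℝ → G} {A : ℝ → VG} {a b : ℝ} (hab : a ≤ b)
    (hf : ContinuousOn f (Icc a b)) (hh : ContinuousOn h (Icc a b))
    (hf' : ∀ t ∈ Ioo a b, HasLogDeriv f (A t) t) (hh' : ∀ t ∈ Ioo a b, HasLogDeriv h (A t) t)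
    (h0 : f a = h a) : f b = h b := by
  have h1 := mul_inv_eq_of_hasLogDeriv hab hf hh hf' hh'
  rw [h0, mul_inv_cancel] at h1
  exact (mul_inv_eq_one.1 h1.symm)

/-- Short solutions of the transport equation, with an estimate. -/
theorem exists_local_transport (ε : ℝ) (hε : 0 < ε) : ∃ δ > 0, ∀ (D : ℝ → VG) (a b K : ℝ),
    Continuous D → a ≤ b → (∀ t ∈ Icc a b, ‖D t‖ ≤ K) → K * (b - a) ≤ δ →
    ∃ f : ℝ → G, f a = 1 ∧ ContinuousOn f (Icc a b) ∧ (∀ t ∈ Ioo a b, HasLogDeriv f (D t) t) ∧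
      ∀ t ∈ Icc a b, f t ∈ (extChartAt 𝓘(ℝ, VG) (1 : G)).source ∧
        ‖extChartAt 𝓘(ℝ, VG) (1 : G) (f t) - extChartAt 𝓘(ℝ, VG) (1 : G) 1 - ∫ τ in a..t, D τ‖
          ≤ ε * K * (b - a) := by
  set φ := extChartAt 𝓘(ℝ, VG) (1 : G) with hφ
  have hL : ContDiffAt ℝ ∞ (chartLeft VG G) (φ 1) := contDiffAt_chartLeft (mem_extChartAt_target _)
  obtain ⟨C, s, hs, hC⟩ := (hL.of_le (m := 1) (by simp)).exists_lipschitzOnWith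
  -- Closeness `ε` of `chartLeft` to the identity gives the final estimate; closeness `1` bounds the
  -- speed of a solution by `2 * K`.
  have hη : 0 < min ε 1 := lt_min hε one_pos
  have h1 : ∀ᶠ y in 𝓝 (φ 1), ‖chartLeft VG G y - ContinuousLinearMap.id ℝ VG‖ < min ε 1 := by
    have := hL.continuousAt.sub (continuousAt_const (y := ContinuousLinearMap.id ℝ VG))
    refine this.norm.eventually_lt continuousAt_const ?_
    simp only [Pi.sub_apply]
    rwa [hφ, chartLeft_one, sub_self, norm_zero]
  have h2 : ∀ᶠ y in 𝓝 (φ 1), y ∈ φ.target ∧ y ∈ s ∧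
      ‖chartLeft VG G y - ContinuousLinearMap.id ℝ VG‖ < min ε 1 :=
    Filter.Eventually.and (extChartAt_target_mem_nhds (1 : G)) (Filter.Eventually.and hs h1)
  obtain ⟨r, hr, hball⟩ := Metric.nhds_basis_closedBall.eventually_iff.1 h2
  -- With speed at most `2 * K`, the solution stays in the ball of radius `r` as long as `2 * K * (b
  -- - a) ≤ r`.
  refine ⟨r / 2, by positivity, fun D a b K hD hab hK hKd => ?_⟩
  have hK0 : 0 ≤ K := (norm_nonneg _).trans (hK a ⟨le_rfl, hab⟩)
  have hL2 : ∀ y ∈ Metric.closedBall (φ 1) r, ∀ v, ‖chartLeft VG G y v - v‖ ≤ min ε 1 * ‖v‖ := by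
    intro y hy v
    exact (chartLeft VG G y - ContinuousLinearMap.id ℝ VG).le_of_opNorm_le (hball hy).2.2.le v
  have hPL : IsPicardLindelof (fun t y => chartLeft VG G y (D t)) (⟨a, left_mem_Icc.2 hab⟩ : Icc a b)
      (φ 1) ⟨r, hr.le⟩ 0 ⟨2 * K, by positivity⟩ (C * ⟨K, hK0⟩) := by
    constructor
    · intro t ht
      have := (hC.mono fun y hy => (hball hy).2.1 :
        LipschitzOnWith C (chartLeft VG G) (Metric.closedBall (φ 1) r))
      rw [lipschitzOnWith_iff_norm_sub_le] at this ⊢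
      intro x hx y hy
      change ‖chartLeft VG G x (D t) - chartLeft VG G y (D t)‖ ≤ C * K * ‖x - y‖
      calc ‖chartLeft VG G x (D t) - chartLeft VG G y (D t)‖
          ≤ ‖chartLeft VG G x - chartLeft VG G y‖ * ‖D t‖ :=
            (chartLeft VG G x - chartLeft VG G y).le_opNorm (D t)
        _ ≤ (C * ‖x - y‖) * K := by
            gcongr
            · exact this hx hy
            · exact hK t ht
        _ = _ := by ring
    · intro x _
      exact ((chartLeft VG G x).continuous.comp hD).continuousOn
    · intro t ht x hx
      change ‖chartLeft VG G x (D t)‖ ≤ 2 * K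
      have h3 := hL2 x hx (D t)
      have h4 := norm_le_norm_add_norm_sub' (chartLeft VG G x (D t)) (D t)
      have h5 := hK t ht
      have h6 : min ε 1 * ‖D t‖ ≤ 1 * ‖D t‖ := by gcongr; exact min_le_right _ _
      linarith
    · change 2 * K * max (b - a) (a - a) ≤ r - 0
      rw [sub_self, max_eq_left (by linarith)]
      linarith
  obtain ⟨α, hαc, hα0, hmem, hαd⟩ := exists_solution_mem_closedBall hPL
  replace hα0 : α a = φ 1 := hα0
  replace hmem : ∀ t, α t ∈ Metric.closedBall (φ 1) r := hmem
  refine ⟨fun t => φ.symm (α t), by simp [hα0, hφ], ?_, ?_, ?_⟩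
  · exact (continuousOn_extChartAt_symm (1 : G)).comp hαc.continuousOn
      fun t _ => (hball (hmem _)).1
  · intro t ht
    exact hasLogDeriv_of_chart (hball (hmem _)).1
      ((hαd t (Ioo_subset_Icc_self ht)).hasDerivAt (Icc_mem_nhds ht.1 ht.2))
  · intro t ht
    refine ⟨φ.map_target (hball (hmem _)).1, ?_⟩
    rw [φ.right_inv (hball (hmem _)).1]
    have h3 : ∀ u ∈ Icc a b, HasDerivWithinAt (fun u => α u - ∫ τ in a..u, D τ)
        (chartLeft VG G (α u) (D u) - D u) (Icc a b) u := fun u hu =>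
      (hαd u hu).sub (intervalIntegral.integral_hasDerivAt_right
        (hD.intervalIntegrable _ _) (hD.stronglyMeasurableAtFilter _ _)
        hD.continuousAt).hasDerivWithinAt
    -- Mean value inequality for the error `α - ∫ D`, whose velocity is `(chartLeft (α u) - id) (D
    -- u)`.
    have h4 := (convex_Icc a b).norm_image_sub_le_of_norm_hasDerivWithin_le (C := ε * K) h3
      (fun u hu => (hL2 _ (hmem _) (D u)).trans (by
        gcongr
        · exact min_le_left _ _
        · exact hK u hu)) ⟨le_rfl, hab⟩ ht
    simp only [hα0, intervalIntegral.integral_same, sub_zero] at h4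
    rw [sub_right_comm]
    refine h4.trans ?_
    gcongr
    rw [Real.norm_eq_abs, abs_of_nonneg (by linarith [ht.1])]
    linarith [ht.2]

/-- The lifetime of a local solution depends only on the bound `K`, because left translation moves
any starting point to the identity. Local solutions on overlapping intervals of fixed length can
therefore be glued. -/
theorem exists_hasLogDeriv_Ioo_of_bounded {A : ℝ → VG} (hA : Continuous A) {K : ℝ} (hK : 0 < K)
    (hAK : ∀ t, ‖A t‖ ≤ K) (a b : ℝ) :
    ∃ f : ℝ → G, ∀ t ∈ Ioo a b, HasLogDeriv f (A t) t := by
  obtain ⟨δ, hδ, hloc⟩ := exists_local_transport (VG := VG) (G := G) 1 one_pos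
  set η := δ / (2 * K) with hη
  have hη0 : 0 < η := by positivity
  have hloc' : ∀ c, ∃ f : ℝ → G, ∀ t ∈ Ioo c (c + 2 * η), HasLogDeriv f (A t) t := by
    intro c
    obtain ⟨f, -, -, hf, -⟩ := hloc A c (c + 2 * η) K hA (by linarith) (fun t _ => hAK t)
      (by rw [hη]; field_simp; ring_nf; rfl)
    exact ⟨f, hf⟩
  have key : ∀ n : ℕ, ∃ f : ℝ → G, ∀ t ∈ Ioo a (a + (n + 1) * η), HasLogDeriv f (A t) t := by
    intro n
    induction n with
    | zero =>
      obtain ⟨f, hf⟩ := hloc' a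
      exact ⟨f, fun t ht => hf t ⟨ht.1, by have := ht.2; push_cast at this; linarith⟩⟩
    | succ n ih =>
      obtain ⟨f, hf⟩ := ih
      obtain ⟨h, hh⟩ := hloc' (a + n * η)
      -- The old and new solutions overlap on an interval of length `η`. They are glued at its
      -- midpoint `p`, after normalising both to the value `1` there.
      set p := a + (n + 1 / 2) * η with hp
      have hp1 : a + n * η < p := by rw [hp]; nlinarith
      have hp2 : p < a + (n + 1) * η := by rw [hp]; nlinarith
      have hn : 0 ≤ n * η := by positivity
      have heq : ∀ τ, a + n * η < τ → τ < p → (f p)⁻¹ * f τ = (h p)⁻¹ * h τ := by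
        intro τ h1 h2
        have hf' : ∀ t ∈ Icc τ p, HasLogDeriv f (A t) t := fun t ht =>
          hf t ⟨by linarith [ht.1], by linarith [ht.2]⟩
        have hh' : ∀ t ∈ Icc τ p, HasLogDeriv h (A t) t := fun t ht =>
          hh t ⟨by linarith [ht.1], by linarith [ht.2]⟩
        have h3 := mul_inv_eq_of_hasLogDeriv h2.le
          (fun t ht => (hf' t ht).continuousAt.continuousWithinAt)
          (fun t ht => (hh' t ht).continuousAt.continuousWithinAt)
          (fun t ht => hf' t (Ioo_subset_Icc_self ht)) (fun t ht => hh' t (Ioo_subset_Icc_self ht))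
        rw [inv_mul_eq_iff_eq_mul, ← mul_assoc, ← h3, inv_mul_cancel_right]
      refine ⟨fun t => if t < p then (f p)⁻¹ * f t else (h p)⁻¹ * h t, fun t ht => ?_⟩
      rcases lt_or_ge t p with htp | htp
      · refine ((hf t ⟨ht.1, by linarith⟩).const_mul (f p)⁻¹).congr ?_
        filter_upwards [gt_mem_nhds htp] with τ hτ
        exact if_pos hτ
      · refine ((hh t ⟨by linarith, by
          have := ht.2; push_cast at this; linarith⟩).const_mul (h p)⁻¹).congr ?_
        filter_upwards [lt_mem_nhds (show a + n * η < t by linarith)] with τ hτ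
        by_cases hτp : τ < p
        · rw [if_pos hτp, heq τ hτ hτp]
        · rw [if_neg hτp]
  obtain ⟨n, hn⟩ := exists_nat_gt ((b - a) / η)
  obtain ⟨f, hf⟩ := key n
  refine ⟨f, fun t ht => hf t ⟨ht.1, ht.2.trans ?_⟩⟩
  rw [div_lt_iff₀ hη0] at hn
  nlinarith

/-- Clamping the argument of `A` to `[a, b]` makes it globally bounded without changing the equation
inside. -/
theorem exists_hasLogDeriv_Ioo {A : ℝ → VG} (hA : Continuous A) {a b : ℝ} (hab : a ≤ b) :
    ∃ f : ℝ → G, ∀ t ∈ Ioo a b, HasLogDeriv f (A t) t := by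
  obtain ⟨K, hK⟩ := isCompact_Icc.exists_bound_of_continuousOn (s := Icc a b) hA.continuousOn
  obtain ⟨f, hf⟩ := exists_hasLogDeriv_Ioo_of_bounded (G := G)
    (A := fun t => A (projIcc a b hab t))
    (hA.comp (continuous_subtype_val.comp continuous_projIcc)) (K := max K 1) (by positivity)
    (fun t => (hK _ (projIcc a b hab t).2).trans (le_max_left _ _)) a b
  refine ⟨f, fun t ht => ?_⟩
  have := hf t ht
  simpa [projIcc_of_mem hab (Ioo_subset_Icc_self ht)] using this

theorem eq_of_hasLogDeriv_Ioo {f h : ℝ → G} {A : ℝ → VG} {a b c d : ℝ}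
    (hf : ∀ t ∈ Ioo a b, HasLogDeriv f (A t) t) (hh : ∀ t ∈ Ioo a b, HasLogDeriv h (A t) t)
    (hc : c ∈ Ioo a b) (hd : d ∈ Ioo a b) (h0 : f c = h c) : f d = h d := by
  rcases le_total c d with hcd | hcd
  · have hs : Icc c d ⊆ Ioo a b := fun t ht => ⟨hc.1.trans_le ht.1, ht.2.trans_lt hd.2⟩
    exact eq_of_hasLogDeriv hcd (fun t ht => (hf t (hs ht)).continuousAt.continuousWithinAt)
      (fun t ht => (hh t (hs ht)).continuousAt.continuousWithinAt)
      (fun t ht => hf t (hs (Ioo_subset_Icc_self ht)))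
      (fun t ht => hh t (hs (Ioo_subset_Icc_self ht))) h0
  · have hs : Icc d c ⊆ Ioo a b := fun t ht => ⟨hd.1.trans_le ht.1, ht.2.trans_lt hc.2⟩
    have h1 := mul_inv_eq_of_hasLogDeriv hcd
      (fun t ht => (hf t (hs ht)).continuousAt.continuousWithinAt)
      (fun t ht => (hh t (hs ht)).continuousAt.continuousWithinAt)
      (fun t ht => hf t (hs (Ioo_subset_Icc_self ht)))
      (fun t ht => hh t (hs (Ioo_subset_Icc_self ht)))
    rw [h0, mul_inv_cancel] at h1
    exact mul_inv_eq_one.1 h1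

/-- Existence for the transport equation. -/
theorem exists_isTransport {A : ℝ → VG} (hA : Continuous A) : ∃ f : ℝ → G, IsTransport A f := by
  have h1 : ∀ n : ℕ, ∃ f : ℝ → G, f 0 = 1 ∧
      ∀ t ∈ Ioo (-(n + 1) : ℝ) (n + 1), HasLogDeriv f (A t) t := by
    intro n
    obtain ⟨f, hf⟩ := exists_hasLogDeriv_Ioo (G := G) hA (a := -(n + 1)) (b := n + 1)
      (by have : (0 : ℝ) ≤ n := n.cast_nonneg; linarith)
    exact ⟨fun t => (f 0)⁻¹ * f t, by simp, fun t ht => (hf t ht).const_mul _⟩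
  choose g hg0 hg using h1
  have hmem : ∀ (n : ℕ) (t : ℝ), |t| < n + 1 → t ∈ Ioo (-(n + 1) : ℝ) (n + 1) :=
    fun n t ht => abs_lt.1 ht
  have hle : ∀ (n m : ℕ) (t : ℝ), n ≤ m → |t| < n + 1 → g n t = g m t := by
    intro n m t hnm ht
    have hnm' : (n : ℝ) ≤ m := Nat.cast_le.2 hnm
    refine eq_of_hasLogDeriv_Ioo (hg n) (fun u hu => hg m u ⟨by linarith [hu.1], by
      linarith [hu.2]⟩) (hmem n 0 ?_) (hmem n t ht) (by rw [hg0, hg0])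
    rw [abs_zero]
    positivity
  have heq : ∀ (n : ℕ) (t : ℝ), |t| < n + 1 → g ⌈|t|⌉₊ t = g n t := by
    intro n t ht
    have h2 : |t| < (⌈|t|⌉₊ : ℝ) + 1 := (Nat.le_ceil _).trans_lt (lt_add_one _)
    rcases le_total n ⌈|t|⌉₊ with h | h
    · exact (hle _ _ t h ht).symm
    · exact hle _ _ t h h2
  -- The solutions on growing intervals agree where both are defined; the index `⌈|t|⌉₊` selects one
  -- whose interval contains `t`.
  refine ⟨fun t => g ⌈|t|⌉₊ t, by simp [hg0], fun t => ?_⟩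
  have h2 : |t| < (⌈|t|⌉₊ : ℝ) + 1 := (Nat.le_ceil _).trans_lt (lt_add_one _)
  refine HasLogDeriv.congr (hg ⌈|t|⌉₊ t (hmem _ t h2)) ?_
  filter_upwards [continuous_abs.continuousAt.eventually_lt continuousAt_const h2] with τ hτ
  exact heq _ τ hτ

theorem IsTransport.hasLogDeriv {A : ℝ → VG} {f : ℝ → G} (h : IsTransport A f) (t : ℝ) :
    HasLogDeriv f (A t) t := h.2 t

theorem IsTransport.continuous {A : ℝ → VG} {f : ℝ → G} (h : IsTransport A f) : Continuous f :=
  continuous_iff_continuousAt.2 fun t => (h.hasLogDeriv t).continuousAt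

theorem IsTransport.unique {A : ℝ → VG} {f h : ℝ → G} (hf : IsTransport A f)
    (hh : IsTransport A h) : f = h := by
  funext t
  have h0 : (0 : ℝ) ∈ Ioo (-(|t| + 1)) (|t| + 1) := by
    constructor <;> linarith [abs_nonneg t]
  have h1 : t ∈ Ioo (-(|t| + 1)) (|t| + 1) := abs_lt.1 (lt_add_one _)
  exact eq_of_hasLogDeriv_Ioo (fun u _ => hf.hasLogDeriv u) (fun u _ => hh.hasLogDeriv u) h0 h1
    (by rw [hf.1, hh.1])

/-- Existence and uniqueness for the transport equation. -/
theorem existsUnique_isTransport {A : ℝ → VG} (hA : Continuous A) :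
    ∃! f : ℝ → G, IsTransport A f := by
  obtain ⟨f, hf⟩ := exists_isTransport (G := G) hA
  exact ⟨f, hf, fun h hh => hh.unique hf⟩

theorem isTransport_transport {A : ℝ → VG} (hA : Continuous A) :
    IsTransport A (transport (G := G) A) :=
  Classical.epsilon_spec (exists_isTransport hA)

theorem transport_zero_time {A : ℝ → VG} (hA : Continuous A) : transport (G := G) A 0 = 1 :=
  (isTransport_transport hA).1

theorem hasLogDeriv_transport {A : ℝ → VG} (hA : Continuous A) (t : ℝ) :
    HasLogDeriv (transport (G := G) A) (A t) t := (isTransport_transport hA).hasLogDeriv t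

theorem continuous_transport {A : ℝ → VG} (hA : Continuous A) :
    Continuous (transport (G := G) A) := (isTransport_transport hA).continuous

theorem IsTransport.eq_transport {A : ℝ → VG} {f : ℝ → G} (hf : IsTransport A f)
    (hA : Continuous A) : f = transport A := hf.unique (isTransport_transport hA)

theorem eq_transport_of_hasLogDeriv {A : ℝ → VG} (hA : Continuous A) {f : ℝ → G} {b : ℝ}
    (hb : 0 ≤ b) (hf : ContinuousOn f (Icc 0 b)) (hf' : ∀ t ∈ Ioo 0 b, HasLogDeriv f (A t) t)
    (h0 : f 0 = 1) : f b = transport A b :=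
  eq_of_hasLogDeriv hb hf (continuous_transport hA).continuousOn hf'
    (fun t _ => hasLogDeriv_transport hA t) (by rw [h0, transport_zero_time hA])

theorem transport_congr {A A' : ℝ → VG} (hA : Continuous A) (hA' : Continuous A') {b : ℝ}
    (hb : 0 ≤ b) (h : ∀ t ∈ Ioo 0 b, A t = A' t) :
    transport (G := G) A b = transport A' b :=
  eq_transport_of_hasLogDeriv hA' hb (continuous_transport hA).continuousOn
    (fun t ht => by rw [← h t ht]; exact hasLogDeriv_transport hA t) (transport_zero_time hA)

theorem transport_map {A : ℝ → VG} (hA : Continuous A) {h : G →* H}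
    (hh : ContMDiff 𝓘(ℝ, VG) 𝓘(ℝ, VH) ∞ h) (t : ℝ) :
    transport (fun τ => diff VG VH h 1 (A τ)) t = h (transport A t) := by
  have h1 : IsTransport (fun τ => diff VG VH h 1 (A τ)) (fun τ => h (transport A τ)) :=
    ⟨by simp only [transport_zero_time hA, map_one], fun τ => (hasLogDeriv_transport hA τ).map hh⟩
  exact (congrFun (h1.eq_transport ((diff VG VH h 1).continuous.comp hA)) t).symm

theorem transport_zero (t : ℝ) : transport (G := G) (fun _ => (0 : VG)) t = 1 := by
  have h1 : IsTransport (fun _ => (0 : VG)) (fun _ => (1 : G)) :=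
    ⟨rfl, fun τ => hasLogDeriv_const 1 τ⟩
  exact (congrFun (h1.eq_transport continuous_const) t).symm

/-- Rescaling time turns the end time into a parameter of the equation, so that parameter dependence
need only be studied at time `1`. -/
theorem transport_comp_mul {A : ℝ → VG} (hA : Continuous A) (c t : ℝ) :
    transport (G := G) (fun τ => c • A (c * τ)) t = transport A (c * t) := by
  have h1 : IsTransport (fun τ => c • A (c * τ)) (fun τ => transport (G := G) A (c * τ)) :=
    ⟨by simp only [mul_zero, transport_zero_time hA], fun τ =>
      (hasLogDeriv_transport hA (c * τ)).comp (by simpa using (hasDerivAt_id τ).const_mul c)⟩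
  exact (congrFun (h1.eq_transport (by fun_prop)) t).symm

/-- A gauge transformation: dividing by a reference solution replaces `A` by the conjugated
difference, which is small when `A` is near `A₀` and so falls within the chart estimate. -/
theorem transport_mul_inv {A A₀ : ℝ → VG} (hA : Continuous A) (hA₀ : Continuous A₀)
    (t : ℝ) : transport (G := G) A t * (transport (G := G) A₀ t)⁻¹ =
      transport (fun τ => Ad VG (transport (G := G) A₀ τ) (A τ - A₀ τ)) t := by
  have h1 : IsTransport (fun τ => Ad VG (transport (G := G) A₀ τ) (A τ - A₀ τ))
      (fun τ => transport (G := G) A τ * (transport (G := G) A₀ τ)⁻¹) := by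
    refine ⟨by simp only [transport_zero_time hA, transport_zero_time hA₀, inv_one, one_mul],
      fun τ => ?_⟩
    have h2 := (hasLogDeriv_transport (G := G) hA τ).mul (hasLogDeriv_transport hA₀ τ).inv
    rwa [inv_inv, ← sub_eq_add_neg, ← map_sub] at h2
  exact congrFun (h1.eq_transport (((contMDiff_Ad (VG := VG)).continuous.comp
    (continuous_transport hA₀)).clm_apply (hA.sub hA₀))) t

/-- Transport along a concatenation. -/
theorem transport_concat {A A₁ A₂ : ℝ → VG} (hA : Continuous A) (hA₁ : Continuous A₁)
    (hA₂ : Continuous A₂) (h₁ : ∀ t ∈ Ioo (0 : ℝ) (1 / 2), A t = (2 : ℝ) • A₁ (2 * t))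
    (h₂ : ∀ t ∈ Ioo (1 / 2 : ℝ) 1, A t = (2 : ℝ) • A₂ (2 * t - 1)) :
    (∀ t ∈ Icc (0 : ℝ) (1 / 2), transport (G := G) A t = transport A₁ (2 * t)) ∧
    (∀ t ∈ Icc (1 / 2 : ℝ) 1,
      transport (G := G) A t = transport A₁ 1 * transport A₂ (2 * t - 1)) := by
  have hfirst : ∀ t ∈ Icc (0 : ℝ) (1 / 2), transport (G := G) A t = transport A₁ (2 * t) := by
    intro t ht
    rw [← transport_comp_mul hA₁]
    exact transport_congr hA (by fun_prop) ht.1 fun τ hτ => h₁ τ ⟨hτ.1, hτ.2.trans_le ht.2⟩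
  have : IsTopologicalGroup G := topologicalGroup_of_lieGroup 𝓘(ℝ, VG) ∞
  refine ⟨hfirst, fun t ht => ?_⟩
  refine eq_of_hasLogDeriv (A := A) (h := fun t => transport A₁ 1 * transport A₂ (2 * t - 1)) ht.1
    (continuous_transport hA).continuousOn ?_ (fun τ _ => hasLogDeriv_transport hA τ) ?_ ?_
  · exact (continuous_const.mul ((continuous_transport hA₂).comp (by fun_prop))).continuousOn
  · intro τ hτ
    rw [h₂ τ ⟨hτ.1, hτ.2.trans_le ht.2⟩]
    refine HasLogDeriv.const_mul ?_ _
    have hu : HasDerivAt (fun τ : ℝ => 2 * τ - 1) 2 τ := by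
      simpa using ((hasDerivAt_id' τ).const_mul (2 : ℝ)).sub_const (1 : ℝ)
    exact HasLogDeriv.comp (u := fun τ : ℝ => 2 * τ - 1) (hasLogDeriv_transport hA₂ _) hu
  · rw [hfirst _ (by norm_num)]
    norm_num
    rw [transport_zero_time hA₂]

end Transport

/-! ### Continuous and differentiable dependence of transports on parameters. -/

section Parameters

/-- Differentiation under the integral sign. -/
theorem hasDerivAt_integral_of_continuous {W : Type*} [NormedAddCommGroup W] [NormedSpace ℝ W]
    [CompleteSpace W]
    {F F' : ℝ → ℝ → W} (hF : Continuous fun p : ℝ × ℝ => F p.1 p.2)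
    (hF' : Continuous fun p : ℝ × ℝ => F' p.1 p.2)
    (h : ∀ s t, HasDerivAt (fun σ => F σ t) (F' s t) s) (a b s : ℝ) :
    HasDerivAt (fun σ => ∫ t in a..b, F σ t) (∫ t in a..b, F' s t) s := by
  obtain ⟨C, hC⟩ := ((isCompact_closedBall s (1 : ℝ)).prod
    (isCompact_uIcc (a := a) (b := b))).exists_bound_of_continuousOn hF'.continuousOn
  have hFc : ∀ σ, Continuous (F σ) := fun σ => hF.comp (by fun_prop : Continuous fun t => (σ, t))
  have hFc' : ∀ σ, Continuous (F' σ) := fun σ =>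
    hF'.comp (by fun_prop : Continuous fun t => (σ, t))
  refine (intervalIntegral.hasDerivAt_integral_of_dominated_loc_of_deriv_le
    (bound := fun _ => C) (Metric.ball_mem_nhds s one_pos)
    (Filter.Eventually.of_forall fun σ => (hFc σ).aestronglyMeasurable)
    ((hFc s).intervalIntegrable _ _) (hFc' s).aestronglyMeasurable
    (Filter.Eventually.of_forall fun t ht σ hσ => hC (σ, t)
      ⟨Metric.ball_subset_closedBall hσ, uIoc_subset_uIcc ht⟩)
    intervalIntegrable_const (Filter.Eventually.of_forall fun t _ σ _ => h σ t)).2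

variable {VG : Type*} [NormedAddCommGroup VG] [NormedSpace ℝ VG] [FiniteDimensional ℝ VG]
variable {G : Type*} [TopologicalSpace G] [ChartedSpace VG G] [Group G]
variable [LieGroup 𝓘(ℝ, VG) ∞ G]

theorem transport_estimate (ε : ℝ) (hε : 0 < ε) : ∃ δ > 0, ∀ (D : ℝ → VG) (K : ℝ),
    Continuous D → (∀ t ∈ Icc (0 : ℝ) 1, ‖D t‖ ≤ K) → K ≤ δ →
      transport (G := G) D 1 ∈ (extChartAt 𝓘(ℝ, VG) (1 : G)).source ∧
        ‖extChartAt 𝓘(ℝ, VG) (1 : G) (transport D 1) - extChartAt 𝓘(ℝ, VG) (1 : G) 1 -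
          ∫ τ in (0 : ℝ)..1, D τ‖ ≤ ε * K := by
  obtain ⟨δ, hδ, h⟩ := exists_local_transport (VG := VG) (G := G) ε hε
  refine ⟨δ, hδ, fun D K hD hK hKδ => ?_⟩
  obtain ⟨f, hf0, hfc, hfd, hf⟩ := h D 0 1 K hD zero_le_one hK (by simpa using hKδ)
  have h1 := hf 1 ⟨zero_le_one, le_rfl⟩
  rw [eq_transport_of_hasLogDeriv hD zero_le_one hfc hfd hf0] at h1
  simpa using h1

theorem continuous_slice {X Y Z : Type*} [TopologicalSpace X] [TopologicalSpace Y]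
    [TopologicalSpace Z] {A : X → Y → Z} (hA : Continuous fun p : X × Y => A p.1 p.2) (x : X) :
    Continuous (A x) := hA.comp (by fun_prop : Continuous fun t => (x, t))

/-- Locally uniform smallness. -/
theorem eventually_norm_le_of_continuous {X : Type*} [TopologicalSpace X]
    {W : Type*} [NormedAddCommGroup W] {D : X → ℝ → W}
    (hD : Continuous fun p : X × ℝ => D p.1 p.2) {x : X} (h0 : ∀ t, D x t = 0) {δ : ℝ} (hδ : 0 < δ) :
    ∀ᶠ y in 𝓝 x, ∀ t ∈ Icc (0 : ℝ) 1, ‖D y t‖ ≤ δ := by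
  refine isCompact_Icc.eventually_forall_of_forall_eventually fun t _ => ?_
  have h1 : Tendsto (fun p : X × ℝ => ‖D p.1 p.2‖) (𝓝 (x, t)) (𝓝 0) := by
    have := hD.norm.tendsto (x, t)
    simpa [h0] using this
  exact (h1.eventually (gt_mem_nhds hδ)).mono fun p hp => hp.le

/-- After division by the transport at `x`, the coefficient is uniformly small near `x`, and the
chart estimate keeps its transport near `1`. -/
theorem continuous_transport_one {X : Type*} [TopologicalSpace X] {A : X → ℝ → VG}
    (hA : Continuous fun p : X × ℝ => A p.1 p.2) :
    Continuous fun x => transport (G := G) (A x) 1 := by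
  have : IsTopologicalGroup G := topologicalGroup_of_lieGroup 𝓘(ℝ, VG) ∞
  rw [continuous_iff_continuousAt]
  intro x
  have hAx := continuous_slice hA
  set g := transport (G := G) (A x) with hg
  have hgc : Continuous g := continuous_transport (hAx x)
  set D : X → ℝ → VG := fun y t => Ad VG (g t) (A y t - A x t) with hD
  have hDc : Continuous fun p : X × ℝ => D p.1 p.2 :=
    ((contMDiff_Ad (VG := VG)).continuous.comp (hgc.comp continuous_snd)).clm_apply
      (hA.sub ((hAx x).comp continuous_snd))
  have hk : ∀ y, transport (G := G) (A y) 1 = transport (D y) 1 * g 1 := by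
    intro y
    rw [hD, ← transport_mul_inv (hAx y) (hAx x), inv_mul_cancel_right]
  simp only [hk]
  refine ContinuousAt.mul ?_ continuousAt_const
  have hDx : ∀ t, D x t = 0 := by simp [hD]
  have hDx1 : transport (G := G) (D x) 1 = 1 := by
    have : D x = fun _ => 0 := funext hDx
    rw [this, transport_zero]
  obtain ⟨δ, hδ, hest⟩ := transport_estimate (VG := VG) (G := G) 1 one_pos
  set φ := extChartAt 𝓘(ℝ, VG) (1 : G) with hφ
  have hφc : Tendsto (fun y => φ (transport (D y) 1)) (𝓝 x) (𝓝 (φ 1)) := by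
    rw [Metric.tendsto_nhds]
    intro ε hε
    filter_upwards [eventually_norm_le_of_continuous hDc hDx
      (show 0 < min δ (ε / 4) by positivity)] with y hy
    have h1 := (hest (D y) _ (continuous_slice hDc y) hy (min_le_left _ _)).2
    have h2 : ‖∫ τ in (0 : ℝ)..1, D y τ‖ ≤ min δ (ε / 4) * |1 - 0| :=
      intervalIntegral.norm_integral_le_of_norm_le_const fun t ht => by
        rw [uIoc_of_le zero_le_one] at ht
        exact hy t ⟨ht.1.le, ht.2⟩
    have h3 := norm_le_norm_add_norm_sub' (φ (transport (D y) 1) - φ 1) (∫ τ in (0 : ℝ)..1, D y τ)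
    have h4 := min_le_right δ (ε / 4)
    simp only [sub_zero, abs_one] at h2
    rw [dist_eq_norm]
    linarith
  have hsrc : ∀ᶠ y in 𝓝 x, transport (D y) 1 ∈ φ.source := by
    filter_upwards [eventually_norm_le_of_continuous hDc hDx hδ] with y hy
    exact (hest (D y) _ (continuous_slice hDc y) hy le_rfl).1
  have h5 := (continuousAt_extChartAt_symm (I := 𝓘(ℝ, VG)) (1 : G)).tendsto.comp hφc
  rw [extChartAt_to_inv] at h5
  rw [ContinuousAt, hDx1]
  refine h5.congr' ?_
  filter_upwards [hsrc] with y hy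
  exact φ.left_inv hy

/-- Joint continuity of transports. -/
theorem continuous_transport_param {X : Type*} [TopologicalSpace X] {A : X → ℝ → VG}
    (hA : Continuous fun p : X × ℝ => A p.1 p.2) :
    Continuous fun p : X × ℝ => transport (G := G) (A p.1) p.2 := by
  have h1 : ∀ p : X × ℝ, transport (G := G) (A p.1) p.2 =
      transport (fun τ => p.2 • A p.1 (p.2 * τ)) 1 := fun p => by
    rw [transport_comp_mul (continuous_slice hA p.1), mul_one]
  simp only [h1]
  refine continuous_transport_one (A := fun (p : X × ℝ) τ => p.2 • A p.1 (p.2 * τ)) ?_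
  exact (by fun_prop : Continuous fun q : (X × ℝ) × ℝ => q.1.2).smul
    (hA.comp (by fun_prop : Continuous fun q : (X × ℝ) × ℝ => (q.1.1, q.1.2 * q.2)))

/-- The quotient by the transport at `s` has coefficient `D σ = O(σ - s)`, so in the chart it is `∫
D σ` up to `o(σ - s)`. Multiplying back by `g 1` on the right introduces the outer `Ad` of its
inverse. -/
theorem hasLogDeriv_transport_one {A A' : ℝ → ℝ → VG}
    (hA : Continuous fun p : ℝ × ℝ => A p.1 p.2) (hA' : Continuous fun p : ℝ × ℝ => A' p.1 p.2)
    (h : ∀ s t, HasDerivAt (fun σ => A σ t) (A' s t) s) (s : ℝ) :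
    HasLogDeriv (fun σ => transport (G := G) (A σ) 1)
      (Ad VG (transport (G := G) (A s) 1)⁻¹
        (∫ t in (0 : ℝ)..1, Ad VG (transport (G := G) (A s) t) (A' s t))) s := by
  have hAs := continuous_slice hA
  set g := transport (G := G) (A s) with hg
  have hgc : Continuous g := continuous_transport (hAs s)
  have hAdg : Continuous fun t => Ad VG (g t) := (contMDiff_Ad (VG := VG)).continuous.comp hgc
  set D : ℝ → ℝ → VG := fun σ t => Ad VG (g t) (A σ t - A s t) with hD
  set D' : ℝ → ℝ → VG := fun σ t => Ad VG (g t) (A' σ t) with hD'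
  have hDc : Continuous fun p : ℝ × ℝ => D p.1 p.2 :=
    (hAdg.comp continuous_snd).clm_apply (hA.sub ((hAs s).comp continuous_snd))
  have hDc' : Continuous fun p : ℝ × ℝ => D' p.1 p.2 :=
    (hAdg.comp continuous_snd).clm_apply hA'
  have hDd : ∀ σ t, HasDerivAt (fun σ => D σ t) (D' σ t) σ := fun σ t =>
    (Ad VG (g t)).hasFDerivAt.comp_hasDerivAt σ ((h σ t).sub_const (A s t))
  have hk : ∀ σ, transport (G := G) (A σ) 1 = transport (D σ) 1 * g 1 := by
    intro σ
    rw [hD, ← transport_mul_inv (hAs σ) (hAs s), inv_mul_cancel_right]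
  have hDs : ∀ t, D s t = 0 := by simp [hD]
  have hDs1 : transport (G := G) (D s) 1 = 1 := by
    have : D s = fun _ => 0 := funext hDs
    rw [this, transport_zero]
  have hint := hasDerivAt_integral_of_continuous hDc hDc' hDd 0 1 s
  obtain ⟨C, hC⟩ := ((isCompact_closedBall s (1 : ℝ)).prod
    (isCompact_Icc (a := (0 : ℝ)) (b := 1))).exists_bound_of_continuousOn hDc'.continuousOn
  have hlip : ∀ σ ∈ Metric.closedBall s 1, ∀ t ∈ Icc (0 : ℝ) 1,
      ‖D σ t‖ ≤ (max C 1) * ‖σ - s‖ := by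
    intro σ hσ t ht
    have := (convex_closedBall s 1).norm_image_sub_le_of_norm_hasDerivWithin_le
      (f := fun σ => D σ t) (C := max C 1)
      (fun σ _ => (hDd σ t).hasDerivWithinAt)
      (fun σ hσ => (hC (σ, t) ⟨hσ, ht⟩).trans (le_max_left _ _))
      (Metric.mem_closedBall_self zero_le_one) hσ
    simpa [hDs] using this
  set φ := extChartAt 𝓘(ℝ, VG) (1 : G) with hφ
  have hest : ∀ ε > 0, ∀ᶠ σ in 𝓝 s, transport (D σ) 1 ∈ φ.source ∧
      ‖φ (transport (D σ) 1) - φ 1 - ∫ τ in (0 : ℝ)..1, D σ τ‖ ≤ ε * ‖σ - s‖ := by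
    intro ε hε
    have hC1 : 0 < max C 1 := by positivity
    -- The divisor cancels the Lipschitz constant in `hlip`.
    obtain ⟨δ, hδ, hest⟩ := transport_estimate (VG := VG) (G := G) (ε / max C 1) (by positivity)
    have h1 : ∀ᶠ σ in 𝓝 s, max C 1 * ‖σ - s‖ < δ := by
      have : Tendsto (fun σ => max C 1 * ‖σ - s‖) (𝓝 s) (𝓝 0) := by
        have : Continuous fun σ : ℝ => max C 1 * ‖σ - s‖ := by fun_prop
        simpa using this.tendsto s
      exact this.eventually (gt_mem_nhds hδ)
    filter_upwards [h1, Metric.closedBall_mem_nhds s one_pos] with σ h2 h3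
    have h4 := hest (D σ) _ (continuous_slice hDc σ) (hlip σ h3) h2.le
    refine ⟨h4.1, h4.2.trans (le_of_eq ?_)⟩
    field_simp
  have hφd : HasDerivAt (fun σ => φ (transport (D σ) 1)) (∫ t in (0 : ℝ)..1, D' s t) s := by
    have h1 : HasDerivAt (fun σ => φ (transport (D σ) 1) - ∫ τ in (0 : ℝ)..1, D σ τ) 0 s := by
      rw [hasDerivAt_iff_isLittleO, Asymptotics.isLittleO_iff]
      intro ε hε
      filter_upwards [hest ε hε] with σ hσ
      simp only [hDs1, hDs, intervalIntegral.integral_zero, sub_zero, smul_zero]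
      rw [sub_right_comm]
      exact hσ.2
    have h2 := h1.fun_add hint
    simpa using h2
  have h1 : HasLogDeriv (fun σ => transport (G := G) (D σ) 1) (∫ t in (0 : ℝ)..1, D' s t) s :=
    hasLogDeriv_of_eq_one hDs1 ((hest 1 one_pos).mono fun σ hσ => hσ.1) hφd
  have h2 := h1.mul (hasLogDeriv_const (VG := VG) (g 1) s)
  simp only [← hk, add_zero] at h2
  exact h2

/-- The derivative of a transport with respect to a parameter. -/
theorem hasLogDeriv_transport_param {A A' : ℝ → ℝ → VG}
    (hA : Continuous fun p : ℝ × ℝ => A p.1 p.2) (hA' : Continuous fun p : ℝ × ℝ => A' p.1 p.2)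
    (h : ∀ s t, HasDerivAt (fun σ => A σ t) (A' s t) s) (s t : ℝ) :
    HasLogDeriv (fun σ => transport (G := G) (A σ) t)
      (Ad VG (transport (G := G) (A s) t)⁻¹
        (∫ τ in (0 : ℝ)..t, Ad VG (transport (G := G) (A s) τ) (A' s τ))) s := by
  have hAs := continuous_slice hA
  have h1 := hasLogDeriv_transport_one (G := G) (A := fun σ τ => t • A σ (t * τ))
    (A' := fun σ τ => t • A' σ (t * τ))
    ((hA.comp (by fun_prop : Continuous fun p : ℝ × ℝ => (p.1, t * p.2))).const_smul t)
    ((hA'.comp (by fun_prop : Continuous fun p : ℝ × ℝ => (p.1, t * p.2))).const_smul t)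
    (fun σ τ => (h σ (t * τ)).const_smul t) s
  simp only [transport_comp_mul (hAs _), mul_one, map_smul] at h1
  rw [intervalIntegral.integral_smul, intervalIntegral.smul_integral_comp_mul_left
    (fun τ => Ad VG (transport (G := G) (A s) τ) (A' s τ))] at h1
  simpa using h1

end Parameters

/-! ### Pullbacks of forms to vector spaces and their exterior derivatives. -/

section Pullback

variable {V : Type*} [NormedAddCommGroup V] [NormedSpace ℝ V]
variable {M : Type*} [TopologicalSpace M] [ChartedSpace V M]
variable {F : Type*} [NormedAddCommGroup F] [NormedSpace ℝ F]
variable {W : Type*} [NormedAddCommGroup W] [NormedSpace ℝ W] {k : ℕ}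

/-- The value of a form, as an alternating map on the model space. -/
def Form.val (α : Form V M F k) (x : M) : V [⋀^Fin k]→L[ℝ] F := α.toFun x

/-- The pullback of a form under a map out of a vector space. -/
def Form.pull (α : Form V M F k) (f : W → M) (p : W) : W [⋀^Fin k]→L[ℝ] F :=
  (α.val (f p)).compContinuousLinearMap (diff W V f p)

theorem Form.pull_apply (α : Form V M F k) (f : W → M) (p : W) (v : Fin k → W) :
    α.pull f p v = α.val (f p) (fun i => diff W V f p (v i)) := rfl

theorem localRep_eq (α : Form V M F k) (c : M) (y : V) :
    localRep α.toFun c y = (α.val ((extChartAt 𝓘(ℝ, V) c).symm y)).compContinuousLinearMap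
      (diff V V (extChartAt 𝓘(ℝ, V) c).symm y) := rfl

variable [IsManifold 𝓘(ℝ, V) ∞ M]

theorem contDiffAt_chart_comp {f : W → M} (hf : ContMDiff 𝓘(ℝ, W) 𝓘(ℝ, V) ∞ f) (p : W) :
    ContDiffAt ℝ ∞ (fun q => extChartAt 𝓘(ℝ, V) (f p) (f q)) p :=
  ((contMDiffAt_extChartAt (x := f p)).comp p (hf p)).contDiffAt

theorem Form.contDiffAt_localRep (α : Form V M F k) (c : M) :
    ContDiffAt ℝ ∞ (localRep α.toFun c) (extChartAt 𝓘(ℝ, V) c c) :=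
  (α.smooth c).contDiffAt (extChartAt_target_mem_nhds c)

/-- Near `p` the pullback factors through the chart at `f p`, which reduces smoothness and the
behaviour of `d` to calculus in vector spaces. -/
theorem Form.pull_eventuallyEq (α : Form V M F k) {f : W → M}
    (hf : ContMDiff 𝓘(ℝ, W) 𝓘(ℝ, V) ∞ f) (p : W) :
    α.pull f =ᶠ[𝓝 p] fun q => (localRep α.toFun (f p)
      (extChartAt 𝓘(ℝ, V) (f p) (f q))).compContinuousLinearMap
        (fderiv ℝ (fun q => extChartAt 𝓘(ℝ, V) (f p) (f q)) q) := by
  have h : ∀ᶠ q in 𝓝 p, f q ∈ (extChartAt 𝓘(ℝ, V) (f p)).source :=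
    hf.continuous.continuousAt.eventually_mem (extChartAt_source_mem_nhds (f p))
  filter_upwards [h] with q hq
  have hu : HasDiff (fun q => extChartAt 𝓘(ℝ, V) (f p) (f q)) q
      ((diff V V (extChartAt 𝓘(ℝ, V) (f p)) (f q)).comp (diff W V f q)) :=
    (hasDiff_extChartAt (by simpa using hq)).comp (hf.hasDiff q)
  have hc := diff_symm_comp_diff_extChartAt (VG := V) (c := f p)
    (y := extChartAt 𝓘(ℝ, V) (f p) (f q)) ((extChartAt 𝓘(ℝ, V) (f p)).map_source hq)
  rw [(extChartAt 𝓘(ℝ, V) (f p)).left_inv hq] at hc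
  rw [localRep_eq, (extChartAt 𝓘(ℝ, V) (f p)).left_inv hq,
    (hasDiff_iff_hasFDerivAt.1 hu).fderiv]
  ext v
  simp only [Form.pull, ContinuousAlternatingMap.compContinuousLinearMap_apply]
  congr 1
  ext i
  exact (DFunLike.congr_fun hc (diff W V f q (v i))).symm

/-- Evaluation of a multilinear map is polynomial jointly in the map and in its arguments. -/
theorem contDiffAt_compContinuousLinearMap_apply {X : Type*} [NormedAddCommGroup X]
    [NormedSpace ℝ X] {n : WithTop ℕ∞} {β : X → V [⋀^Fin k]→L[ℝ] F} {L : X → W →L[ℝ] V} {p : X}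
    (hβ : ContDiffAt ℝ n β p) (hL : ContDiffAt ℝ n L p) (v : Fin k → W) :
    ContDiffAt ℝ n (fun q => (β q).compContinuousLinearMap (L q) v) p := by
  have h1 : ContDiffAt ℝ n (fun q =>
      ContinuousAlternatingMap.toContinuousMultilinearMapCLM ℝ (β q)) p :=
    (ContinuousLinearMap.contDiff _).contDiffAt.comp p hβ
  have h2 : ContDiffAt ℝ n (fun q (i : Fin k) => L q (v i)) p :=
    contDiffAt_pi.2 fun i => hL.clm_apply contDiffAt_const
  have h3 : ContDiff ℝ n
      (fun q : (ContinuousMultilinearMap ℝ (fun _ : Fin k => V) F) × (Fin k → V) => q.1 q.2) :=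
    contDiff_iff_contDiffAt.2 fun q => ((ContinuousLinearMap.id ℝ
      (ContinuousMultilinearMap ℝ (fun _ : Fin k => V) F)).cpolynomialAt_uncurry_of_multilinear).contDiffAt
  exact h3.contDiffAt.comp p (h1.prodMk h2)

theorem Form.contDiff_pull (α : Form V M F k) {f : W → M}
    (hf : ContMDiff 𝓘(ℝ, W) 𝓘(ℝ, V) ∞ f) (v : Fin k → W) :
    ContDiff ℝ ∞ (fun p => α.pull f p v) := by
  refine contDiff_iff_contDiffAt.2 fun p => ?_
  have hu := contDiffAt_chart_comp hf p
  refine (contDiffAt_compContinuousLinearMap_apply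
    (ContDiffAt.comp p (α.contDiffAt_localRep (f p)) hu)
    (hu.fderiv_right (m := ∞) le_rfl) v).congr_of_eventuallyEq ?_
  filter_upwards [α.pull_eventuallyEq hf p] with q hq
  rw [hq]
  rfl

theorem Form.d_pull (α : Form V M F k) {f : W → M}
    (hf : ContMDiff 𝓘(ℝ, W) 𝓘(ℝ, V) ∞ f) (p : W) (v : Fin (k + 1) → W) :
    α.d (f p) (fun i => diff W V f p (v i)) =
      ∑ i, (-1) ^ i.val • fderiv ℝ (fun q => α.pull f q (i.removeNth v)) p (v i) := by
  have hu := contDiffAt_chart_comp hf p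
  have hα := (α.contDiffAt_localRep (f p)).differentiableAt (by simp)
  have hd := (hu.fderiv_right (m := ∞) le_rfl).differentiableAt (by simp)
  have he := α.pull_eventuallyEq hf p
  have hp : DifferentiableAt ℝ (α.pull f) p :=
    (DifferentiableAt.continuousAlternatingMapCompContinuousLinearMap
      (hα.comp p (hu.differentiableAt (by simp))) hd).congr_of_eventuallyEq he
  rw [← extDeriv_apply hp, he.extDeriv_eq, extDeriv_pullback (r := ∞)
    (f := fun q => extChartAt 𝓘(ℝ, V) (f p) (f q)) hα hu (by
    simp only [minSmoothness_of_isRCLikeNormedField]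
    exact WithTop.coe_le_coe.2 (le_top : (2 : ℕ∞) ≤ ⊤))]
  have hu' : HasDiff (fun q => extChartAt 𝓘(ℝ, V) (f p) (f q)) p
      ((diff V V (extChartAt 𝓘(ℝ, V) (f p)) (f p)).comp (diff W V f p)) :=
    (hasDiff_extChartAt (by simp)).comp (hf.hasDiff p)
  rw [(hasDiff_iff_hasFDerivAt.1 hu').fderiv]
  rfl

end Pullback

/-! ### Nonabelian Stokes theorem and variation of the flux. -/

section Flat

variable {VG : Type*} [NormedAddCommGroup VG] [NormedSpace ℝ VG] [FiniteDimensional ℝ VG]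
variable {G : Type*} [TopologicalSpace G] [ChartedSpace VG G] [Group G]
variable [LieGroup 𝓘(ℝ, VG) ∞ G]
variable {VE : Type*} [NormedAddCommGroup VE] [NormedSpace ℝ VE] [FiniteDimensional ℝ VE]
variable {E : Type*} [TopologicalSpace E] [ChartedSpace VE E] [Group E]
variable [LieGroup 𝓘(ℝ, VE) ∞ E]

theorem LiePreCrossedModule.continuous_dact_transport (P : LiePreCrossedModule VG G VE E)
    {X : Type*} [TopologicalSpace X] {A : X → ℝ → VG}
    (hA : Continuous fun p : X × ℝ => A p.1 p.2) :
    Continuous fun p : X × ℝ => P.dact (transport (A p.1) p.2) :=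
  P.contMDiff_dact.continuous.comp (continuous_transport_param hA)

theorem continuous_Ad_transport_apply {A B : ℝ → VG} (hA : Continuous A) (hB : Continuous B) :
    Continuous fun t => Ad VG (transport (G := G) A t) (B t) :=
  (((contMDiff_Ad (VG := VG)).continuous).comp (continuous_transport hA)).clm_apply hB

/-- Integration by parts against the adjoint action of a transport. -/
theorem integral_Ad_transport {A C C' A' Z : ℝ → VG} (hA : Continuous A)
    (hA' : Continuous A') (hZ : Continuous Z)
    (hC : ∀ t, HasDerivAt C (C' t) t) (h : ∀ t, Z t = C' t - A' t + ad VG G (A t) (C t)) (b : ℝ) :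
    ∫ t in (0 : ℝ)..b, Ad VG (transport (G := G) A t) (A' t) =
      Ad VG (transport (G := G) A b) (C b) - C 0 -
        ∫ t in (0 : ℝ)..b, Ad VG (transport (G := G) A t) (Z t) := by
  have hCc : Continuous C := continuous_iff_continuousAt.2 fun t => (hC t).continuousAt
  have i1 := (continuous_Ad_transport_apply (G := G) hA hA').intervalIntegrable
    (μ := volume) 0 b
  have i2 := (continuous_Ad_transport_apply (G := G) hA hZ).intervalIntegrable
    (μ := volume) 0 b
  rw [eq_sub_iff_add_eq, ← intervalIntegral.integral_add i1 i2]
  -- The derivative of `Ad(g) C` is `Ad(g) (C' + [A, C])`, and `h` rewrites the bracketed sum as `A'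
  -- + Z`.
  have hd : ∀ t ∈ uIcc 0 b, HasDerivAt (fun t => Ad VG (transport (G := G) A t) (C t))
      (Ad VG (transport (G := G) A t) (A' t) + Ad VG (transport (G := G) A t) (Z t)) t := by
    intro t _
    have h1 := (hasDerivAt_Ad (hasLogDeriv_transport (G := G) hA t)).clm_apply (hC t)
    convert h1 using 1
    rw [h, ← map_add, ContinuousLinearMap.comp_apply, ← map_add]
    congr 1
    abel
  rw [intervalIntegral.integral_eq_sub_of_hasDerivAt hd (i1.add i2), transport_zero_time hA, Ad_one]
  rfl

variable (P : LiePreCrossedModule VG G VE E)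

/-- The data induced on the plane, with coordinates `s` and `t`, by a connection with components
`C` and `A` whose curvature is the image of a 2-form `m`. -/
structure LiePreCrossedModule.FlatPair (A A' C C' : ℝ → ℝ → VG) (m : ℝ → ℝ → VE) : Prop where
  cont_A : Continuous fun p : ℝ × ℝ => A p.1 p.2
  cont_A' : Continuous fun p : ℝ × ℝ => A' p.1 p.2
  cont_C : Continuous fun p : ℝ × ℝ => C p.1 p.2
  cont_m : Continuous fun p : ℝ × ℝ => m p.1 p.2
  deriv_A : ∀ s t, HasDerivAt (fun σ => A σ t) (A' s t) s
  deriv_C : ∀ s t, HasDerivAt (C s) (C' s t) t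
  curv : ∀ s t, P.dbd (m s t) = C' s t - A' s t + ad VG G (A s t) (C s t)
  zero : ∀ s, C s 0 = 0

/-- The integral of the transported 2-form. -/
def LiePreCrossedModule.flux (A : ℝ → VG) (m : ℝ → VE) (t : ℝ) : VE :=
  ∫ τ in (0 : ℝ)..t, P.dact (transport A τ) (m τ)

variable {P}

namespace LiePreCrossedModule

variable (P) in
theorem continuous_flux_integrand {X : Type*} [TopologicalSpace X] {A : X → ℝ → VG}
    {m : X → ℝ → VE}
    (hA : Continuous fun p : X × ℝ => A p.1 p.2) (hm : Continuous fun p : X × ℝ => m p.1 p.2) :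
    Continuous fun p : X × ℝ => P.dact (transport (A p.1) p.2) (m p.1 p.2) :=
  (P.continuous_dact_transport hA).clm_apply hm

variable (P) in
theorem continuous_flux {X : Type*} [TopologicalSpace X] [FirstCountableTopology X]
    [LocallyCompactSpace X] {A : X → ℝ → VG} {m : X → ℝ → VE}
    (hA : Continuous fun p : X × ℝ => A p.1 p.2) (hm : Continuous fun p : X × ℝ => m p.1 p.2) :
    Continuous fun p : X × ℝ => P.flux (A p.1) (m p.1) p.2 :=
  intervalIntegral.continuous_parametric_primitive_of_continuous
    (f := fun s t => P.dact (transport (A s) t) (m s t)) (P.continuous_flux_integrand hA hm)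

variable (P) in
theorem continuous_flux_const {X : Type*} [TopologicalSpace X] [FirstCountableTopology X]
    [LocallyCompactSpace X] {A : X → ℝ → VG} {m : X → ℝ → VE}
    (hA : Continuous fun p : X × ℝ => A p.1 p.2) (hm : Continuous fun p : X × ℝ => m p.1 p.2)
    (b : ℝ) : Continuous fun s => P.flux (A s) (m s) b :=
  intervalIntegral.continuous_parametric_intervalIntegral_of_continuous'
    (f := fun s t => P.dact (transport (A s) t) (m s t)) (P.continuous_flux_integrand hA hm) 0 b

/-- The derivative of a transport in a direction in which the curvature is known. -/
theorem FlatPair.hasLogDeriv {A A' C C' : ℝ → ℝ → VG} {m : ℝ → ℝ → VE}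
    (h : P.FlatPair A A' C C' m) (s t : ℝ) :
    HasLogDeriv (fun σ => transport (G := G) (A σ) t)
      (C s t - Ad VG (transport (G := G) (A s) t)⁻¹ (P.dbd (P.flux (A s) (m s) t))) s := by
  have h1 := hasLogDeriv_transport_param (G := G) h.cont_A h.cont_A' h.deriv_A s t
  rw [integral_Ad_transport (continuous_slice h.cont_A s) (continuous_slice h.cont_A' s)
    (P.dbd.continuous.comp (continuous_slice h.cont_m s))
    (h.deriv_C s) (h.curv s) t, h.zero, sub_zero, map_sub, Ad_inv_Ad] at h1
  have h2 : ∫ τ in (0 : ℝ)..t, Ad VG (transport (G := G) (A s) τ) (P.dbd (m s τ)) =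
      P.dbd (P.flux (A s) (m s) t) := by
    simp only [← P.dbd_dact]
    exact P.dbd.intervalIntegral_comp_comm
      ((continuous_slice (A := fun s τ => P.dact (transport (A s) τ) (m s τ))
        (P.continuous_flux_integrand h.cont_A h.cont_m) s).intervalIntegrable _ _)
  exact h2 ▸ h1

/-- The variation of the transport has a local part `C` and a nonlocal part `-Ad(g⁻¹) ∂F`;
equivariance (`drep_Ad`) carries the latter through `dact g`, where it acts as `∂F`. -/
theorem FlatPair.hasDerivAt_dact {A A' C C' : ℝ → ℝ → VG} {m : ℝ → ℝ → VE}
    (h : P.FlatPair A A' C C' m) {n : ℝ → VE} {n' : VE} {s t : ℝ} (hn : HasDerivAt n n' s) :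
    HasDerivAt (fun σ => P.dact (transport (A σ) t) (n σ))
      (P.dact (transport (A s) t) (P.drep (C s t) (n s) + n') -
        P.drep (P.dbd (P.flux (A s) (m s) t)) (P.dact (transport (A s) t) (n s))) s := by
  have h1 := (P.hasDerivAt_dact (h.hasLogDeriv s t)).clm_apply hn
  convert h1 using 1
  rw [ContinuousLinearMap.comp_apply, map_sub, sub_apply, map_sub, map_add,
    ← P.drep_Ad _ (Ad VG _ _), Ad_Ad_inv]
  abel

variable (P) in
theorem continuous_deriv_flux_integrand {X : Type*} [TopologicalSpace X]
    [FirstCountableTopology X] [LocallyCompactSpace X] {A C : X → ℝ → VG} {m n n' : X → ℝ → VE}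
    (hA : Continuous fun p : X × ℝ => A p.1 p.2) (hC : Continuous fun p : X × ℝ => C p.1 p.2)
    (hm : Continuous fun p : X × ℝ => m p.1 p.2) (hn : Continuous fun p : X × ℝ => n p.1 p.2)
    (hn' : Continuous fun p : X × ℝ => n' p.1 p.2) :
    Continuous fun p : X × ℝ =>
      P.dact (transport (A p.1) p.2) (P.drep (C p.1 p.2) (n p.1 p.2) + n' p.1 p.2) -
        P.drep (P.dbd (P.flux (A p.1) (m p.1) p.2))
          (P.dact (transport (A p.1) p.2) (n p.1 p.2)) :=
  (P.continuous_flux_integrand hA (m := fun s t => P.drep (C s t) (n s t) + n' s t)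
    (((P.drep.continuous.comp hC).clm_apply hn).add hn')).sub
    ((P.drep.continuous.comp (P.dbd.continuous.comp (P.continuous_flux hA hm))).clm_apply
      (P.continuous_flux_integrand hA hn))

theorem FlatPair.hasDerivAt_flux {A A' C C' : ℝ → ℝ → VG} {m n n' : ℝ → ℝ → VE}
    (h : P.FlatPair A A' C C' m) (hn : Continuous fun p : ℝ × ℝ => n p.1 p.2)
    (hn' : Continuous fun p : ℝ × ℝ => n' p.1 p.2)
    (hd : ∀ s t, HasDerivAt (fun σ => n σ t) (n' s t) s) (s b : ℝ) :
    HasDerivAt (fun σ => P.flux (A σ) (n σ) b)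
      (∫ t in (0 : ℝ)..b, (P.dact (transport (A s) t) (P.drep (C s t) (n s t) + n' s t) -
        P.drep (P.dbd (P.flux (A s) (m s) t)) (P.dact (transport (A s) t) (n s t)))) s := by
  refine hasDerivAt_integral_of_continuous (P.continuous_flux_integrand h.cont_A hn)
    (F' := fun s t => P.dact (transport (A s) t) (P.drep (C s t) (n s t) + n' s t) -
        P.drep (P.dbd (P.flux (A s) (m s) t)) (P.dact (transport (A s) t) (n s t)))
    (P.continuous_deriv_flux_integrand h.cont_A h.cont_C h.cont_m hn hn')
    (fun s t => h.hasDerivAt_dact (hd s t)) 0 b s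

/-- The nonabelian Stokes theorem. -/
theorem FlatPair.stokes {A A' C C' : ℝ → ℝ → VG} {m : ℝ → ℝ → VE}
    (h : P.FlatPair A A' C C' m) {b : ℝ} (hb : ∀ s, C s b = 0) (s : ℝ) :
    P.bd (transport (fun σ => P.flux (A σ) (m σ) b) s) * transport (A s) b =
      transport (A 0) b := by
  have hc : Continuous fun σ => P.flux (A σ) (m σ) b :=
    P.continuous_flux_const h.cont_A h.cont_m b
  have h1 : ∀ σ, HasLogDeriv (fun σ => P.bd (transport (fun σ => P.flux (A σ) (m σ) b) σ) *
      transport (A σ) b) (0 : VG) σ := by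
    intro σ
    -- The first factor contributes `Ad(g⁻¹) ∂F` and the second `C - Ad(g⁻¹) ∂F`, with `C = 0` at
    -- the endpoint.
    have h2 := ((hasLogDeriv_transport (G := E) hc σ).map P.contMDiff_bd).mul (h.hasLogDeriv σ b)
    rwa [hb, zero_sub, show diff VE VG P.bd 1 = P.dbd from rfl, add_neg_cancel] at h2
  have h3 : ∀ a b' : ℝ, a ≤ b' → _ := fun a b' hab => eq_of_hasLogDeriv_zero (VG := VG) hab
    (fun σ _ => (h1 σ).continuousAt.continuousWithinAt) (fun σ _ => h1 σ)
  have h4 : P.bd (transport (fun σ => P.flux (A σ) (m σ) b) 0) * transport (A 0) b =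
      transport (A 0) b := by
    rw [transport_zero_time hc, map_one, one_mul]
  rcases le_total 0 s with hs | hs
  · exact (h3 0 s hs).symm.trans h4
  · exact (h3 s 0 hs).trans h4

/-- It is essential that `c` does not depend on `t`: only then does proportionality of 2-forms pass
to their integrals. The case `c = 0` serves for vanishing fluxes. -/
theorem flux_eq_smul {A : ℝ → VG} {m m' : ℝ → VE} {b c : ℝ} (hb : 0 ≤ b)
    (h : ∀ t ∈ Icc 0 b, m' t = c • m t) : P.flux A m' b = c • P.flux A m b := by
  unfold flux
  rw [← intervalIntegral.integral_smul]
  refine intervalIntegral.integral_congr fun t ht => ?_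
  rw [uIcc_of_le hb] at ht
  change P.dact _ (m' t) = c • P.dact _ (m t)
  rw [h t ht, map_smul]

/-- The mixed derivatives of the fluxes of a 2-form in two directions agree if the 2-form is
closed and horizontal along the third direction and its components are proportional. -/
theorem integral_deriv_flux_eq {A a₁ a₂ : ℝ → VG} {m₁ m₂ m₁₂ n₁ n₂ n₁₂ : ℝ → VE}
    (hA : Continuous A) (ha₁ : Continuous a₁) (hm₁ : Continuous m₁)
    (hm₂ : Continuous m₂) (hn₂ : Continuous n₂) (hn₁₂ : Continuous n₁₂)
    (hd : ∀ t, HasDerivAt m₁₂ (n₁₂ t) t) (h0 : m₁₂ 0 = 0) (h1 : m₁₂ 1 = 0)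
    (hclosed : ∀ t ∈ Icc (0 : ℝ) 1, n₁₂ t - n₂ t + n₁ t = 0)
    (hcyc : ∀ t ∈ Icc (0 : ℝ) 1,
      P.drep (A t) (m₁₂ t) - P.drep (a₁ t) (m₂ t) + P.drep (a₂ t) (m₁ t) = 0)
    (hprop : (∃ c : ℝ, ∀ t ∈ Icc (0 : ℝ) 1, m₂ t = c • m₁ t) ∨
      ∃ c : ℝ, ∀ t ∈ Icc (0 : ℝ) 1, m₁ t = c • m₂ t) :
    ∫ t in (0 : ℝ)..1, (P.dact (transport A t) (P.drep (a₂ t) (m₁ t) + n₁ t) -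
        P.drep (P.dbd (P.flux A m₂ t)) (P.dact (transport A t) (m₁ t))) =
      ∫ t in (0 : ℝ)..1, (P.dact (transport A t) (P.drep (a₁ t) (m₂ t) + n₂ t) -
        P.drep (P.dbd (P.flux A m₁ t)) (P.dact (transport A t) (m₂ t))) := by
  have hm₁₂ : Continuous m₁₂ := continuous_iff_continuousAt.2 fun t => (hd t).continuousAt
  have hR : Continuous fun t => P.dact (transport A t) :=
    P.contMDiff_dact.continuous.comp (continuous_transport hA)
  have hφ : ∀ t, HasDerivAt (fun t => P.dact (transport A t) (m₁₂ t))
      (P.dact (transport A t) (P.drep (A t) (m₁₂ t) + n₁₂ t)) t := fun t => by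
    have h := (P.hasDerivAt_dact (hasLogDeriv_transport (G := G) hA t)).clm_apply (hd t)
    rwa [ContinuousLinearMap.comp_apply, ← map_add] at h
  have hφc : Continuous fun t => P.dact (transport A t) (P.drep (A t) (m₁₂ t) + n₁₂ t) :=
    hR.clm_apply (((P.drep.continuous.comp hA).clm_apply hm₁₂).add hn₁₂)
  -- A total `t`-derivative, whose boundary terms vanish with `m₁₂`; it may be subtracted from
  -- either side.
  have hφi : ∫ t in (0 : ℝ)..1, P.dact (transport A t) (P.drep (A t) (m₁₂ t) + n₁₂ t) = 0 := by
    rw [intervalIntegral.integral_eq_sub_of_hasDerivAt (fun t _ => hφ t)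
      (hφc.intervalIntegrable _ _), h0, h1]
    simp
  have hflux : Continuous fun t => P.flux A m₁ t :=
    intervalIntegral.continuous_primitive
      (fun a b => (hR.clm_apply hm₁).intervalIntegrable a b) 0
  have hc : Continuous fun t => P.dact (transport A t) (P.drep (a₁ t) (m₂ t) + n₂ t) -
        P.drep (P.dbd (P.flux A m₁ t)) (P.dact (transport A t) (m₂ t)) :=
    (hR.clm_apply (((P.drep.continuous.comp ha₁).clm_apply hm₂).add hn₂)).sub
      ((P.drep.continuous.comp (P.dbd.continuous.comp hflux)).clm_apply (hR.clm_apply hm₂))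
  rw [← sub_zero (∫ t in (0 : ℝ)..1, (P.dact (transport A t) (P.drep (a₁ t) (m₂ t) + n₂ t) -
    P.drep (P.dbd (P.flux A m₁ t)) (P.dact (transport A t) (m₂ t)))), ← hφi,
    ← intervalIntegral.integral_sub (hc.intervalIntegrable _ _) (hφc.intervalIntegrable _ _)]
  refine intervalIntegral.integral_congr fun t ht => ?_
  rw [uIcc_of_le zero_le_one] at ht
  -- The quadratic terms agree because the same constant leaves the flux on one side and the 2-form
  -- on the other.
  have e1 : P.drep (P.dbd (P.flux A m₂ t)) (P.dact (transport A t) (m₁ t)) =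
      P.drep (P.dbd (P.flux A m₁ t)) (P.dact (transport A t) (m₂ t)) := by
    rcases hprop with ⟨c, hc⟩ | ⟨c, hc⟩
    · rw [P.flux_eq_smul ht.1 (fun τ hτ => hc τ ⟨hτ.1, hτ.2.trans ht.2⟩), hc t ht]
      simp only [map_smul, smul_apply]
    · rw [P.flux_eq_smul ht.1 (fun τ hτ => hc τ ⟨hτ.1, hτ.2.trans ht.2⟩), hc t ht]
      simp only [map_smul, smul_apply]
  -- The difference of the two sides is the sum of the expressions in `hclosed` and `hcyc`: the
  -- covariant exterior derivative of the 2-form.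
  have e2 : P.drep (a₂ t) (m₁ t) + n₁ t = P.drep (a₁ t) (m₂ t) + n₂ t -
      (P.drep (A t) (m₁₂ t) + n₁₂ t) := by
    rw [← sub_eq_zero]
    rw [← add_zero (0 : VE)]
    nth_rw 1 [← hclosed t ht, ← hcyc t ht]
    abel
  change P.dact (transport A t) _ - _ = P.dact (transport A t) _ - _ - _
  rw [e1, e2, map_sub]
  abel

end LiePreCrossedModule

end Flat

/-! ### Rank conditions and the curvature equation under pullback. -/

section PullbackLemmas

variable {V : Type*} [NormedAddCommGroup V] [NormedSpace ℝ V]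
variable {M : Type*} [TopologicalSpace M] [ChartedSpace V M]
variable {F : Type*} [NormedAddCommGroup F] [NormedSpace ℝ F]
variable {W : Type*} [NormedAddCommGroup W] [NormedSpace ℝ W]
variable {W' : Type*} [NormedAddCommGroup W'] [NormedSpace ℝ W'] {k : ℕ}

theorem Form.pull_comp (α : Form V M F k) {f : W → M} {j : W' → W} {L : W' →L[ℝ] W} {p : W'}
    (hf : ContMDiff 𝓘(ℝ, W) 𝓘(ℝ, V) ∞ f) (hj : HasFDerivAt j L p) (v : Fin k → W') :
    α.pull (fun q => f (j q)) p v = α.pull f (j p) (fun i => L (v i)) := by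
  rw [Form.pull_apply, Form.pull_apply,
    ((hf.hasDiff (j p)).comp (hasDiff_iff_hasFDerivAt.2 hj)).diff_eq]
  rfl

theorem Form.pull_congr (α : Form V M F k) {f f' : W → M} {p : W} (h : f =ᶠ[𝓝 p] f')
    (v : Fin k → W) : α.pull f p v = α.pull f' p v := by
  have h1 : diff W V f p = diff W V f' p := h.mfderiv_eq
  rw [Form.pull_apply, Form.pull_apply, h.eq_of_nhds, h1]

/-- Restrict to the line through `p` in direction `a`, on which `f` is constant near `p`. -/
theorem diff_apply_eq_zero {f : W → M} (hf : ContMDiff 𝓘(ℝ, W) 𝓘(ℝ, V) ∞ f) {p a : W} {c : M}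
    (h : ∀ᶠ r : ℝ in 𝓝 0, f (p + r • a) = c) : diff W V f p a = 0 := by
  have h0 : HasDerivAt (fun r : ℝ => p + r • a) a 0 := by
    simpa using ((hasDerivAt_id' (0 : ℝ)).smul_const a).const_add p
  have h1 := (hf.hasDiff p).comp_of_eq (hasDiff_iff_hasFDerivAt.2 h0.hasFDerivAt) (by simp)
  have h2 := h1.unique ((hasDiff_const c (0 : ℝ)).congr h)
  simpa using congrArg (fun L : ℝ →L[ℝ] V => L 1) h2

theorem Form.pull_eq_zero (α : Form V M F k) {f : W → M} {p : W} {v : Fin k → W} (i : Fin k)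
    (h : diff W V f p (v i) = 0) : α.pull f p v = 0 :=
  (α.val (f p)).map_coord_zero i h

theorem Form.pull_one (α : Form V M F 1) (f : W → M) (p a : W) :
    α.pull f p ![a] = α.val (f p) ![diff W V f p a] := by
  rw [Form.pull_apply]
  congr 1
  ext i; fin_cases i; rfl

theorem Form.pull_two (α : Form V M F 2) (f : W → M) (p a b : W) :
    α.pull f p ![a, b] = α.val (f p) ![diff W V f p a, diff W V f p b] := by
  rw [Form.pull_apply]
  congr 1
  ext i; fin_cases i <;> rfl

/-- The arguments are `k + 1` vectors in a space of dimension at most `k`, hence dependent. -/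
theorem comp_diff_eq_zero_of_rankAt_le [FiniteDimensional ℝ W] {f : W → M} {p : W}
    (h : rankAt (V := V) f p ≤ k) (β : V [⋀^Fin (k + 1)]→ₗ[ℝ] F) (v : Fin (k + 1) → W) :
    β (fun i => diff W V f p (v i)) = 0 := by
  refine β.map_linearDependent _ fun hl => ?_
  have h1 : LinearIndependent ℝ (fun i =>
      (⟨diff W V f p (v i), v i, rfl⟩ : LinearMap.range (diff W V f p).toLinearMap)) :=
    LinearIndependent.of_comp (LinearMap.range (diff W V f p).toLinearMap).subtype hl
  have h2 := h1.fintype_card_le_finrank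
  rw [Fintype.card_fin] at h2
  exact absurd (h2.trans h) (by omega)

variable [IsManifold 𝓘(ℝ, V) ∞ M]

theorem Form.d_pull_one (α : Form V M F 1) {f : W → M}
    (hf : ContMDiff 𝓘(ℝ, W) 𝓘(ℝ, V) ∞ f) (p a b : W) :
    α.d (f p) ![diff W V f p a, diff W V f p b] =
      fderiv ℝ (fun q => α.pull f q ![b]) p a - fderiv ℝ (fun q => α.pull f q ![a]) p b := by
  have h := α.d_pull hf p ![a, b]
  have e0 : (fun i => diff W V f p (![a, b] i)) = ![diff W V f p a, diff W V f p b] := by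
    ext i; fin_cases i <;> rfl
  have e1 : Fin.removeNth 0 ![a, b] = ![b] := by ext i; fin_cases i; rfl
  have e2 : Fin.removeNth 1 ![a, b] = ![a] := by ext i; fin_cases i; rfl
  rw [e0, Fin.sum_univ_two, e1, e2] at h
  refine h.trans ?_
  simp [sub_eq_add_neg]

theorem Form.d_pull_two (α : Form V M F 2) {f : W → M}
    (hf : ContMDiff 𝓘(ℝ, W) 𝓘(ℝ, V) ∞ f) (p a b c : W) :
    α.d (f p) (fun i => diff W V f p (![a, b, c] i)) =
      fderiv ℝ (fun q => α.pull f q ![b, c]) p a - fderiv ℝ (fun q => α.pull f q ![a, c]) p b +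
        fderiv ℝ (fun q => α.pull f q ![a, b]) p c := by
  have h := α.d_pull hf p ![a, b, c]
  have e1 : Fin.removeNth 0 ![a, b, c] = ![b, c] := by ext i; fin_cases i <;> rfl
  have e2 : Fin.removeNth 1 ![a, b, c] = ![a, c] := by ext i; fin_cases i <;> rfl
  have e3 : Fin.removeNth 2 ![a, b, c] = ![a, b] := by ext i; fin_cases i <;> rfl
  rw [Fin.sum_univ_three, e1, e2, e3] at h
  refine h.trans ?_
  simp [sub_eq_add_neg]

variable {VG : Type*} [NormedAddCommGroup VG] [NormedSpace ℝ VG] [FiniteDimensional ℝ VG]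
variable {G : Type*} [TopologicalSpace G] [ChartedSpace VG G] [Group G]
variable [LieGroup 𝓘(ℝ, VG) ∞ G]
variable {VE : Type*} [NormedAddCommGroup VE] [NormedSpace ℝ VE] [FiniteDimensional ℝ VE]
variable {E : Type*} [TopologicalSpace E] [ChartedSpace VE E] [Group E]
variable [LieGroup 𝓘(ℝ, VE) ∞ E]
variable {P : LiePreCrossedModule VG G VE E} {w : Form V M VG 1} {m : Form V M VE 2}

theorem LiePreCrossedModule.CurvatureEq.pull (h : P.CurvatureEq w m) {f : W → M}
    (hf : ContMDiff 𝓘(ℝ, W) 𝓘(ℝ, V) ∞ f) (p a b : W) :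
    P.dbd (m.pull f p ![a, b]) =
      fderiv ℝ (fun q => w.pull f q ![b]) p a - fderiv ℝ (fun q => w.pull f q ![a]) p b +
        ad VG G (w.pull f p ![a]) (w.pull f p ![b]) := by
  have h1 := h (f p) (diff W V f p a) (diff W V f p b)
  rw [lieAlgBracket_eq_ad] at h1
  rw [Form.pull_two, Form.pull_one, Form.pull_one]
  exact h1.trans (congrArg (· + _) (w.d_pull_one hf p a b))

/-- The algebraic consequence of linear dependence for the action of a 1-form on a 2-form. -/
theorem LiePreCrossedModule.cyclic_drep_eq_zero [FiniteDimensional ℝ W] {f : W → M} {p : W}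
    (h : rankAt (V := V) f p ≤ 2) (a b c : W) :
    P.drep (w.pull f p ![a]) (m.pull f p ![b, c]) - P.drep (w.pull f p ![b]) (m.pull f p ![a, c]) +
      P.drep (w.pull f p ![c]) (m.pull f p ![a, b]) = 0 := by
  -- The alternatization of `φ` is the wedge product of `w` with `m` under the action, a 3-form; on
  -- a map of rank at most 2 it vanishes.
  let φ : V →ₗ[ℝ] V [⋀^Fin 2]→ₗ[ℝ] VE :=
    { toFun := fun X => (P.drep (w.val (f p) ![X])).toLinearMap.compAlternatingMap
        (m.val (f p)).toAlternatingMap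
      map_add' := fun X Y => by
        have e : w.val (f p) ![X + Y] = w.val (f p) ![X] + w.val (f p) ![Y] :=
          (w.val (f p)).toAlternatingMap.map_vecCons_add ![] X Y
        ext v
        simp [e]
      map_smul' := fun r X => by
        have e : w.val (f p) ![r • X] = r • w.val (f p) ![X] :=
          (w.val (f p)).toAlternatingMap.map_vecCons_smul ![] r X
        ext v
        simp [e] }
  have h1 := comp_diff_eq_zero_of_rankAt_le h (AlternatingMap.alternatizeUncurryFin φ) ![a, b, c]
  have e0 : (fun i => diff W V f p (![a, b, c] i)) =
      ![diff W V f p a, diff W V f p b, diff W V f p c] := by ext i; fin_cases i <;> rfl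
  have e1 : ∀ x y z : V, Fin.removeNth 0 ![x, y, z] = ![y, z] := by
    intros; ext i; fin_cases i <;> rfl
  have e2 : ∀ x y z : V, Fin.removeNth 1 ![x, y, z] = ![x, z] := by
    intros; ext i; fin_cases i <;> rfl
  have e3 : ∀ x y z : V, Fin.removeNth 2 ![x, y, z] = ![x, y] := by
    intros; ext i; fin_cases i <;> rfl
  rw [e0, AlternatingMap.alternatizeUncurryFin_apply, Fin.sum_univ_three, e1, e2, e3] at h1
  simp only [Form.pull_two, Form.pull_one]
  refine Eq.trans ?_ h1
  simp [φ, sub_eq_add_neg]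

/-- An affine plane in the parameter space pulls the connection back to a `FlatPair`. Using `p`,
`a`, `b` freely allows the same statement for 2-paths and for both kinds of faces of a 3-path. -/
theorem LiePreCrossedModule.CurvatureEq.flatPair (h : P.CurvatureEq w m) {f : W → M}
    (hf : ContMDiff 𝓘(ℝ, W) 𝓘(ℝ, V) ∞ f) {p a b : W} {j : ℝ → ℝ → W}
    (hj : ∀ s t, j s t = p + t • a + s • b) (h0 : ∀ s, diff W V f (j s 0) b = 0) :
    P.FlatPair (fun s t => w.pull f (j s t) ![a])
      (fun s t => fderiv ℝ (fun q => w.pull f q ![a]) (j s t) b)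
      (fun s t => w.pull f (j s t) ![b])
      (fun s t => fderiv ℝ (fun q => w.pull f q ![b]) (j s t) a)
      (fun s t => m.pull f (j s t) ![a, b]) := by
  obtain rfl : j = fun s t => p + t • a + s • b := by funext s t; exact hj s t
  have ha := w.contDiff_pull hf ![a]
  have hb := w.contDiff_pull hf ![b]
  have hab := m.contDiff_pull hf ![a, b]
  have hc : Continuous fun q : ℝ × ℝ => p + q.2 • a + q.1 • b := by fun_prop
  have hds : ∀ s t : ℝ, HasDerivAt (fun s : ℝ => p + t • a + s • b) b s := fun s t => by
    simpa using ((hasDerivAt_id' s).smul_const b).const_add (p + t • a)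
  have hdt : ∀ s t : ℝ, HasDerivAt (fun t : ℝ => p + t • a + s • b) a t := fun s t => by
    simpa using (((hasDerivAt_id' t).smul_const a).const_add p).add_const (s • b)
  exact
    { cont_A := ha.continuous.comp hc
      cont_A' := ((ha.continuous_fderiv (by simp)).comp hc).clm_apply continuous_const
      cont_C := hb.continuous.comp hc
      cont_m := hab.continuous.comp hc
      deriv_A := fun s t => (ha.differentiable (by simp) _).hasFDerivAt.comp_hasDerivAt s (hds s t)
      deriv_C := fun s t => (hb.differentiable (by simp) _).hasFDerivAt.comp_hasDerivAt t (hdt s t)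
      curv := fun s t => h.pull hf _ a b
      zero := fun s => w.pull_eq_zero 0 (h0 s) }

end PullbackLemmas

/-! ### Consequences of collars, and restriction of forms to faces. -/

section PathCollars

variable {V : Type*} [NormedAddCommGroup V] [NormedSpace ℝ V]
variable {M : Type*} [TopologicalSpace M] [ChartedSpace V M]

/-- Near the side `t = 0` the path is constant in both variables, so all directions are killed. This
gives `C = 0` at fixed endpoints. -/
theorem Path2.diff_left (Γ : Path2 V M) (s : ℝ) (v : ℝ × ℝ) :
    diff (ℝ × ℝ) V Γ.toFun (0, s) v = 0 := by
  obtain ⟨ε, hε, h0, -⟩ := Γ.collar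
  refine diff_apply_eq_zero Γ.smooth (c := Γ (0, 0)) ?_
  have hc : Tendsto (fun r : ℝ => r * v.1) (𝓝 0) (𝓝 0) := by
    have hr : Continuous fun r : ℝ => r * v.1 := by fun_prop
    simpa using hr.tendsto 0
  filter_upwards [hc.eventually (eventually_le_nhds hε)] with r hr
  exact h0 _ _ (by simpa using hr)

theorem Path2.diff_right (Γ : Path2 V M) (s : ℝ) (v : ℝ × ℝ) :
    diff (ℝ × ℝ) V Γ.toFun (1, s) v = 0 := by
  obtain ⟨ε, hε, -, h1, -⟩ := Γ.collar
  refine diff_apply_eq_zero Γ.smooth (c := Γ (1, 0)) ?_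
  have hc : Tendsto (fun r : ℝ => r * v.1) (𝓝 0) (𝓝 0) := by
    have hr : Continuous fun r : ℝ => r * v.1 := by fun_prop
    simpa using hr.tendsto 0
  filter_upwards [hc.eventually (eventually_ge_nhds (neg_lt_zero.2 hε))] with r hr
  exact h1 _ _ (show 1 - ε ≤ 1 + r * v.1 by linarith)

theorem Path3.diff_left (J : Path3 V M) (s x : ℝ) (v : ℝ × ℝ × ℝ) :
    diff (ℝ × ℝ × ℝ) V J.toFun (0, s, x) v = 0 := by
  obtain ⟨ε, hε, h0, -⟩ := J.collar
  refine diff_apply_eq_zero J.smooth (c := J (0, 0, 0)) ?_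
  have hc : Tendsto (fun r : ℝ => r * v.1) (𝓝 0) (𝓝 0) := by
    have hr : Continuous fun r : ℝ => r * v.1 := by fun_prop
    simpa using hr.tendsto 0
  filter_upwards [hc.eventually (eventually_le_nhds hε)] with r hr
  exact h0 _ _ _ (by simpa using hr)

theorem Path3.diff_right (J : Path3 V M) (s x : ℝ) (v : ℝ × ℝ × ℝ) :
    diff (ℝ × ℝ × ℝ) V J.toFun (1, s, x) v = 0 := by
  obtain ⟨ε, hε, -, h1, -⟩ := J.collar
  refine diff_apply_eq_zero J.smooth (c := J (1, 0, 0)) ?_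
  have hc : Tendsto (fun r : ℝ => r * v.1) (𝓝 0) (𝓝 0) := by
    have hr : Continuous fun r : ℝ => r * v.1 := by fun_prop
    simpa using hr.tendsto 0
  filter_upwards [hc.eventually (eventually_ge_nhds (neg_lt_zero.2 hε))] with r hr
  exact h1 _ _ _ (show 1 - ε ≤ 1 + r * v.1 by linarith)

variable {F : Type*} [NormedAddCommGroup F] [NormedSpace ℝ F] {k : ℕ}

theorem hasFDerivAt_mk_left (t s : ℝ) : HasFDerivAt (fun τ : ℝ => (τ, s))
    (ContinuousLinearMap.inl ℝ ℝ ℝ) t :=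
  (hasFDerivAt_id t).prodMk (hasFDerivAt_const s t)

/-- The differential of the inclusion of the face `x = x₀`. -/
def faceMap3 : ℝ × ℝ →L[ℝ] ℝ × ℝ × ℝ :=
  (ContinuousLinearMap.fst ℝ ℝ ℝ).prod ((ContinuousLinearMap.snd ℝ ℝ ℝ).prod 0)

/-- The differential of the inclusion of the face `s = s₀`. -/
def faceMap2 : ℝ × ℝ →L[ℝ] ℝ × ℝ × ℝ :=
  (ContinuousLinearMap.fst ℝ ℝ ℝ).prod
    ((0 : ℝ × ℝ →L[ℝ] ℝ).prod (ContinuousLinearMap.snd ℝ ℝ ℝ))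

theorem Form.pull_slice (α : Form V M F k) (Γ : Path2 V M) (t s : ℝ) (v : Fin k → ℝ) :
    α.pull (Γ.slice s).toFun t v = α.pull Γ.toFun (t, s) (fun i => (v i, 0)) :=
  α.pull_comp Γ.smooth (hasFDerivAt_mk_left t s) v

theorem Form.pull_face3 (α : Form V M F k) (J : Path3 V M) (p : ℝ × ℝ) (x : ℝ)
    (v : Fin k → ℝ × ℝ) :
    α.pull (J.face3 x).toFun p v =
      α.pull J.toFun (p.1, p.2, x) (fun i => ((v i).1, (v i).2, 0)) :=
  α.pull_comp (j := fun q : ℝ × ℝ => (q.1, q.2, x)) (L := faceMap3) J.smooth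
    ((hasFDerivAt_fst).prodMk (hasFDerivAt_snd.prodMk (hasFDerivAt_const x p))) v

theorem Form.pull_face2 (α : Form V M F k) (J : Path3 V M) (p : ℝ × ℝ) (s : ℝ)
    (v : Fin k → ℝ × ℝ) :
    α.pull (J.face2 s).toFun p v =
      α.pull J.toFun (p.1, s, p.2) (fun i => ((v i).1, 0, (v i).2)) :=
  α.pull_comp (j := fun q : ℝ × ℝ => (q.1, s, q.2)) (L := faceMap2) J.smooth
    ((hasFDerivAt_fst).prodMk ((hasFDerivAt_const s p).prodMk hasFDerivAt_snd)) v

theorem Form.along_eq (w : Form V M F 1) (γ : Path1 V M) (t : ℝ) :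
    w.along γ t = w.pull γ.toFun t ![1] := (w.pull_one γ.toFun t 1).symm

theorem Form.along_slice (w : Form V M F 1) (Γ : Path2 V M) (t s : ℝ) :
    w.along (Γ.slice s) t = w.pull Γ.toFun (t, s) ![(1, 0)] := by
  rw [w.along_eq, w.pull_slice]
  congr 1
  ext i <;> fin_cases i <;> rfl

theorem Path2.IsThin.pull_eq_zero {Γ : Path2 V M} (h : Γ.IsThin) (m : Form V M F 2) {p : ℝ × ℝ}
    (hp : p ∈ Icc (0 : ℝ × ℝ) 1) (v : Fin 2 → ℝ × ℝ) : m.pull Γ.toFun p v = 0 :=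
  comp_diff_eq_zero_of_rankAt_le (h p hp) (m.val (Γ p)).toAlternatingMap v

end PathCollars

/-! ### Targets of 2-holonomies and rank-1 homotopy invariance. -/

section Stokes

variable {V : Type*} [NormedAddCommGroup V] [NormedSpace ℝ V]
variable {M : Type*} [TopologicalSpace M] [ChartedSpace V M]
variable {VG : Type*} [NormedAddCommGroup VG] [NormedSpace ℝ VG] [FiniteDimensional ℝ VG]
variable {G : Type*} [TopologicalSpace G] [ChartedSpace VG G] [Group G]
variable [LieGroup 𝓘(ℝ, VG) ∞ G]
variable {VE : Type*} [NormedAddCommGroup VE] [NormedSpace ℝ VE] [FiniteDimensional ℝ VE]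
variable {E : Type*} [TopologicalSpace E] [ChartedSpace VE E] [Group E]
variable [LieGroup 𝓘(ℝ, VE) ∞ E]
variable (P : LiePreCrossedModule VG G VE E) (w : Form V M VG 1) (m : Form V M VE 2)

theorem LiePreCrossedModule.along_eq_flux (Γ : Path2 V M) (s : ℝ) :
    P.along w m Γ s = P.flux (fun t => w.pull Γ.toFun (t, s) ![(1, 0)])
      (fun t => m.pull Γ.toFun (t, s) ![(1, 0), (0, 1)]) 1 := by
  have e : w.along (Γ.slice s) = fun t => w.pull Γ.toFun (t, s) ![(1, 0)] :=
    funext fun t => w.along_slice Γ t s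
  unfold LiePreCrossedModule.along LiePreCrossedModule.flux holonomyCurve
  rw [e]
  refine intervalIntegral.integral_congr fun t _ => ?_
  exact congrArg (P.dact _) (m.pull_two Γ.toFun (t, s) (1, 0) (0, 1)).symm

theorem Path2.IsThin.along_eq_zero {Γ : Path2 V M} (h : Γ.IsThin) {s : ℝ}
    (hs : s ∈ Icc (0 : ℝ) 1) : P.along w m Γ s = 0 := by
  rw [P.along_eq_flux, P.flux_eq_smul (c := 0) (m := 0) zero_le_one, zero_smul]
  intro t ht
  rw [h.pull_eq_zero m ⟨⟨ht.1, hs.1⟩, ⟨ht.2, hs.2⟩⟩, zero_smul]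

variable [IsManifold 𝓘(ℝ, V) ∞ M]

theorem Form.continuous_along (γ : Path1 V M) : Continuous (w.along γ) := by
  have e : w.along γ = fun t => w.pull γ.toFun t ![1] := funext (w.along_eq γ)
  rw [e]
  exact (w.contDiff_pull γ.smooth _).continuous

theorem LiePreCrossedModule.continuous_along (Γ : Path2 V M) : Continuous (P.along w m Γ) := by
  have e : P.along w m Γ = fun s => P.flux (fun t => w.pull Γ.toFun (t, s) ![(1, 0)])
      (fun t => m.pull Γ.toFun (t, s) ![(1, 0), (0, 1)]) 1 := funext (P.along_eq_flux w m Γ)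
  rw [e]
  exact P.continuous_flux_const (A := fun s t => w.pull Γ.toFun (t, s) ![(1, 0)])
    (m := fun s t => m.pull Γ.toFun (t, s) ![(1, 0), (0, 1)])
    ((w.contDiff_pull Γ.smooth _).continuous.comp continuous_swap)
    ((m.contDiff_pull Γ.smooth _).continuous.comp continuous_swap) 1

/-- A 2-form vanishes on a map of rank at most 1, so the coefficient of the equation for `e` is zero
on `[0, 1]`. -/
theorem Path2.IsThin.holonomy₂_eq_one {Γ : Path2 V M} (h : Γ.IsThin) : P.holonomy₂ w m Γ = 1 := by
  unfold LiePreCrossedModule.holonomy₂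
  rw [transport_congr (P.continuous_along w m Γ) continuous_const zero_le_one
    (fun s hs => h.along_eq_zero P w m ⟨hs.1.le, hs.2.le⟩), transport_zero]

variable {P w m}

/-- The target of the holonomy of a 2-path. -/
theorem LiePreCrossedModule.CurvatureEq.bd_holonomy₂_mul (hm : P.CurvatureEq w m) (Γ : Path2 V M) :
    P.bd (P.holonomy₂ w m Γ) * holonomy₁ G w Γ.top = holonomy₁ G w Γ.bot := by
  have h1 := (hm.flatPair Γ.smooth (p := 0) (a := (1, 0)) (b := (0, 1)) (j := fun s t => (t, s))
    (fun s t => by simp) (fun s => Γ.diff_left s _)).stokes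
    (fun s => w.pull_eq_zero 0 (Γ.diff_right s _)) 1
  have e : P.along w m Γ = fun s => P.flux (fun t => w.pull Γ.toFun (t, s) ![(1, 0)])
      (fun t => m.pull Γ.toFun (t, s) ![(1, 0), (0, 1)]) 1 := funext (P.along_eq_flux w m Γ)
  have e' : ∀ s, w.along (Γ.slice s) = fun t => w.pull Γ.toFun (t, s) ![(1, 0)] := fun s =>
    funext fun t => w.along_slice Γ t s
  unfold LiePreCrossedModule.holonomy₂ holonomy₁ holonomyCurve Path2.top Path2.bot
  rw [e, e', e']
  exact h1

theorem LiePreCrossedModule.CurvatureEq.holonomy₁_eq_of_isThin (hm : P.CurvatureEq w m) {Γ : Path2 V M}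
    (h : Γ.IsThin) :
    holonomy₁ G w Γ.top = holonomy₁ G w Γ.bot := by
  rw [← hm.bd_holonomy₂_mul Γ, h.holonomy₂_eq_one P w m, map_one, one_mul]

end Stokes

/-! ### Invariance of the 2-holonomy under laminated rank-2 homotopy. -/

section Laminated

variable {V : Type*} [NormedAddCommGroup V] [NormedSpace ℝ V]
variable {M : Type*} [TopologicalSpace M] [ChartedSpace V M]
variable {VG : Type*} [NormedAddCommGroup VG] [NormedSpace ℝ VG] [FiniteDimensional ℝ VG]
variable {G : Type*} [TopologicalSpace G] [ChartedSpace VG G] [Group G]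
variable [LieGroup 𝓘(ℝ, VG) ∞ G]
variable {VE : Type*} [NormedAddCommGroup VE] [NormedSpace ℝ VE] [FiniteDimensional ℝ VE]
variable {E : Type*} [TopologicalSpace E] [ChartedSpace VE E] [Group E]
variable [LieGroup 𝓘(ℝ, VE) ∞ E]

/-- If the two components of a connection have equal mixed derivatives and commute almost
everywhere, and one of them vanishes on two opposite sides of the square, then the holonomies
along the other two sides agree. -/
theorem transport_eq_of_ae {A A' C C' : ℝ → ℝ → VG}
    (hA : Continuous fun p : ℝ × ℝ => A p.1 p.2) (hA' : Continuous fun p : ℝ × ℝ => A' p.1 p.2)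
    (hC : Continuous fun p : ℝ × ℝ => C p.1 p.2) (hC' : Continuous fun p : ℝ × ℝ => C' p.1 p.2)
    (hdA : ∀ s x, HasDerivAt (fun ξ => A s ξ) (A' s x) x)
    (hdC : ∀ s x, HasDerivAt (fun σ => C σ x) (C' s x) s)
    (h0 : ∀ x ∈ Icc (0 : ℝ) 1, C 0 x = 0) (h1 : ∀ x ∈ Icc (0 : ℝ) 1, C 1 x = 0)
    (hae : ∀ᵐ p : ℝ × ℝ ∂(volume.restrict (Ioo (0 : ℝ) 1 ×ˢ Ioo (0 : ℝ) 1)),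
      C' p.1 p.2 = A' p.1 p.2 ∧ ad VG G (A p.1 p.2) (C p.1 p.2) = 0) :
    transport (G := G) (fun s => A s 0) 1 = transport (fun s => A s 1) 1 := by
  have hAx : Continuous fun p : ℝ × ℝ => A p.2 p.1 := hA.comp continuous_swap
  have hAx' : Continuous fun p : ℝ × ℝ => A' p.2 p.1 := hA'.comp continuous_swap
  have hZc : Continuous fun p : ℝ × ℝ =>
      C' p.1 p.2 - A' p.1 p.2 + ad VG G (A p.1 p.2) (C p.1 p.2) :=
    (hC'.sub hA').add (((ad VG G).continuous.comp hA).clm_apply hC)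
  -- Almost everywhere is not enough on a single line of constant `x`, which is a null set;
  -- continuity of the curvature upgrades it to the whole open square.
  have hZ : EqOn (fun p : ℝ × ℝ => C' p.1 p.2 - A' p.1 p.2 + ad VG G (A p.1 p.2) (C p.1 p.2))
      (fun _ => 0) (Ioo (0 : ℝ) 1 ×ˢ Ioo (0 : ℝ) 1) := by
    refine Measure.eqOn_open_of_ae_eq (μ := volume) ?_ (isOpen_Ioo.prod isOpen_Ioo)
      hZc.continuousOn continuousOn_const
    filter_upwards [hae] with p hp
    rw [hp.1, hp.2, sub_self, add_zero]
  have hd := hasLogDeriv_transport_param (G := G) (A := fun x s => A s x)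
    (A' := fun x s => A' s x) hAx hAx' (fun x s => hdA s x)
  refine eq_of_hasLogDeriv_zero (VG := VG) (f := fun x => transport (G := G) (fun s => A s x) 1)
    zero_le_one (fun x _ => (hd x 1).continuousAt.continuousWithinAt) fun x hx => ?_
  have h3 : ∫ s in (0 : ℝ)..1, Ad VG (transport (G := G) (fun s => A s x) s)
      (C' s x - A' s x + ad VG G (A s x) (C s x)) = 0 := by
    rw [intervalIntegral.integral_of_le zero_le_one, integral_Ioc_eq_integral_Ioo]
    refine setIntegral_eq_zero_of_forall_eq_zero fun s hs => ?_
    rw [show C' s x - A' s x + ad VG G (A s x) (C s x) = 0 from hZ (x := (s, x)) ⟨hs, hx⟩, map_zero]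
  have h4 := integral_Ad_transport (G := G) (A := fun s => A s x) (A' := fun s => A' s x)
    (C := fun s => C s x) (C' := fun s => C' s x)
    (Z := fun s => C' s x - A' s x + ad VG G (A s x) (C s x))
    (continuous_slice (A := fun x s => A s x) hAx x)
    (continuous_slice (A := fun x s => A' s x) hAx' x)
    (continuous_slice (A := fun x s => C' s x - A' s x + ad VG G (A s x) (C s x))
      (hZc.comp continuous_swap) x) (fun s => hdC s x) (fun s => rfl) 1
  rw [h3, h0 x ⟨hx.1.le, hx.2.le⟩, h1 x ⟨hx.1.le, hx.2.le⟩, map_zero, sub_zero, sub_zero] at h4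
  have h2 := hd x 1
  rwa [h4, map_zero] at h2

variable [IsManifold 𝓘(ℝ, V) ∞ M]
variable {P : LiePreCrossedModule VG G VE E} {w : Form V M VG 1} {m : Form V M VE 2}

/-- At almost all points, the components of a 2-form on a laminated homotopy are proportional. -/
theorem Path3.pull_proportional {J : Path3 V M} {s x : ℝ}
    (h : J.LaminatedAt s x ∨ J.PathSpaceThinAt s x) (m : Form V M VE 2) :
    (∃ c : ℝ, ∀ t ∈ Icc (0 : ℝ) 1, m.pull J.toFun (t, s, x) ![(1, 0, 0), (0, 0, 1)] =
      c • m.pull J.toFun (t, s, x) ![(1, 0, 0), (0, 1, 0)]) ∨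
    ∃ c : ℝ, ∀ t ∈ Icc (0 : ℝ) 1, m.pull J.toFun (t, s, x) ![(1, 0, 0), (0, 1, 0)] =
      c • m.pull J.toFun (t, s, x) ![(1, 0, 0), (0, 0, 1)] := by
  -- In the two laminated cases one component vanishes, so the factor is `0`. In the remaining case
  -- the `x`-derivative is `-(a / b)` times the `s`-derivative, for all `t` at once.
  rcases h with (h | h) | ⟨a, b, ha, hb, h⟩
  · refine Or.inr ⟨0, fun t ht => ?_⟩
    have h1 : m.pull (J.face3 x).toFun (t, s) ![(1, 0), (0, 1)] = 0 :=
      comp_diff_eq_zero_of_rankAt_le (h t ht) (m.val (J (t, s, x))).toAlternatingMap _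
    rw [zero_smul, ← h1, m.pull_face3]
    congr 1
    ext i <;> fin_cases i <;> rfl
  · refine Or.inl ⟨0, fun t ht => ?_⟩
    have h1 : m.pull (J.face2 s).toFun (t, x) ![(1, 0), (0, 1)] = 0 :=
      comp_diff_eq_zero_of_rankAt_le (h t ht) (m.val (J (t, s, x))).toAlternatingMap _
    rw [zero_smul, ← h1, m.pull_face2]
    congr 1
    ext i <;> fin_cases i <;> rfl
  · refine Or.inl ⟨-(b⁻¹ * a), fun t ht => ?_⟩
    have h1 : a • diff (ℝ × ℝ × ℝ) V J.toFun (t, s, x) (0, 1, 0) +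
      b • diff (ℝ × ℝ × ℝ) V J.toFun (t, s, x) (0, 0, 1) = 0 := h t ht
    have h2 : diff (ℝ × ℝ × ℝ) V J.toFun (t, s, x) (0, 0, 1) =
        -(b⁻¹ * a) • diff (ℝ × ℝ × ℝ) V J.toFun (t, s, x) (0, 1, 0) := by
      rw [neg_smul, mul_smul, eq_neg_iff_add_eq_zero, add_comm, ← smul_right_injective V hb |>.eq_iff]
      simp only [smul_add, smul_zero, smul_inv_smul₀ hb]
      exact h1
    rw [Form.pull_two, Form.pull_two, h2]
    have h3 := (m.val (J (t, s, x))).map_update_smul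
      ![diff (ℝ × ℝ × ℝ) V J.toFun (t, s, x) (1, 0, 0), 0] 1 (-(b⁻¹ * a))
      (diff (ℝ × ℝ × ℝ) V J.toFun (t, s, x) (0, 1, 0))
    have h4 : ∀ u v : V, Function.update ![u, 0] 1 v = ![u, v] := fun u v => by
      ext i; fin_cases i <;> rfl
    rwa [h4, h4] at h3

theorem Path2.IsThin.pull_face2_eq_zero {J : Path3 V M} {s : ℝ} (h : (J.face2 s).IsThin)
    (m : Form V M VE 2) {t x : ℝ} (ht : t ∈ Icc (0 : ℝ) 1) (hx : x ∈ Icc (0 : ℝ) 1) :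
    m.pull J.toFun (t, s, x) ![(1, 0, 0), (0, 0, 1)] = 0 := by
  rw [← h.pull_eq_zero m (p := (t, x)) ⟨⟨ht.1, hx.1⟩, ⟨ht.2, hx.2⟩⟩ ![(1, 0), (0, 1)],
    m.pull_face2]
  congr 1
  ext i <;> fin_cases i <;> rfl

theorem LiePreCrossedModule.along_face3 (P : LiePreCrossedModule VG G VE E) (w : Form V M VG 1)
    (m : Form V M VE 2) (J : Path3 V M) (s x : ℝ) :
    P.along w m (J.face3 x) s = P.flux (fun t => w.pull J.toFun (t, s, x) ![(1, 0, 0)])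
      (fun t => m.pull J.toFun (t, s, x) ![(1, 0, 0), (0, 1, 0)]) 1 := by
  rw [P.along_eq_flux]
  have e1 : ∀ t, w.pull (J.face3 x).toFun (t, s) ![(1, 0)] =
      w.pull J.toFun (t, s, x) ![(1, 0, 0)] := fun t => by
    rw [w.pull_face3]
    congr 1
    ext i <;> fin_cases i <;> rfl
  have e2 : ∀ t, m.pull (J.face3 x).toFun (t, s) ![(1, 0), (0, 1)] =
      m.pull J.toFun (t, s, x) ![(1, 0, 0), (0, 1, 0)] := fun t => by
    rw [m.pull_face3]
    congr 1
    ext i <;> fin_cases i <;> rfl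
  simp only [e1, e2]

/-- Laminated rank-2 homotopic 2-paths have the same holonomy. -/
theorem LiePreCrossedModule.CurvatureEq.holonomy₂_eq (hm : P.CurvatureEq w m) {Γ Γ' : Path2 V M}
    (h : LaminatedHomotopic Γ Γ') : P.holonomy₂ w m Γ = P.holonomy₂ w m Γ' := by
  obtain ⟨J, rfl, rfl, hJ0, hJ1, hr, hae⟩ := h
  let T : ℝ × ℝ × ℝ := (1, 0, 0)
  let S : ℝ × ℝ × ℝ := (0, 1, 0)
  let X : ℝ × ℝ × ℝ := (0, 0, 1)
  let a (s x t : ℝ) : VG := w.pull J.toFun (t, s, x) ![T]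
  let as (s x t : ℝ) : VG := w.pull J.toFun (t, s, x) ![S]
  let ax (s x t : ℝ) : VG := w.pull J.toFun (t, s, x) ![X]
  let ms (s x t : ℝ) : VE := m.pull J.toFun (t, s, x) ![T, S]
  let mx (s x t : ℝ) : VE := m.pull J.toFun (t, s, x) ![T, X]
  let msx (s x t : ℝ) : VE := m.pull J.toFun (t, s, x) ![S, X]
  let dms (s x t : ℝ) : VE := fderiv ℝ (fun q => m.pull J.toFun q ![T, S]) (t, s, x) X
  let dmx (s x t : ℝ) : VE := fderiv ℝ (fun q => m.pull J.toFun q ![T, X]) (t, s, x) S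
  let dmsx (s x t : ℝ) : VE := fderiv ℝ (fun q => m.pull J.toFun q ![S, X]) (t, s, x) T
  have hc : Continuous fun p : (ℝ × ℝ) × ℝ => (p.2, p.1.1, p.1.2) := by fun_prop
  have hw (u : ℝ × ℝ × ℝ) : Continuous fun p : (ℝ × ℝ) × ℝ =>
      w.pull J.toFun (p.2, p.1.1, p.1.2) ![u] := (w.contDiff_pull J.smooth _).continuous.comp hc
  have hmc (u v : ℝ × ℝ × ℝ) : Continuous fun p : (ℝ × ℝ) × ℝ =>
      m.pull J.toFun (p.2, p.1.1, p.1.2) ![u, v] :=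
    (m.contDiff_pull J.smooth _).continuous.comp hc
  have hmd (u v z : ℝ × ℝ × ℝ) : Continuous fun p : (ℝ × ℝ) × ℝ =>
      fderiv ℝ (fun q => m.pull J.toFun q ![u, v]) (p.2, p.1.1, p.1.2) z :=
    (((m.contDiff_pull J.smooth _).continuous_fderiv (by simp)).comp hc).clm_apply
      continuous_const
  have hmh (u v : ℝ × ℝ × ℝ) (q : ℝ × ℝ × ℝ) : HasFDerivAt (fun q => m.pull J.toFun q ![u, v])
      (fderiv ℝ (fun q => m.pull J.toFun q ![u, v]) q) q :=
    ((m.contDiff_pull J.smooth _).differentiable (by simp) q).hasFDerivAt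
  have hdt (s x t : ℝ) : HasDerivAt (fun t : ℝ => (t, s, x)) T t :=
    (hasDerivAt_id' t).prodMk (hasDerivAt_const t (s, x))
  have hds (s x t : ℝ) : HasDerivAt (fun s : ℝ => (t, s, x)) S s :=
    (hasDerivAt_const s t).prodMk ((hasDerivAt_id' s).prodMk (hasDerivAt_const s x))
  have hdx (s x t : ℝ) : HasDerivAt (fun x : ℝ => (t, s, x)) X x :=
    (hasDerivAt_const x t).prodMk ((hasDerivAt_const x s).prodMk (hasDerivAt_id' x))
  have hfs (x : ℝ) := hm.flatPair J.smooth (p := (0, 0, x)) (a := T) (b := S)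
    (j := fun s t => (t, s, x)) (fun s t => by simp [T, S]) (fun s => J.diff_left s x _)
  have hfx (s : ℝ) := hm.flatPair J.smooth (p := (0, s, 0)) (a := T) (b := X)
    (j := fun x t => (t, s, x)) (fun s t => by simp [T, X]) (fun x => J.diff_left s x _)
  -- `D₁` is the `x`-derivative of the flux in the `(t, s)` direction, and `D₂` the `s`-derivative
  -- of the flux in the `(t, x)` direction.
  let D₁ (s x : ℝ) : VE :=
    ∫ t in (0 : ℝ)..1, (P.dact (transport (a s x) t) (P.drep (ax s x t) (ms s x t) + dms s x t) -
        P.drep (P.dbd (P.flux (a s x) (mx s x) t)) (P.dact (transport (a s x) t) (ms s x t)))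
  let D₂ (s x : ℝ) : VE :=
    ∫ t in (0 : ℝ)..1, (P.dact (transport (a s x) t) (P.drep (as s x t) (mx s x t) + dmx s x t) -
        P.drep (P.dbd (P.flux (a s x) (ms s x) t)) (P.dact (transport (a s x) t) (mx s x t)))
  have hD₁ : Continuous fun p : ℝ × ℝ => D₁ p.1 p.2 :=
    intervalIntegral.continuous_parametric_intervalIntegral_of_continuous'
      (P.continuous_deriv_flux_integrand (X := ℝ × ℝ) (A := fun p => a p.1 p.2)
        (C := fun p => ax p.1 p.2) (m := fun p => mx p.1 p.2) (n := fun p => ms p.1 p.2)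
        (n' := fun p => dms p.1 p.2) (hw T) (hw X) (hmc T X) (hmc T S) (hmd T S X)) 0 1
  have hD₂ : Continuous fun p : ℝ × ℝ => D₂ p.1 p.2 :=
    intervalIntegral.continuous_parametric_intervalIntegral_of_continuous'
      (P.continuous_deriv_flux_integrand (X := ℝ × ℝ) (A := fun p => a p.1 p.2)
        (C := fun p => as p.1 p.2) (m := fun p => ms p.1 p.2) (n := fun p => mx p.1 p.2)
        (n' := fun p => dmx p.1 p.2) (hw T) (hw S) (hmc T S) (hmc T X) (hmd T X S)) 0 1
  -- The two fluxes are the components of a connection on the `(s, x)` square; its flatness and the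
  -- vanishing of the `x`-component on the sides `s = 0, 1` give the equality.
  have key : transport (G := E) (fun s => P.flux (a s 0) (ms s 0) 1) 1 =
      transport (fun s => P.flux (a s 1) (ms s 1) 1) 1 := by
    refine transport_eq_of_ae (A := fun s x => P.flux (a s x) (ms s x) 1) (A' := D₁)
      (C := fun s x => P.flux (a s x) (mx s x) 1) (C' := D₂) ?_ hD₁ ?_ hD₂ ?_ ?_ ?_ ?_ ?_
    · exact P.continuous_flux_const (X := ℝ × ℝ) (A := fun p => a p.1 p.2)
        (m := fun p => ms p.1 p.2) (hw T) (hmc T S) 1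
    · exact P.continuous_flux_const (X := ℝ × ℝ) (A := fun p => a p.1 p.2)
        (m := fun p => mx p.1 p.2) (hw T) (hmc T X) 1
    · intro s x
      have hcs : Continuous fun p : ℝ × ℝ => (((s, p.1), p.2) : (ℝ × ℝ) × ℝ) := by fun_prop
      exact (hfx s).hasDerivAt_flux (n := fun x t => ms s x t) (n' := fun x t => dms s x t)
        ((hmc T S).comp hcs) ((hmd T S X).comp hcs)
        (fun x t => (hmh T S _).comp_hasDerivAt x (hdx s x t)) x 1
    · intro s x
      have hcs : Continuous fun p : ℝ × ℝ => (((p.1, x), p.2) : (ℝ × ℝ) × ℝ) := by fun_prop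
      exact (hfs x).hasDerivAt_flux (n := fun s t => mx s x t) (n' := fun s t => dmx s x t)
        ((hmc T X).comp hcs) ((hmd T X S).comp hcs)
        (fun s t => (hmh T X _).comp_hasDerivAt s (hds s x t)) s 1
    · exact fun x hx => (P.flux_eq_smul (c := 0) (m := 0) zero_le_one fun t ht =>
        (hJ0.pull_face2_eq_zero m ht hx).trans (zero_smul _ _).symm).trans (zero_smul _ _)
    · exact fun x hx => (P.flux_eq_smul (c := 0) (m := 0) zero_le_one fun t ht =>
        (hJ1.pull_face2_eq_zero m ht hx).trans (zero_smul _ _).symm).trans (zero_smul _ _)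
    · refine (ae_restrict_iff' (measurableSet_Ioo.prod measurableSet_Ioo)).2 ?_
      rw [ae_restrict_iff' (measurableSet_Ioo.prod measurableSet_Ioo)] at hae
      filter_upwards [hae] with p hp hpI
      have hprop := Path3.pull_proportional (hp hpI) m
      have hI : ∀ t ∈ Icc (0 : ℝ) 1, (t, p.1, p.2) ∈ Icc (0 : ℝ × ℝ × ℝ) 1 := fun t ht =>
        ⟨⟨ht.1, hpI.1.1.le, hpI.2.1.le⟩, ⟨ht.2, hpI.1.2.le, hpI.2.2.le⟩⟩
      have hct : Continuous fun t : ℝ => ((p, t) : (ℝ × ℝ) × ℝ) := by fun_prop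
      constructor
      · refine (P.integral_deriv_flux_eq (n₁₂ := dmsx p.1 p.2) (m₁₂ := msx p.1 p.2)
          ((hw T).comp hct) ((hw S).comp hct) ((hmc T S).comp hct) ((hmc T X).comp hct)
          ((hmd T X S).comp hct) ((hmd S X T).comp hct)
          (fun t => (hmh S X _).comp_hasDerivAt t (hdt p.1 p.2 t))
          (m.pull_eq_zero 0 (J.diff_left _ _ _)) (m.pull_eq_zero 0 (J.diff_right _ _ _))
          (fun t ht => ?_) (fun t ht => P.cyclic_drep_eq_zero (hr _ (hI t ht)) T S X) hprop).symm
        refine (m.d_pull_two J.smooth (t, p.1, p.2) T S X).symm.trans ?_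
        exact comp_diff_eq_zero_of_rankAt_le (hr _ (hI t ht))
          (show V [⋀^Fin 3]→L[ℝ] VE from m.d (J (t, p.1, p.2))).toAlternatingMap ![T, S, X]
      -- The bracket of the two fluxes vanishes because they are proportional.
      · rcases hprop with ⟨c, hc⟩ | ⟨c, hc⟩
        · rw [P.flux_eq_smul zero_le_one hc, map_smul, ad_self, smul_zero]
        · rw [P.flux_eq_smul zero_le_one hc, map_smul, smul_apply, ad_self, smul_zero]
  unfold LiePreCrossedModule.holonomy₂
  rw [funext (P.along_face3 w m J · 0), funext (P.along_face3 w m J · 1)]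
  exact key

end Laminated

/-! ### Local form of concatenations and their effect on forms. -/

section PathOperations

variable {V : Type*} [NormedAddCommGroup V] [NormedSpace ℝ V]
variable {M : Type*} [TopologicalSpace M] [ChartedSpace V M]
variable {F : Type*} [NormedAddCommGroup F] [NormedSpace ℝ F] {k : ℕ}

theorem Form.along_eq_smul (w : Form V M F 1) {γ γ' : Path1 V M} {c d t : ℝ}
    (h : γ.toFun =ᶠ[𝓝 t] fun τ => γ' (c * τ + d)) :
    w.along γ t = c • w.along γ' (c * t + d) := by
  have hj : HasDerivAt (fun τ : ℝ => c * τ + d) c t := by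
    simpa using ((hasDerivAt_id' t).const_mul c).add_const d
  rw [w.along_eq, w.along_eq, w.pull_congr h, w.pull_comp γ'.smooth hj.hasFDerivAt]
  have h3 := (w.pull γ'.toFun (c * t + d)).map_update_smul ![0] 0 c 1
  have h4 : ∀ u : ℝ, Function.update ![(0 : ℝ)] 0 u = ![u] := fun u => by
    ext i; fin_cases i; rfl
  rw [h4, h4] at h3
  rw [← h3]
  congr 1
  ext i; fin_cases i; simp

theorem Form.pull_reparam (α : Form V M F k) {Γ Γ' : Path2 V M} {a b c d : ℝ} {p : ℝ × ℝ}
    (h : Γ.toFun =ᶠ[𝓝 p] fun q => Γ' (a * q.1 + b, c * q.2 + d)) (v : Fin k → ℝ × ℝ) :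
    α.pull Γ.toFun p v = α.pull Γ'.toFun (a * p.1 + b, c * p.2 + d)
      (fun i => (a * (v i).1, c * (v i).2)) := by
  have h1 : HasFDerivAt (fun q : ℝ × ℝ => a * q.1 + b) (a • ContinuousLinearMap.fst ℝ ℝ ℝ) p :=
    (hasFDerivAt_fst.const_mul a).add_const b
  have h2 : HasFDerivAt (fun q : ℝ × ℝ => c * q.2 + d) (c • ContinuousLinearMap.snd ℝ ℝ ℝ) p :=
    (hasFDerivAt_snd.const_mul c).add_const d
  rw [α.pull_congr h, α.pull_comp Γ'.smooth (h1.prodMk h2)]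
  rfl

/-- The Jacobian factor of a diagonal reparametrisation; for each concatenation it equals `2`, as
only one coordinate is doubled. -/
theorem pull_scale (m : Form V M F 2) (Γ : Path2 V M) (p : ℝ × ℝ) (a c : ℝ) :
    m.pull Γ.toFun p (fun i => (a * ((![(1, 0), (0, 1)] : Fin 2 → ℝ × ℝ) i).1,
      c * ((![(1, 0), (0, 1)] : Fin 2 → ℝ × ℝ) i).2)) =
      (a * c) • m.pull Γ.toFun p ![(1, 0), (0, 1)] := by
  have h := (m.pull Γ.toFun p).map_smul_univ ![a, c] ![(1, 0), (0, 1)]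
  rw [Fin.prod_univ_two] at h
  refine Eq.trans (congrArg _ ?_) h
  ext i <;> fin_cases i <;> simp

theorem Path1.comp_eventuallyEq_left {γ φ : Path1 V M} (h : γ 1 = φ 0) {t : ℝ} (ht : t < 1 / 2) :
    (γ.comp φ h).toFun =ᶠ[𝓝 t] fun τ => γ (2 * τ + 0) := by
  filter_upwards [eventually_lt_nhds ht] with τ hτ
  rw [add_zero]
  exact if_pos hτ.le

theorem Path1.comp_eventuallyEq_right {γ φ : Path1 V M} (h : γ 1 = φ 0) {t : ℝ} (ht : 1 / 2 < t) :
    (γ.comp φ h).toFun =ᶠ[𝓝 t] fun τ => φ (2 * τ + -1) := by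
  filter_upwards [eventually_gt_nhds ht] with τ hτ
  exact if_neg (not_le.2 hτ)

theorem Path2.vcomp_eventuallyEq_left {Γ Γ' : Path2 V M} (h : Γ.top = Γ'.bot) {p : ℝ × ℝ}
    (hp : p.2 < 1 / 2) :
    (Γ.vcomp Γ' h).toFun =ᶠ[𝓝 p] fun q => Γ (1 * q.1 + 0, 2 * q.2 + 0) := by
  filter_upwards [continuous_snd.continuousAt.eventually (eventually_lt_nhds hp)] with q hq
  rw [add_zero, add_zero, one_mul]
  exact if_pos hq.le

theorem Path2.vcomp_eventuallyEq_right {Γ Γ' : Path2 V M} (h : Γ.top = Γ'.bot) {p : ℝ × ℝ}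
    (hp : 1 / 2 < p.2) :
    (Γ.vcomp Γ' h).toFun =ᶠ[𝓝 p] fun q => Γ' (1 * q.1 + 0, 2 * q.2 + -1) := by
  filter_upwards [continuous_snd.continuousAt.eventually (eventually_gt_nhds hp)] with q hq
  rw [add_zero, one_mul]
  exact if_neg (not_le.2 hq)

theorem Path2.hcomp_eventuallyEq_left {Γ Γ' : Path2 V M} (h : Γ (1, 0) = Γ' (0, 0)) {p : ℝ × ℝ}
    (hp : p.1 < 1 / 2) :
    (Γ.hcomp Γ' h).toFun =ᶠ[𝓝 p] fun q => Γ (2 * q.1 + 0, 1 * q.2 + 0) := by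
  filter_upwards [continuous_fst.continuousAt.eventually (eventually_lt_nhds hp)] with q hq
  rw [add_zero, add_zero, one_mul]
  exact if_pos hq.le

theorem Path2.hcomp_eventuallyEq_right {Γ Γ' : Path2 V M} (h : Γ (1, 0) = Γ' (0, 0)) {p : ℝ × ℝ}
    (hp : 1 / 2 < p.1) :
    (Γ.hcomp Γ' h).toFun =ᶠ[𝓝 p] fun q => Γ' (2 * q.1 + -1, 1 * q.2 + 0) := by
  filter_upwards [continuous_fst.continuousAt.eventually (eventually_gt_nhds hp)] with q hq
  rw [add_zero, one_mul]
  exact if_neg (not_le.2 hq)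

theorem Path2.slice_one_eq (Γ : Path2 V M) (s : ℝ) : Γ (1, s) = Γ (1, 0) := by
  obtain ⟨ε, hε, -, h1, -⟩ := Γ.collar
  exact h1 1 s (by linarith)

theorem Path2.slice_zero_eq (Γ : Path2 V M) (s : ℝ) : Γ (0, s) = Γ (0, 0) := by
  obtain ⟨ε, hε, h0, -⟩ := Γ.collar
  exact h0 0 s hε.le

theorem Path2.slice_match {Γ Γ' : Path2 V M} (h : Γ (1, 0) = Γ' (0, 0)) (s : ℝ) :
    (Γ.slice s) 1 = (Γ'.slice s) 0 :=
  (Γ.slice_one_eq s).trans (h.trans (Γ'.slice_zero_eq s).symm)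

theorem Path2.slice_hcomp {Γ Γ' : Path2 V M} (h : Γ (1, 0) = Γ' (0, 0)) (s : ℝ) :
    (Γ.hcomp Γ' h).slice s = (Γ.slice s).comp (Γ'.slice s) (Path2.slice_match h s) :=
  rfl

/-- An identity 2-path factors through the line. -/
theorem Path1.isThin_id2 (γ : Path1 V M) : γ.id2.IsThin := fun v _ =>
  (rankAt_comp_le γ.smooth (ContinuousLinearMap.fst ℝ ℝ ℝ) v).trans (by simp)

end PathOperations

/-! ### Holonomy of composites and the morphism of sesquigroupoids. -/

section Holonomies

variable {V : Type*} [NormedAddCommGroup V] [NormedSpace ℝ V]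
variable {M : Type*} [TopologicalSpace M] [ChartedSpace V M] [IsManifold 𝓘(ℝ, V) ∞ M]
variable {VG : Type*} [NormedAddCommGroup VG] [NormedSpace ℝ VG] [FiniteDimensional ℝ VG]
variable {G : Type*} [TopologicalSpace G] [ChartedSpace VG G] [Group G]
variable [LieGroup 𝓘(ℝ, VG) ∞ G]
variable {VE : Type*} [NormedAddCommGroup VE] [NormedSpace ℝ VE] [FiniteDimensional ℝ VE]
variable {E : Type*} [TopologicalSpace E] [ChartedSpace VE E] [Group E]
variable [LieGroup 𝓘(ℝ, VE) ∞ E]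
variable (P : LiePreCrossedModule VG G VE E) (w : Form V M VG 1) (m : Form V M VE 2)

theorem holonomyCurve_comp {γ φ : Path1 V M} (h : γ 1 = φ 0) :
    (∀ t ∈ Icc (0 : ℝ) (1 / 2),
      holonomyCurve G w (γ.comp φ h) t = holonomyCurve G w γ (2 * t)) ∧
    (∀ t ∈ Icc (1 / 2 : ℝ) 1,
      holonomyCurve G w (γ.comp φ h) t = holonomy₁ G w γ * holonomyCurve G w φ (2 * t - 1)) := by
  refine transport_concat (w.continuous_along _) (w.continuous_along _) (w.continuous_along _)
    (fun t ht => ?_) (fun t ht => ?_)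
  · rw [w.along_eq_smul (Path1.comp_eventuallyEq_left h ht.2), add_zero]
  · rw [w.along_eq_smul (Path1.comp_eventuallyEq_right h ht.1), ← sub_eq_add_neg]

theorem holonomy₁_comp {γ φ : Path1 V M} (h : γ 1 = φ 0) :
    holonomy₁ G w (γ.comp φ h) = holonomy₁ G w γ * holonomy₁ G w φ := by
  refine ((holonomyCurve_comp w h).2 1 (by norm_num)).trans ?_
  norm_num
  rfl

theorem holonomy₁_const (p : M) : holonomy₁ G w (Path1.const p) = 1 := by
  have h : ∀ t, w.along (Path1.const p) t = 0 := fun t => by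
    rw [w.along_eq]
    refine w.pull_eq_zero 0 ?_
    exact congrArg (fun L : ℝ →L[ℝ] V => L 1) (hasDiff_const p t).diff_eq
  unfold holonomy₁ holonomyCurve
  rw [funext h, transport_zero]

namespace LiePreCrossedModule

theorem along_vcomp_left {Γ Γ' : Path2 V M} (h : Γ.top = Γ'.bot) {s : ℝ} (hs : s < 1 / 2) :
    P.along w m (Γ.vcomp Γ' h) s = (2 : ℝ) • P.along w m Γ (2 * s) := by
  have hw : ∀ t, w.pull (Γ.vcomp Γ' h).toFun (t, s) ![(1, 0)] =
      w.pull Γ.toFun (t, 2 * s) ![(1, 0)] := fun t => by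
    rw [w.pull_reparam (Path2.vcomp_eventuallyEq_left h (p := (t, s)) hs)]
    simp only [one_mul, add_zero]
    congr 1
    ext i <;> fin_cases i <;> simp
  have hm : ∀ t, m.pull (Γ.vcomp Γ' h).toFun (t, s) ![(1, 0), (0, 1)] =
      (2 : ℝ) • m.pull Γ.toFun (t, 2 * s) ![(1, 0), (0, 1)] := fun t => by
    rw [m.pull_reparam (Path2.vcomp_eventuallyEq_left h (p := (t, s)) hs), pull_scale]
    simp only [one_mul, add_zero]
  rw [P.along_eq_flux, P.along_eq_flux]
  simp only [hw]
  exact P.flux_eq_smul zero_le_one fun t _ => hm t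

theorem along_vcomp_right {Γ Γ' : Path2 V M} (h : Γ.top = Γ'.bot) {s : ℝ} (hs : 1 / 2 < s) :
    P.along w m (Γ.vcomp Γ' h) s = (2 : ℝ) • P.along w m Γ' (2 * s - 1) := by
  have hw : ∀ t, w.pull (Γ.vcomp Γ' h).toFun (t, s) ![(1, 0)] =
      w.pull Γ'.toFun (t, 2 * s - 1) ![(1, 0)] := fun t => by
    rw [w.pull_reparam (Path2.vcomp_eventuallyEq_right h (p := (t, s)) hs)]
    simp only [one_mul, add_zero, ← sub_eq_add_neg]
    congr 1
    ext i <;> fin_cases i <;> simp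
  have hm : ∀ t, m.pull (Γ.vcomp Γ' h).toFun (t, s) ![(1, 0), (0, 1)] =
      (2 : ℝ) • m.pull Γ'.toFun (t, 2 * s - 1) ![(1, 0), (0, 1)] := fun t => by
    rw [m.pull_reparam (Path2.vcomp_eventuallyEq_right h (p := (t, s)) hs), pull_scale]
    simp only [one_mul, add_zero, ← sub_eq_add_neg]
  rw [P.along_eq_flux, P.along_eq_flux]
  simp only [hw]
  exact P.flux_eq_smul zero_le_one fun t _ => hm t

theorem holonomy₂_vcomp {Γ Γ' : Path2 V M} (h : Γ.top = Γ'.bot) :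
    P.holonomy₂ w m (Γ.vcomp Γ' h) = P.holonomy₂ w m Γ * P.holonomy₂ w m Γ' := by
  have h1 := (transport_concat (G := E) (P.continuous_along w m (Γ.vcomp Γ' h))
    (P.continuous_along w m Γ) (P.continuous_along w m Γ')
    (fun s hs => P.along_vcomp_left w m h hs.2) (fun s hs => P.along_vcomp_right w m h hs.1)).2 1
    (by norm_num)
  refine h1.trans ?_
  norm_num
  rfl

/-- The flux integral splits at `t = 1 / 2`. On the second half the transport already contains the
holonomy of the first path, which leaves the integral as a constant linear map. -/
theorem along_hcomp {Γ Γ' : Path2 V M} (h : Γ (1, 0) = Γ' (0, 0)) (s : ℝ) :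
    P.along w m (Γ.hcomp Γ' h) s =
      P.along w m Γ s + P.dact (holonomy₁ G w (Γ.slice s)) (P.along w m Γ' s) := by
  let f (Γ : Path2 V M) (t : ℝ) : VE := P.dact (holonomyCurve G w (Γ.slice s) t)
    (m.pull Γ.toFun (t, s) ![(1, 0), (0, 1)])
  have hf : ∀ Γ : Path2 V M, P.along w m Γ s = ∫ t in (0 : ℝ)..1, f Γ t := fun Γ =>
    intervalIntegral.integral_congr fun t _ =>
      congrArg (P.dact _) (m.pull_two Γ.toFun (t, s) (1, 0) (0, 1)).symm
  have hc : ∀ Γ : Path2 V M, Continuous (f Γ) := fun Γ =>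
    (P.contMDiff_dact.continuous.comp (continuous_transport (w.continuous_along _))).clm_apply
      ((m.contDiff_pull Γ.smooth _).continuous.comp (by fun_prop : Continuous fun t : ℝ => (t, s)))
  have h1 : ∫ t in (0 : ℝ)..(1 / 2), f (Γ.hcomp Γ' h) t = ∫ t in (0 : ℝ)..1, f Γ t := by
    have e : ∫ t in (0 : ℝ)..(1 / 2), f (Γ.hcomp Γ' h) t =
        ∫ t in (0 : ℝ)..(1 / 2), (2 : ℝ) • f Γ (2 * t) := by
      -- Open intervals, since the composite is identified with a half of the concatenation only on
      -- a neighbourhood of `t` away from `1 / 2`.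
      refine intervalIntegral.integral_congr_Ioo_of_le (by norm_num) fun t ht => ?_
      change P.dact _ _ = (2 : ℝ) • P.dact _ _
      rw [Path2.slice_hcomp h s, (holonomyCurve_comp w _).1 t ⟨ht.1.le, ht.2.le⟩,
        m.pull_reparam (Path2.hcomp_eventuallyEq_left h (p := (t, s)) ht.2), pull_scale]
      simp only [one_mul, mul_one, add_zero, map_smul]
    rw [e, intervalIntegral.integral_smul, intervalIntegral.smul_integral_comp_mul_left]
    norm_num
  have h2 : ∫ t in (1 / 2 : ℝ)..1, f (Γ.hcomp Γ' h) t =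
      P.dact (holonomy₁ G w (Γ.slice s)) (∫ t in (0 : ℝ)..1, f Γ' t) := by
    have e : ∫ t in (1 / 2 : ℝ)..1, f (Γ.hcomp Γ' h) t =
        ∫ t in (1 / 2 : ℝ)..1, (2 : ℝ) • P.dact (holonomy₁ G w (Γ.slice s)) (f Γ' (2 * t - 1)) := by
      refine intervalIntegral.integral_congr_Ioo_of_le (by norm_num) fun t ht => ?_
      change P.dact _ _ = (2 : ℝ) • P.dact _ (P.dact _ _)
      rw [Path2.slice_hcomp h s, (holonomyCurve_comp w _).2 t ⟨ht.1.le, ht.2.le⟩, P.dact_mul,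
        m.pull_reparam (Path2.hcomp_eventuallyEq_right h (p := (t, s)) ht.1), pull_scale]
      simp only [one_mul, mul_one, add_zero, map_smul, ← sub_eq_add_neg]
      rfl
    rw [e, intervalIntegral.integral_smul, intervalIntegral.smul_integral_comp_mul_sub
      (fun t => P.dact (holonomy₁ G w (Γ.slice s)) (f Γ' t))]
    norm_num
    exact (P.dact _).intervalIntegral_comp_comm ((hc Γ').intervalIntegrable _ _)
  rw [hf, hf, hf, ← h2, ← h1, intervalIntegral.integral_add_adjacent_intervals
    ((hc _).intervalIntegrable _ _) ((hc _).intervalIntegrable _ _)]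

theorem holonomy₂_whiskerRight {Γ : Path2 V M} {γ : Path1 V M} (h : Γ (1, 0) = γ 0) :
    P.holonomy₂ w m (Γ.hcomp γ.id2 h) = P.holonomy₂ w m Γ := by
  refine transport_congr (P.continuous_along w m _) (P.continuous_along w m _) zero_le_one
    fun s hs => ?_
  refine (P.along_hcomp w m (Γ' := γ.id2) h s).trans ?_
  rw [γ.isThin_id2.along_eq_zero P w m ⟨hs.1.le, hs.2.le⟩, map_zero, add_zero]

/-- The flux is that of `Γ` acted on by the holonomy of `γ`, which does not depend on `s`; a smooth
automorphism of `E` carries transports to transports. -/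
theorem holonomy₂_whiskerLeft {Γ : Path2 V M} {γ : Path1 V M} (h : γ 1 = Γ (0, 0)) :
    P.holonomy₂ w m (γ.id2.hcomp Γ h) = P.act (holonomy₁ G w γ) (P.holonomy₂ w m Γ) := by
  have h1 := transport_map (P.continuous_along w m Γ)
    (h := (P.act (holonomy₁ G w γ)).toMonoidHom) (P.contMDiff_act_apply (holonomy₁ G w γ)) 1
  refine Eq.trans ?_ h1
  refine transport_congr (P.continuous_along w m _)
    ((P.dact (holonomy₁ G w γ)).continuous.comp (P.continuous_along w m Γ)) zero_le_one
    fun s hs => ?_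
  refine (P.along_hcomp w m (Γ := γ.id2) h s).trans ?_
  rw [γ.isThin_id2.along_eq_zero P w m ⟨hs.1.le, hs.2.le⟩, zero_add]
  rfl

variable {P w m}

/-- The morphism given by holonomy. -/
def CurvatureEq.holonomy (hm : P.CurvatureEq w m) : SesquiHom (tracks V M) P.sesqui := by
  have h₁ : ∀ φ γ : Path1 V M, Rank1Homotopic φ γ → holonomy₁ G w φ = holonomy₁ G w γ := by
    rintro _ _ ⟨Γ, rfl, rfl, h⟩
    exact hm.holonomy₁_eq_of_isThin h
  have h₂ : ∀ Γ Γ' : Path2 V M, LaminatedHomotopic Γ Γ' →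
      (holonomy₁ G w Γ.bot, P.holonomy₂ w m Γ) = (holonomy₁ G w Γ'.bot, P.holonomy₂ w m Γ') := by
    intro Γ Γ' h
    refine Prod.ext ?_ (hm.holonomy₂_eq h)
    obtain ⟨J, rfl, rfl, hJ, -⟩ := h
    exact (hm.holonomy₁_eq_of_isThin hJ).symm
  have htop : ∀ Γ : Path2 V M,
      (P.bd (P.holonomy₂ w m Γ))⁻¹ * holonomy₁ G w Γ.bot = holonomy₁ G w Γ.top := fun Γ => by
    rw [← hm.bd_holonomy₂_mul Γ, inv_mul_cancel_left]
  let F₁ : Track1 V M → G := Quot.lift (fun γ => holonomy₁ G w γ) h₁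
  let F₂ : Track2 V M → G × E :=
    Quot.lift (fun Γ => (holonomy₁ G w Γ.bot, P.holonomy₂ w m Γ)) h₂
  have hsrc : ∀ a, P.sesqui.src₂ (F₂ a) = F₁ ((tracks V M).src₂ a) := by
    rintro ⟨Γ⟩
    rfl
  have htgt : ∀ a, P.sesqui.tgt₂ (F₂ a) = F₁ ((tracks V M).tgt₂ a) := by
    rintro ⟨Γ⟩
    exact htop Γ
  have hcomp : ∀ a b c, (tracks V M).comp₂ a b c → P.sesqui.comp₂ (F₂ a) (F₂ b) (F₂ c) := by
    rintro _ _ _ ⟨Γ, H, Γ', h, h', hH, rfl, rfl, rfl⟩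
    refine ⟨?_, ?_⟩
    · change holonomy₁ G w Γ'.bot = (P.bd (P.holonomy₂ w m Γ))⁻¹ * holonomy₁ G w Γ.bot
      have e : (Γ.vcomp H h).top = H.top := by
        ext t
        change (if (1 : ℝ) ≤ 1 / 2 then _ else H (t, 2 * 1 - 1)) = H (t, 1)
        norm_num
      -- Composability in the target: the thin `H` joins the top of `Γ` to the bottom of `Γ'`
      -- without changing the 1-holonomy.
      rw [htop, h, ← h', e, hm.holonomy₁_eq_of_isThin hH]
    · have e : ((Γ.vcomp H h).vcomp Γ' h').bot = Γ.bot := by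
        ext t
        change (if (0 : ℝ) ≤ 1 / 2 then
          (if 2 * (0 : ℝ) ≤ 1 / 2 then Γ (t, 2 * (2 * 0)) else _) else _) = Γ (t, 0)
        norm_num
      change (holonomy₁ G w ((Γ.vcomp H h).vcomp Γ' h').bot,
        P.holonomy₂ w m ((Γ.vcomp H h).vcomp Γ' h')) =
          (holonomy₁ G w Γ.bot, P.holonomy₂ w m Γ * P.holonomy₂ w m Γ')
      rw [e, P.holonomy₂_vcomp, P.holonomy₂_vcomp, hH.holonomy₂_eq_one, mul_one]
  have hleft : ∀ a b c, (tracks V M).whiskerLeft a b c →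
      P.sesqui.whiskerLeft (F₁ a) (F₂ b) (F₂ c) := by
    rintro _ _ _ ⟨γ, Γ, h, rfl, rfl, rfl⟩
    exact Prod.ext (holonomy₁_comp w (φ := Γ.bot) h) (P.holonomy₂_whiskerLeft w m h)
  have hright : ∀ a b c, (tracks V M).whiskerRight a b c →
      P.sesqui.whiskerRight (F₂ a) (F₁ b) (F₂ c) := by
    rintro _ _ _ ⟨Γ, γ, h, rfl, rfl, rfl⟩
    exact Prod.ext (holonomy₁_comp w (γ := Γ.bot) h) (P.holonomy₂_whiskerRight w m h)
  exact
    { map₀ := fun _ => ()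
      map₁ := F₁
      map₂ := F₂
      map_src₁ := fun _ => rfl
      map_tgt₁ := fun _ => rfl
      map_src₂ := hsrc
      map_tgt₂ := htgt
      map_id₁ := fun p => (holonomy₁_const w p : holonomy₁ G w (Path1.const p) = 1)
      map_id₂ := by
        rintro ⟨γ⟩
        exact Prod.ext rfl (γ.isThin_id2.holonomy₂_eq_one P w m)
      map_comp₁ := by
        rintro _ _ _ ⟨γ, φ, h, rfl, rfl, rfl⟩
        exact holonomy₁_comp w h
      map_comp₂ := hcomp
      map_whiskerLeft := hleft
      map_whiskerRight := hright
      map_hcompMinus := by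
        rintro a b c ⟨p, q, hp, hq, hc⟩
        -- Horizontal composites are built from whiskerings by boundaries and a vertical
        -- composition, so preservation is formal.
        exact ⟨F₂ p, F₂ q, hsrc b ▸ hright _ _ _ hp, htgt a ▸ hleft _ _ _ hq, hcomp _ _ _ hc⟩
      map_hcompPlus := by
        rintro a b c ⟨p, q, hp, hq, hc⟩
        exact ⟨F₂ p, F₂ q, hsrc a ▸ hleft _ _ _ hp, htgt b ▸ hright _ _ _ hq, hcomp _ _ _ hc⟩ }

end LiePreCrossedModule

end Holonomies

end Holonomy

end

theorem mainTheorem11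
    {V : Type*} [NormedAddCommGroup V] [NormedSpace ℝ V] [FiniteDimensional ℝ V]
    {M : Type*} [TopologicalSpace M] [ChartedSpace V M] [IsManifold 𝓘(ℝ, V) ∞ M]
    {VG : Type*} [NormedAddCommGroup VG] [NormedSpace ℝ VG] [FiniteDimensional ℝ VG]
    {G : Type*} [TopologicalSpace G] [ChartedSpace VG G] [Group G] [LieGroup 𝓘(ℝ, VG) ∞ G]
    {VE : Type*} [NormedAddCommGroup VE] [NormedSpace ℝ VE] [FiniteDimensional ℝ VE]
    {E : Type*} [TopologicalSpace E] [ChartedSpace VE E] [Group E] [LieGroup 𝓘(ℝ, VE) ∞ E]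
    (P : LiePreCrossedModule VG G VE E)
    (w : Form V M VG 1) (m : Form V M VE 2) (hm : P.CurvatureEq w m) :
    (∀ γ : Path1 V M, ∃! g : ℝ → G, IsTransport (w.along γ) g) ∧
    (∀ Γ : Path2 V M, ∃! e : ℝ → E, IsTransport (P.along w m Γ) e) ∧
    ∃ F : SesquiHom (tracks V M) P.sesqui,
      (∀ γ : Path1 V M, F.map₁ γ.track = holonomy₁ G w γ) ∧
      (∀ Γ : Path2 V M, F.map₂ Γ.track = (holonomy₁ G w Γ.bot, P.holonomy₂ w m Γ)) := by
  exact ⟨fun γ => existsUnique_isTransport (w.continuous_along γ),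
    fun Γ => existsUnique_isTransport (P.continuous_along w m Γ),
    hm.holonomy, fun _ => rfl, fun _ => rfl⟩
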